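/- Let $d\ge 1$, $0<\alpha\le 1$, and let $\Omega\subset\mathbb R^{d+1}$ be a bounded domain (a bounded, connected, non-empty open set) whose boundary is of class $C^{1,\alpha}$, i.e. near each boundary point, in suitable Cartesian coordinates, $\Omega$ is the region strictly below the graph of a $C^1$ function with $\alpha$-Hölder continuous derivative. Let $\sigma$ be the surface measure on $\partial\Omega$, $\nu_x$ the outward unit normal at $x\in\partial\Omega$, and $\omega_{d+1}$ the area of the unit sphere in $\mathbb R^{d+1}$. Function spaces are over $\mathbb R$ or over $\mathbb C$. For $f\in L^2(\partial\Omega)$ and a.e. $x\in\partial\Omega$ put $$\mathcal K[f](x)=-\frac1{\omega_{d+1}}\,\mathrm{p.v.}\!\int_{\partial\Omega}\frac{(x-y)\cdot\nu_y}{|x-y|^{d+1}}f(y)\,d\sigma(y),\qquad \mathcal K^*[f](x)=\frac1{\omega_{d+1}}\,\mathrm{p.v.}\!\int_{\partial\Omega}\frac{(x-y)\cdot\nu_x}{|x-y|^{d+1}}f(y)\,d\sigma(y),$$ where $\mathrm{p.v.}$ is the limit as $\varepsilon\to0^+$ of the integrals over $\{|x-y|>\varepsilon\}$. Let $H^{1/2}(\partial\Omega)$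 be the space of $f\in L^2(\partial\Omega)$ with $$\|f\|_{H^{1/2}}^2=\|f\|_{L^2}^2+\int_{\partial\Omega\times\partial\Omega}\frac{|f(x)-f(y)|^2}{|x-y|^{d+1}}\,d\sigma(x)\,d\sigma(y)<\infty,$$ and let $H^{-1/2}(\partial\Omega)$ be the space of bounded linear functionals on $H^{1/2}(\partial\Omega)$ with the dual norm; $u\in L^2(\partial\Omega)$ is regarded as the element $h\mapsto\int_{\partial\Omega}u\,h\,d\sigma$ of $H^{-1/2}(\partial\Omega)$. On $H^{-1/2}(\partial\Omega)$ the operator $\mathcal K^*$ is the extension by continuity from $L^2(\partial\Omega)$: $\mathcal K^*[g]=g'$ when there are $u_n\in L^2(\partial\Omega)$ with $u_n\to g$ and $\mathcal K^*[u_n]\to g'$ in $H^{-1/2}(\partial\Omega)$. Then: (i) every eigenfunction of $\mathcal K$ in $L^2(\partial\Omega)$ corresponding to a non-zero eigenvalue belongs to $H^{1/2}(\partial\Omega)$; (ii) every eigenfunction of $\mathcal K^*$ in $H^{-1/2}(\partial\Omega)$ corresponding to a non-zero eigenvalue belongs to $L^2(\partial\Omega)$. -/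

import Mathlib

open MeasureTheory Set Filter Topology
open scoped ENNReal InnerProductSpace

noncomputable section

namespace NeumannPoincare

/-- The boundary of `Ω` is of class `C^{1,α}`: near each boundary point there is a Cartesian
coordinate system `Φ` of `ℝ^{d+1} = ℝ^d × ℝ` (Euclidean product) in which `Ω` is the region strictly
below the graph of a `C¹` function whose derivative is Hölder continuous with exponent `α`. -/
def HasC1HolderBoundary {d : ℕ} (α : ℝ) (Ω : Set (EuclideanSpace ℝ (Fin (d + 1)))) : Prop :=
  ∀ p ∈ frontier Ω,
    ∃ Φ : EuclideanSpace ℝ (Fin (d + 1)) ≃ᵃⁱ[ℝ] WithLp 2 (EuclideanSpace ℝ (Fin d) × ℝ),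
    ∃ φ : EuclideanSpace ℝ (Fin d) → ℝ,
      ContDiff ℝ 1 φ ∧
      (∃ C : ℝ, ∀ u v, ‖fderiv ℝ φ u - fderiv ℝ φ v‖ ≤ C * ‖u - v‖ ^ α) ∧
      ∃ r > 0, ∀ x ∈ Metric.ball p r, (x ∈ Ω ↔ (Φ x).snd < φ (Φ x).fst)

/-- `n` is the outward unit normal of `Ω` at `x`: `Ω` is tangent at `x` to the half-space
`{y | ⟪y - x, n⟫ < 0}`, that is, near `x` it contains every cone `⟪y - x, n⟫ < -ε |y - x|` and
misses every cone `⟪y - x, n⟫ > ε |y - x|`. -/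
def IsOutwardUnitNormal {d : ℕ} (Ω : Set (EuclideanSpace ℝ (Fin (d + 1))))
    (x n : EuclideanSpace ℝ (Fin (d + 1))) : Prop :=
  ‖n‖ = 1 ∧ ∀ ε > 0, ∃ δ > 0, ∀ y ∈ Metric.ball x δ,
    (⟪y - x, n⟫_ℝ < -(ε * ‖y - x‖) → y ∈ Ω) ∧ (ε * ‖y - x‖ < ⟪y - x, n⟫_ℝ → y ∉ Ω)

/-- The outward unit normal is unique, so the choice in `outwardNormal` is no choice. -/
theorem IsOutwardUnitNormal.unique {d : ℕ} {Ω : Set (EuclideanSpace ℝ (Fin (d + 1)))}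
    {x n m : EuclideanSpace ℝ (Fin (d + 1))} (hn : IsOutwardUnitNormal Ω x n)
    (hm : IsOutwardUnitNormal Ω x m) : n = m := by
  by_contra hne
  have hv : 0 < ‖n - m‖ := norm_pos_iff.2 (sub_ne_zero.2 hne)
  have hsq : ‖n - m‖ ^ 2 = 2 - 2 * ⟪m, n⟫_ℝ := by
    rw [norm_sub_sq_real, hn.1, hm.1, real_inner_comm]; ring
  have h1 : ⟪n - m, n⟫_ℝ = ‖n - m‖ ^ 2 / 2 := by
    rw [hsq, inner_sub_left, real_inner_self_eq_norm_sq, hn.1]; ring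
  have h2 : ⟪n - m, m⟫_ℝ = -(‖n - m‖ ^ 2 / 2) := by
    rw [hsq, inner_sub_left, real_inner_self_eq_norm_sq, hm.1, real_inner_comm]; ring
  obtain ⟨δ, hδ, H⟩ := hn.2 (‖n - m‖ / 4) (by positivity)
  obtain ⟨δ', hδ', H'⟩ := hm.2 (‖n - m‖ / 4) (by positivity)
  obtain ⟨t, ht, ht'⟩ : ∃ t : ℝ, 0 < t ∧ t * ‖n - m‖ < min δ δ' := by
    refine ⟨min δ δ' / (2 * ‖n - m‖), by positivity, ?_⟩
    have : 0 < min δ δ' := lt_min hδ hδ'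
    field_simp
    linarith
  have hy : ‖x + t • (n - m) - x‖ = t * ‖n - m‖ := by
    rw [add_sub_cancel_left, norm_smul, Real.norm_of_nonneg ht.le]
  have hpos : 0 < t * ‖n - m‖ ^ 2 := by positivity
  refine (H (x + t • (n - m)) ?_).2 ?_ ((H' (x + t • (n - m)) ?_).1 ?_)
  · rw [mem_ball_iff_norm, hy]; exact ht'.trans_le (min_le_left _ _)
  · rw [hy, add_sub_cancel_left, real_inner_smul_left, h1]; nlinarith
  · rw [mem_ball_iff_norm, hy]; exact ht'.trans_le (min_le_right _ _)
  · rw [hy, add_sub_cancel_left, real_inner_smul_left, h2]; nlinarith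

open Classical in
/-- The outward unit normal `ν_x` (only used on the boundary of a `C¹` domain, where it exists). -/
def outwardNormal {d : ℕ} (Ω : Set (EuclideanSpace ℝ (Fin (d + 1))))
    (x : EuclideanSpace ℝ (Fin (d + 1))) : EuclideanSpace ℝ (Fin (d + 1)) :=
  if h : ∃ n, IsOutwardUnitNormal Ω x n then h.choose else 0

/-- The surface measure `σ` of `∂Ω`: `d`-dimensional Hausdorff measure, normalized so that it is
Lebesgue measure on `ℝ^d`. -/
def surfaceMeasure {d : ℕ} (Ω : Set (EuclideanSpace ℝ (Fin (d + 1)))) :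
    Measure (EuclideanSpace ℝ (Fin (d + 1))) :=
  (Measure.euclideanHausdorffMeasure d).restrict (frontier Ω)

/-- The area `ω_{d+1}` of the unit sphere in `ℝ^{d+1}`. -/
def sphereArea (d : ℕ) : ℝ :=
  (Measure.euclideanHausdorffMeasure d
    (Metric.sphere (0 : EuclideanSpace ℝ (Fin (d + 1))) 1)).toReal

/-- The kernel of the operator `K`. -/
def kernelK {d : ℕ} (Ω : Set (EuclideanSpace ℝ (Fin (d + 1))))
    (x y : EuclideanSpace ℝ (Fin (d + 1))) : ℝ :=
  -(1 / sphereArea d) * (⟪x - y, outwardNormal Ω y⟫_ℝ / ‖x - y‖ ^ (d + 1))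

/-- The kernel of the operator `K*`. -/
def kernelKStar {d : ℕ} (Ω : Set (EuclideanSpace ℝ (Fin (d + 1))))
    (x y : EuclideanSpace ℝ (Fin (d + 1))) : ℝ :=
  (1 / sphereArea d) * (⟪x - y, outwardNormal Ω x⟫_ℝ / ‖x - y‖ ^ (d + 1))

/-- The Hilbert space `L²(∂Ω)` of (classes of) `𝕜`-valued functions. -/
abbrev L2 (𝕜 : Type*) [RCLike 𝕜] {d : ℕ} (Ω : Set (EuclideanSpace ℝ (Fin (d + 1)))) :=
  Lp 𝕜 2 (surfaceMeasure Ω)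

/-- The integral operator with kernel `k` on `∂Ω`, in the sense of the Cauchy principal value, maps
`f` to `w`: at almost every `x ∈ ∂Ω`, the integral of `k(x, y) f(y)` over `|x - y| > ε` converges
to `w(x)` as `ε → 0+`. -/
def PVMapsTo {𝕜 : Type*} [RCLike 𝕜] {d : ℕ} (Ω : Set (EuclideanSpace ℝ (Fin (d + 1))))
    (k : EuclideanSpace ℝ (Fin (d + 1)) → EuclideanSpace ℝ (Fin (d + 1)) → ℝ)
    (f w : L2 𝕜 Ω) : Prop :=
  ∀ᵐ x ∂(surfaceMeasure Ω),
    Tendsto (fun ε : ℝ ↦ ∫ y in {y | ε < ‖x - y‖}, (k x y : 𝕜) * f y ∂(surfaceMeasure Ω))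
      (𝓝[>] 0) (𝓝 (w x))

/-- `f ∈ L²(∂Ω)` is an eigenfunction of `K` for the eigenvalue `c`. -/
def IsEigenfunctionK {𝕜 : Type*} [RCLike 𝕜] {d : ℕ} (Ω : Set (EuclideanSpace ℝ (Fin (d + 1))))
    (c : 𝕜) (f : L2 𝕜 Ω) : Prop :=
  f ≠ 0 ∧ PVMapsTo Ω (kernelK Ω) f (c • f)

/-- The square of the Gagliardo seminorm of order `1/2`,
`∫ |f(x) - f(y)|² / |x - y|^{d+1} dσ(x) dσ(y)` over `∂Ω × ∂Ω`. -/
def gagliardoSq {𝕜 : Type*} [RCLike 𝕜] {d : ℕ} (Ω : Set (EuclideanSpace ℝ (Fin (d + 1))))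
    (f : EuclideanSpace ℝ (Fin (d + 1)) → 𝕜) : ℝ≥0∞ :=
  ∫⁻ z, ‖f z.1 - f z.2‖ₑ ^ 2 / ‖z.1 - z.2‖ₑ ^ (d + 1)
    ∂((surfaceMeasure Ω).prod (surfaceMeasure Ω))

theorem gagliardoSq_congr {𝕜 : Type*} [RCLike 𝕜] {d : ℕ}
    {Ω : Set (EuclideanSpace ℝ (Fin (d + 1)))} {f g : EuclideanSpace ℝ (Fin (d + 1)) → 𝕜}
    (h : f =ᵐ[surfaceMeasure Ω] g) : gagliardoSq Ω f = gagliardoSq Ω g := by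
  refine lintegral_congr_ae ?_
  filter_upwards [Measure.quasiMeasurePreserving_fst.ae h,
    Measure.quasiMeasurePreserving_snd.ae h] with z hx hy
  rw [hx, hy]

/-- The Sobolev space `H^{1/2}(∂Ω)`, as a subspace of `L²(∂Ω)`. -/
def HHalf (𝕜 : Type*) [RCLike 𝕜] {d : ℕ} (Ω : Set (EuclideanSpace ℝ (Fin (d + 1)))) :
    Submodule 𝕜 (L2 𝕜 Ω) where
  carrier := {f | gagliardoSq Ω f < ∞}
  zero_mem' := by
    change gagliardoSq Ω _ < ∞
    rw [gagliardoSq_congr (Lp.coeFn_zero 𝕜 2 (surfaceMeasure Ω))]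
    simp [gagliardoSq]
  add_mem' := by
    intro f g hf hg
    change gagliardoSq Ω _ < ∞
    rw [gagliardoSq_congr (Lp.coeFn_add f g)]
    have hf' : StronglyMeasurable f := Lp.stronglyMeasurable f
    have hmeas : Measurable fun z : EuclideanSpace ℝ (Fin (d + 1)) ×
        EuclideanSpace ℝ (Fin (d + 1)) ↦
        2 * (‖f z.1 - f z.2‖ₑ ^ 2 / ‖z.1 - z.2‖ₑ ^ (d + 1)) := by
      have h2 := ((hf'.comp_measurable measurable_fst).sub
        (hf'.comp_measurable measurable_snd)).enorm
      have h3 : Measurable fun z : EuclideanSpace ℝ (Fin (d + 1)) ×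
          EuclideanSpace ℝ (Fin (d + 1)) ↦ ‖z.1 - z.2‖ₑ := by fun_prop
      exact ((h2.pow_const 2).div (h3.pow_const (d + 1))).const_mul 2
    have key : gagliardoSq Ω (⇑f + ⇑g) ≤ 2 * gagliardoSq Ω f + 2 * gagliardoSq Ω g := by
      unfold gagliardoSq
      rw [← lintegral_const_mul' _ _ (by simp), ← lintegral_const_mul' _ _ (by simp),
        ← lintegral_add_left hmeas]
      refine lintegral_mono fun z ↦ ?_
      simp only [Pi.add_apply]
      rw [← mul_div_assoc, ← mul_div_assoc, ← ENNReal.add_div]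
      gcongr
      have hE : ‖f z.1 + g z.1 - (f z.2 + g z.2)‖ₑ ≤
          ‖f z.1 - f z.2‖ₑ + ‖g z.1 - g z.2‖ₑ := by
        rw [add_sub_add_comm]; exact enorm_add_le _ _
      refine (pow_le_pow_left' hE 2).trans ?_
      simp only [enorm_eq_nnnorm]
      norm_cast
      rw [← NNReal.coe_le_coe]
      push_cast
      nlinarith [sq_nonneg (‖f z.1 - f z.2‖ - ‖g z.1 - g z.2‖)]
    exact key.trans_lt (ENNReal.add_lt_top.2
      ⟨ENNReal.mul_lt_top (by simp) hf, ENNReal.mul_lt_top (by simp) hg⟩)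
  smul_mem' := by
    intro c f hf
    change gagliardoSq Ω _ < ∞
    rw [gagliardoSq_congr (Lp.coeFn_smul c f)]
    have key : gagliardoSq Ω (c • ⇑f) = ‖c‖ₑ ^ 2 * gagliardoSq Ω f := by
      unfold gagliardoSq
      rw [← lintegral_const_mul' _ _ (by simp)]
      refine lintegral_congr fun z ↦ ?_
      rw [Pi.smul_apply, Pi.smul_apply, ← smul_sub, enorm_smul, mul_pow, mul_div_assoc]
    rw [key]
    exact ENNReal.mul_lt_top (by simp) hf

/-- The norm of `H^{1/2}(∂Ω)`. -/
def hHalfNorm {𝕜 : Type*} [RCLike 𝕜] {d : ℕ} {Ω : Set (EuclideanSpace ℝ (Fin (d + 1)))}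
    (h : HHalf 𝕜 Ω) : ℝ :=
  Real.sqrt (‖(h : L2 𝕜 Ω)‖ ^ 2 + (gagliardoSq Ω (h : L2 𝕜 Ω)).toReal)

/-- The space `H^{-1/2}(∂Ω)`: the linear functionals on `H^{1/2}(∂Ω)` that are bounded with
respect to the norm of `H^{1/2}(∂Ω)`. -/
def HNegHalf (𝕜 : Type*) [RCLike 𝕜] {d : ℕ} (Ω : Set (EuclideanSpace ℝ (Fin (d + 1)))) :
    Submodule 𝕜 (HHalf 𝕜 Ω →ₗ[𝕜] 𝕜) where
  carrier := {g | ∃ C : ℝ, ∀ h, ‖g h‖ ≤ C * hHalfNorm h}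
  zero_mem' := ⟨0, by simp⟩
  add_mem' := by
    rintro g g' ⟨C, hC⟩ ⟨C', hC'⟩
    refine ⟨C + C', fun h ↦ ?_⟩
    rw [LinearMap.add_apply, add_mul]
    exact (norm_add_le _ _).trans (add_le_add (hC h) (hC' h))
  smul_mem' := by
    rintro c g ⟨C, hC⟩
    refine ⟨‖c‖ * C, fun h ↦ ?_⟩
    rw [LinearMap.smul_apply, norm_smul, mul_assoc]
    exact mul_le_mul_of_nonneg_left (hC h) (norm_nonneg c)

/-- The duality pairing `∫ u h dσ` through which `u ∈ L²(∂Ω)` acts on `h ∈ H^{1/2}(∂Ω)`. -/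
def pairing {𝕜 : Type*} [RCLike 𝕜] {d : ℕ} {Ω : Set (EuclideanSpace ℝ (Fin (d + 1)))}
    (u : L2 𝕜 Ω) (h : HHalf 𝕜 Ω) : 𝕜 :=
  ∫ x, u x * (h : L2 𝕜 Ω) x ∂(surfaceMeasure Ω)

/-- `g ∈ H^{-1/2}(∂Ω)` belongs to `L²(∂Ω)`. -/
def BelongsToL2 {𝕜 : Type*} [RCLike 𝕜] {d : ℕ} {Ω : Set (EuclideanSpace ℝ (Fin (d + 1)))}
    (g : HNegHalf 𝕜 Ω) : Prop :=
  ∃ u : L2 𝕜 Ω, ∀ h : HHalf 𝕜 Ω, g.1 h = pairing u h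

/-- A sequence in `L²(∂Ω)` converges to `g` in the (dual) norm of `H^{-1/2}(∂Ω)`. -/
def TendstoHNegHalf {𝕜 : Type*} [RCLike 𝕜] {d : ℕ} {Ω : Set (EuclideanSpace ℝ (Fin (d + 1)))}
    (u : ℕ → L2 𝕜 Ω) (g : HNegHalf 𝕜 Ω) : Prop :=
  ∃ ε : ℕ → ℝ, Tendsto ε atTop (𝓝 0) ∧
    ∀ n (h : HHalf 𝕜 Ω), ‖pairing (u n) h - g.1 h‖ ≤ ε n * hHalfNorm h

/-- The graph of `K*` on `H^{-1/2}(∂Ω)`, where `K*` acts as the extension by continuity of the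
principal value operator on `L²(∂Ω)`: `K* g = g'` when some `uₙ ∈ L²(∂Ω)` satisfy `uₙ → g` and
`K*[uₙ] → g'` in `H^{-1/2}(∂Ω)`. -/
def KStarMapsTo {𝕜 : Type*} [RCLike 𝕜] {d : ℕ} (Ω : Set (EuclideanSpace ℝ (Fin (d + 1))))
    (g g' : HNegHalf 𝕜 Ω) : Prop :=
  ∃ u w : ℕ → L2 𝕜 Ω, (∀ n, PVMapsTo Ω (kernelKStar Ω) (u n) (w n)) ∧
    TendstoHNegHalf u g ∧ TendstoHNegHalf w g'

/-- `g ∈ H^{-1/2}(∂Ω)` is an eigenfunction of `K*` for the eigenvalue `c`. -/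
def IsEigenfunctionKStar {𝕜 : Type*} [RCLike 𝕜] {d : ℕ}
    (Ω : Set (EuclideanSpace ℝ (Fin (d + 1)))) (c : 𝕜) (g : HNegHalf 𝕜 Ω) : Prop :=
  g ≠ 0 ∧ KStarMapsTo Ω g (c • g)

end NeumannPoincare

end

/-! The kernel of `K` on a `C^{1,α}` boundary is of size `|x - y|^{α - d}`, because chords of length
`ρ` make an angle `O(ρ^α)` with the tangent plane, and it is Lipschitz in its first variable away
from the diagonal with one power of `|x - y|` lost. Knowing `K` on constants as well, one can use
the smoothness that `f` already has:
`K f(x) - K f(x') = ∫ (k(x,y) - k(x',y)) (f(y) - f(x)) dσ(y) + f(x) (K 1(x) - K 1(x'))`.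
By a Schur-type estimate of the first term, `K` gains `α / 4` derivatives, up to the order `1 / 2`,
as long as `K 1` is Lipschitz (`IsSmoothingKernel.fracSq_op_le`). Hence a power `K ^ N` maps `L²`
to `H^{1/2}` (`IsSmoothingKernel.exists_fracSq_half_iterate_op_le`).

The divergence theorem would show that `K 1` is constant. It suffices, however, that `K 1` is
Lipschitz, and this is a local fact about graphs. Over the base of a chart the kernel is, up to a
constant, `|z|^{-d}` times the radial derivative of `slopeFun d (h z)`, where `z = v - u` and `h` is
the slope of the chord. The measure `|z|^{-d} dz` is invariant under dilations, so radial
derivatives integrate to `0` against it as soon as the function is odd at the origin to first order,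
which is the case for slopes of chords of a differentiable graph
(`integral_radial_deriv_eq_zero`). Thus the integral of the kernel against a cut-off function
reduces to a term that lives where the cut-off function varies, away from the singularity
(`integral_mul_graphKernel`), and `K 1` is Lipschitz (`exists_abs_integral_kernelK_sub_le`). The
surface measure being a Hausdorff measure, this needs the area formula for graphs
(`comap_graphMap`).

An eigenfunction `f` of `K` with eigenvalue `c ≠ 0` is `c^{-N} K ^ N f`, which is in `H^{1/2}`. For
`K*`, which is the transpose of `K`, an eigenfunction `g` satisfies
`c ^ N ⟨g, h⟩ = ⟨g, K ^ N h⟩` for `h` in `H^{1/2}`, so that `|⟨g, h⟩|` is bounded by the norm of `h`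
in `L²`, and the Riesz representation theorem provides `g` as an element of `L²`
(`BelongsToL2.of_bound`). -/

set_option linter.unusedSectionVars false

noncomputable section

namespace NeumannPoincare

/-! ### Estimates for differences of the kernel -/

/-- Cauchy-Schwarz with respect to the weight `m`. -/
theorem sq_lintegral_mul_le {X : Type*} [MeasurableSpace X] {μ : Measure X} {m F : X → ℝ≥0∞}
    (hm : AEMeasurable m μ) (hF : AEMeasurable F μ) :
    (∫⁻ y, m y * F y ∂μ) ^ 2 ≤ (∫⁻ y, m y ∂μ) * ∫⁻ y, m y * F y ^ 2 ∂μ := by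
  have h := ENNReal.lintegral_mul_le_Lp_mul_Lq μ Real.HolderConjugate.two_two
    (f := fun y ↦ m y ^ (1 / 2 : ℝ)) (g := fun y ↦ m y ^ (1 / 2 : ℝ) * F y)
    (hm.pow_const _) ((hm.pow_const _).mul hF)
  have e1 : ∀ y, m y ^ (1 / 2 : ℝ) * (m y ^ (1 / 2 : ℝ) * F y) = m y * F y := fun y ↦ by
    rw [← mul_assoc, ← ENNReal.rpow_add_of_nonneg _ _ (by norm_num) (by norm_num)]
    norm_num
  have e2 : ∀ y, (m y ^ (1 / 2 : ℝ)) ^ (2 : ℝ) = m y := fun y ↦ by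
    rw [← ENNReal.rpow_mul]; norm_num
  have e3 : ∀ y, (m y ^ (1 / 2 : ℝ) * F y) ^ (2 : ℝ) = m y * F y ^ 2 := fun y ↦ by
    rw [ENNReal.mul_rpow_of_nonneg _ _ (by norm_num), e2]; norm_num
  simp only [Pi.mul_apply, e1, e2, e3] at h
  have h2 := pow_le_pow_left' h 2
  rw [mul_pow, ← ENNReal.rpow_natCast, ← ENNReal.rpow_natCast (_ ^ (1 / 2 : ℝ)),
    ← ENNReal.rpow_natCast (_ ^ (1 / 2 : ℝ)), ← ENNReal.rpow_mul, ← ENNReal.rpow_mul] at h2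
  simpa using h2

/-- The two ways in which a kernel difference `m = |k(x,y) - k(x',y)|`, obeying the standard
estimates of order `-α`, is used; here `r = |x - x'|`, `ρ = |x - y|` and `ρ' = |x' - y|`. Half of
the order `-α` is kept to make the weights integrable over `y` or `x'`; the other half is the gain.
For `ρ < 2 r` both follow from the size of the kernel, otherwise from its smoothness. -/
theorem kernel_diff_bounds {D α s R C₀ : ℝ} (hα : 0 < α) (hα1 : α ≤ 1)
    (hs : -(α / 2) ≤ s) (hs' : 2 * s ≤ 1 - α / 2) (hDs : 0 ≤ D + 2 * s) (hR : 0 < R)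
    (hC₀ : 0 ≤ C₀) :
    ∃ C, 0 ≤ C ∧ ∀ r ρ ρ' m : ℝ, 0 < r → 0 < ρ → 0 < ρ' → r ≤ R → ρ ≤ R → ρ' ≤ R →
      ρ' ≤ ρ + r → m ≤ C₀ * (ρ ^ (α - D) + ρ' ^ (α - D)) →
      (2 * r ≤ ρ → m ≤ C₀ * (r * ρ ^ (α - 1 - D))) →
      m ≤ C * (r ^ (α / 2) * (ρ ^ (α / 2 - D) + ρ' ^ (α / 2 - D))) ∧
      r ^ (-D - 2 * s) * m ≤
        C * (ρ ^ (-D - 2 * s) * (r ^ (α / 2 - D) + ρ' ^ (α / 2 - D))) := by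
  set a := α / 2 with ha
  have hα2 : α = a + a := by rw [ha]; ring
  set K : ℝ := 3 + 2 ^ (D + 2 * s) + 2 ^ (α + 2 * s) with hK
  have hK2 : 0 < (2:ℝ) ^ (D + 2 * s) := by positivity
  have hK3 : 0 < (2:ℝ) ^ (α + 2 * s) := by positivity
  have hRa : 0 < R ^ a := by positivity
  refine ⟨C₀ * (3 + K * R ^ a), by positivity, ?_⟩
  intro r ρ ρ' m hr hρ hρ' hrR hρR hρ'R htri hm1 hm2
  have hpos : 0 < r ^ a := by positivity
  have hA : 0 < ρ ^ (a - D) := by positivity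
  have hB : 0 < ρ' ^ (a - D) := by positivity
  have hE : 0 < r ^ (a - D) := by positivity
  have hP : 0 < ρ ^ (-D - 2 * s) := by positivity
  have e1 : ρ ^ (α - D) = ρ ^ a * ρ ^ (a - D) := by rw [← Real.rpow_add hρ]; congr 1; linarith
  have e2 : ρ' ^ (α - D) = ρ' ^ a * ρ' ^ (a - D) := by
    rw [← Real.rpow_add hρ']; congr 1; linarith
  have ha0 : 0 < a := by positivity
  have hρ'a : ρ' ^ a ≤ R ^ a := by gcongr
  have hra : r ^ a ≤ R ^ a := by gcongr
  have hρa : ρ ^ a ≤ R ^ a := by gcongr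
  rcases lt_or_ge ρ (2 * r) with hlt | hge
  · have h3 : (3:ℝ) ^ a ≤ 3 := by
      calc (3:ℝ) ^ a ≤ 3 ^ (1:ℝ) := by gcongr <;> linarith
        _ = 3 := by simp
    have b1 : ρ ^ a ≤ 3 * r ^ a := by
      calc ρ ^ a ≤ (3 * r) ^ a := by gcongr; linarith
        _ = 3 ^ a * r ^ a := by rw [Real.mul_rpow (by norm_num) hr.le]
        _ ≤ _ := by gcongr
    have b2 : ρ' ^ a ≤ 3 * r ^ a := by
      calc ρ' ^ a ≤ (3 * r) ^ a := by gcongr; linarith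
        _ = 3 ^ a * r ^ a := by rw [Real.mul_rpow (by norm_num) hr.le]
        _ ≤ _ := by gcongr
    constructor
    · calc m ≤ C₀ * (ρ ^ a * ρ ^ (a - D) + ρ' ^ a * ρ' ^ (a - D)) := by rwa [e1, e2] at hm1
        _ ≤ C₀ * (3 * r ^ a * ρ ^ (a - D) + 3 * r ^ a * ρ' ^ (a - D)) := by gcongr
        _ = C₀ * 3 * (r ^ a * (ρ ^ (a - D) + ρ' ^ (a - D))) := by ring
        _ ≤ _ := by gcongr; nlinarith [mul_pos (by positivity : 0 < K) hRa]
    · have c1 : r ^ (-D - 2 * s) * ρ ^ (α - D) ≤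
          2 ^ (α + 2 * s) * R ^ a * (ρ ^ (-D - 2 * s) * r ^ (a - D)) := by
        calc r ^ (-D - 2 * s) * ρ ^ (α - D)
            = r ^ (-D - 2 * s) * (ρ ^ (-D - 2 * s) * ρ ^ (α + 2 * s)) := by
              rw [← Real.rpow_add hρ]; ring_nf
          _ ≤ r ^ (-D - 2 * s) * (ρ ^ (-D - 2 * s) * (2 * r) ^ (α + 2 * s)) := by
              gcongr; linarith
          _ = 2 ^ (α + 2 * s) * (r ^ a) * (ρ ^ (-D - 2 * s) * r ^ (a - D)) := by
              rw [Real.mul_rpow (by norm_num) hr.le]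
              have : r ^ (-D - 2 * s) * r ^ (α + 2 * s) = r ^ a * r ^ (a - D) := by
                rw [← Real.rpow_add hr, ← Real.rpow_add hr]; congr 1; linarith
              linear_combination (2 ^ (α + 2 * s) * ρ ^ (-D - 2 * s)) * this
          _ ≤ _ := by gcongr
      have c2 : r ^ (-D - 2 * s) * ρ' ^ (α - D) ≤
          2 ^ (D + 2 * s) * R ^ a * (ρ ^ (-D - 2 * s) * ρ' ^ (a - D)) := by
        have : r ^ (-D - 2 * s) ≤ 2 ^ (D + 2 * s) * ρ ^ (-D - 2 * s) := by
          calc r ^ (-D - 2 * s) ≤ (ρ / 2) ^ (-D - 2 * s) :=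
                Real.rpow_le_rpow_of_nonpos (by positivity) (by linarith) (by linarith)
            _ = _ := by
              rw [div_eq_mul_inv, Real.mul_rpow hρ.le (by norm_num), Real.inv_rpow (by norm_num),
                ← Real.rpow_neg (by norm_num), mul_comm]
              congr 2; ring
        rw [e2]
        calc _ ≤ 2 ^ (D + 2 * s) * ρ ^ (-D - 2 * s) * (R ^ a * ρ' ^ (a - D)) := by gcongr
          _ = _ := by ring
      calc r ^ (-D - 2 * s) * m
          ≤ r ^ (-D - 2 * s) * (C₀ * (ρ ^ (α - D) + ρ' ^ (α - D))) := by gcongr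
        _ = C₀ * (r ^ (-D - 2 * s) * ρ ^ (α - D) + r ^ (-D - 2 * s) * ρ' ^ (α - D)) := by ring
        _ ≤ C₀ * (2 ^ (α + 2 * s) * R ^ a * (ρ ^ (-D - 2 * s) * r ^ (a - D)) +
            2 ^ (D + 2 * s) * R ^ a * (ρ ^ (-D - 2 * s) * ρ' ^ (a - D))) := by gcongr
        _ ≤ C₀ * (K * R ^ a * (ρ ^ (-D - 2 * s) * r ^ (a - D)) +
            K * R ^ a * (ρ ^ (-D - 2 * s) * ρ' ^ (a - D))) := by
            gcongr <;> · rw [hK]; linarith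
        _ = C₀ * (K * R ^ a) * (ρ ^ (-D - 2 * s) * (r ^ (a - D) + ρ' ^ (a - D))) := by ring
        _ ≤ _ := by gcongr; linarith
  · have hm := hm2 hge
    have hrρ : r ≤ ρ := by linarith
    constructor
    · have b : r * ρ ^ (α - 1 - D) ≤ r ^ a * ρ ^ (a - D) := by
        have q1 : r = r ^ a * r ^ (1 - a) := by rw [← Real.rpow_add hr]; simp
        have q2 : ρ ^ (α - 1 - D) = ρ ^ (a - 1) * ρ ^ (a - D) := by
          rw [← Real.rpow_add hρ]; congr 1; linarith
        have q3 : r ^ (1 - a) * ρ ^ (a - 1) ≤ 1 := by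
          calc r ^ (1 - a) * ρ ^ (a - 1) ≤ ρ ^ (1 - a) * ρ ^ (a - 1) := by
                gcongr; linarith
            _ = 1 := by rw [← Real.rpow_add hρ]; simp
        calc r * ρ ^ (α - 1 - D) = r ^ a * (r ^ (1 - a) * ρ ^ (a - 1)) * ρ ^ (a - D) := by
              rw [q2]; nth_rewrite 1 [q1]; ring
          _ ≤ r ^ a * 1 * ρ ^ (a - D) := by gcongr
          _ = _ := by ring
      calc m ≤ C₀ * (r * ρ ^ (α - 1 - D)) := hm
        _ ≤ C₀ * (r ^ a * ρ ^ (a - D)) := by gcongr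
        _ ≤ C₀ * (r ^ a * (ρ ^ (a - D) + ρ' ^ (a - D))) := by gcongr; linarith
        _ = C₀ * 1 * (r ^ a * (ρ ^ (a - D) + ρ' ^ (a - D))) := by ring
        _ ≤ _ := by gcongr; nlinarith [mul_pos (by positivity : 0 < K) hRa]
    · have b : r ^ (-D - 2 * s) * (r * ρ ^ (α - 1 - D)) ≤
          R ^ a * (ρ ^ (-D - 2 * s) * r ^ (a - D)) := by
        have q1 : r ^ (-D - 2 * s) * r = r ^ (a - D) * r ^ (1 - 2 * s - a) := by
          nth_rewrite 2 [← Real.rpow_one r]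
          rw [← Real.rpow_add hr, ← Real.rpow_add hr]; congr 1; ring
        have q2 : ρ ^ (α - 1 - D) = ρ ^ (-D - 2 * s) * ρ ^ (α - 1 + 2 * s) := by
          rw [← Real.rpow_add hρ]; congr 1; ring
        have q3 : r ^ (1 - 2 * s - a) * ρ ^ (α - 1 + 2 * s) ≤ R ^ a := by
          calc r ^ (1 - 2 * s - a) * ρ ^ (α - 1 + 2 * s)
              ≤ ρ ^ (1 - 2 * s - a) * ρ ^ (α - 1 + 2 * s) := by gcongr; linarith
            _ = ρ ^ a := by rw [← Real.rpow_add hρ]; congr 1; linarith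
            _ ≤ _ := hρa
        calc r ^ (-D - 2 * s) * (r * ρ ^ (α - 1 - D))
            = r ^ (a - D) * ρ ^ (-D - 2 * s) * (r ^ (1 - 2 * s - a) * ρ ^ (α - 1 + 2 * s)) := by
              rw [← mul_assoc, q1, q2]; ring
          _ ≤ r ^ (a - D) * ρ ^ (-D - 2 * s) * R ^ a := by gcongr
          _ = _ := by ring
      calc r ^ (-D - 2 * s) * m ≤ r ^ (-D - 2 * s) * (C₀ * (r * ρ ^ (α - 1 - D))) := by gcongr
        _ = C₀ * (r ^ (-D - 2 * s) * (r * ρ ^ (α - 1 - D))) := by ring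
        _ ≤ C₀ * (R ^ a * (ρ ^ (-D - 2 * s) * r ^ (a - D))) := by gcongr
        _ ≤ C₀ * (R ^ a * (ρ ^ (-D - 2 * s) * (r ^ (a - D) + ρ' ^ (a - D)))) := by
            gcongr; linarith
        _ = C₀ * (1 * R ^ a) * (ρ ^ (-D - 2 * s) * (r ^ (a - D) + ρ' ^ (a - D))) := by ring
        _ ≤ C₀ * (K * R ^ a) * (ρ ^ (-D - 2 * s) * (r ^ (a - D) + ρ' ^ (a - D))) := by
            gcongr; rw [hK]; linarith
        _ ≤ _ := by gcongr; linarith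

/-! ### Weakly singular kernels on `L²` -/

theorem ofReal_norm_rpow {X : Type*} [NormedAddCommGroup X] {x : X} (hx : x ≠ 0) (γ : ℝ) :
    ENNReal.ofReal (‖x‖ ^ γ) = ‖x‖ₑ ^ γ := by
  rw [← ofReal_norm, ENNReal.ofReal_rpow_of_pos (norm_pos_iff.2 hx)]

/-- `k` is a kernel of order `-α` on a bounded set `Γ` of dimension `D` carrying the measure `σ`.
The dimension enters only through the Riesz potentials of `σ`, which are bounded for every positive
order. -/
structure IsWeaklySingularKernel {X : Type*} [NormedAddCommGroup X] [MeasurableSpace X]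
    (σ : Measure X) (Γ : Set X) (D α : ℝ) (k : X → X → ℝ) : Prop where
  one_le : 1 ≤ D
  pos : 0 < α
  le_one : α ≤ 1
  ae_mem : ∀ᵐ x ∂σ, x ∈ Γ
  diam : ∃ R > 0, ∀ x ∈ Γ, ∀ y ∈ Γ, ‖x - y‖ ≤ R
  riesz : ∀ β > 0, ∃ C : NNReal, ∀ x ∈ Γ, ∫⁻ y, ‖x - y‖ₑ ^ (β - D) ∂σ ≤ C
  meas : AEStronglyMeasurable (Function.uncurry k) (σ.prod σ)
  size : ∃ C, ∀ x ∈ Γ, ∀ y ∈ Γ, x ≠ y → |k x y| ≤ C * ‖x - y‖ ^ (α - D)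
  diff : ∃ C, ∀ x ∈ Γ, ∀ x' ∈ Γ, ∀ y ∈ Γ, x ≠ x' → x ≠ y → 2 * ‖x - x'‖ ≤ ‖x - y‖ →
    |k x y - k x' y| ≤ C * (‖x - x'‖ * ‖x - y‖ ^ (α - 1 - D))

/-- `k` is a kernel of order `-α` whose integral over `Γ` is a Lipschitz function of the first
variable. -/
structure IsSmoothingKernel {X : Type*} [NormedAddCommGroup X] [MeasurableSpace X]
    (σ : Measure X) (Γ : Set X) (D α : ℝ) (k : X → X → ℝ) : Prop
    extends IsWeaklySingularKernel σ Γ D α k where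
  one : ∃ C, ∀ x ∈ Γ, ∀ x' ∈ Γ, |∫ y, k x y ∂σ - ∫ y, k x' y ∂σ| ≤ C * ‖x - x'‖

namespace IsWeaklySingularKernel

variable {X : Type*} [NormedAddCommGroup X] [MeasurableSpace X] [BorelSpace X]
  [SecondCountableTopology X] {σ : Measure X} [IsFiniteMeasure σ] {Γ : Set X} {D α : ℝ}
  {k : X → X → ℝ}

theorem ae_ne (hk : IsWeaklySingularKernel σ Γ D α k) (x : X) : ∀ᵐ y ∂σ, y ≠ x := by
  by_cases hx : x ∈ Γ
  · obtain ⟨C, hC⟩ := hk.riesz (1 / 2) (by norm_num)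
    have hfin := ae_lt_top (μ := σ) (f := fun y ↦ ‖x - y‖ₑ ^ (1 / 2 - D)) (by fun_prop)
      ((hC x hx).trans_lt ENNReal.coe_lt_top).ne
    filter_upwards [hfin] with y hy hyx
    have : 1 / 2 - D < 0 := by linarith [hk.one_le]
    simp only [hyx, sub_self, enorm_zero, ENNReal.zero_rpow_of_neg this] at hy
    exact lt_irrefl _ hy
  · filter_upwards [hk.ae_mem] with y hy hyx
    exact hx (hyx ▸ hy)

theorem enorm_le (hk : IsWeaklySingularKernel σ Γ D α k) :
    ∃ C : NNReal, ∀ x ∈ Γ, ∀ y ∈ Γ, x ≠ y → ‖k x y‖ₑ ≤ C * ‖x - y‖ₑ ^ (α - D) := by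
  obtain ⟨C, hC⟩ := hk.size
  refine ⟨C.toNNReal, fun x hx y hy hxy ↦ ?_⟩
  rw [← ofReal_norm_rpow (sub_ne_zero.2 hxy), Real.enorm_eq_ofReal_abs]
  refine (ENNReal.ofReal_le_ofReal (hC x hx y hy hxy)).trans ?_
  rw [ENNReal.ofReal_mul' (by positivity)]
  rfl

theorem lintegral_enorm_le (hk : IsWeaklySingularKernel σ Γ D α k) :
    ∃ C : NNReal, ∀ x ∈ Γ, ∫⁻ y, ‖k x y‖ₑ ∂σ ≤ C := by
  obtain ⟨C, hC⟩ := hk.enorm_le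
  obtain ⟨J, hJ⟩ := hk.riesz α hk.pos
  refine ⟨C * J, fun x hx ↦ ?_⟩
  calc ∫⁻ y, ‖k x y‖ₑ ∂σ ≤ ∫⁻ y, C * ‖x - y‖ₑ ^ (α - D) ∂σ := by
        refine lintegral_mono_ae ?_
        filter_upwards [hk.ae_mem, hk.ae_ne x] with y hy hne
        exact hC x hx y hy hne.symm
    _ = C * ∫⁻ y, ‖x - y‖ₑ ^ (α - D) ∂σ := lintegral_const_mul _ (by fun_prop)
    _ ≤ C * J := by gcongr; exact hJ x hx
    _ = _ := by push_cast; rfl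

end IsWeaklySingularKernel

namespace IsSmoothingKernel

variable {X : Type*} [NormedAddCommGroup X] [MeasurableSpace X] [BorelSpace X]
  [SecondCountableTopology X] {σ : Measure X} [IsFiniteMeasure σ] {Γ : Set X} {D α : ℝ}
  {k : X → X → ℝ} {𝕜 : Type*} [RCLike 𝕜]

theorem measurable_riesz (γ : ℝ) :
    Measurable fun z : X × X ↦ ‖z.1 - z.2‖ₑ ^ γ := by
  fun_prop

/-- Schur's test for the Riesz kernels. -/
theorem riesz_schur (hk : IsSmoothingKernel σ Γ D α k) {β : ℝ} (hβ : 0 < β) :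
    ∃ C : NNReal, ∀ g : X → ℝ≥0∞, Measurable g →
      ∫⁻ x, ∫⁻ y, ‖x - y‖ₑ ^ (β - D) * g y ∂σ ∂σ ≤ C * ∫⁻ y, g y ∂σ := by
  obtain ⟨C, hC⟩ := hk.riesz β hβ
  refine ⟨C, fun g hg ↦ ?_⟩
  have hm : Measurable (Function.uncurry fun x y : X ↦ ‖x - y‖ₑ ^ (β - D) * g y) :=
    (measurable_riesz (β - D)).mul (hg.comp measurable_snd)
  rw [lintegral_lintegral_swap hm.aemeasurable, ← lintegral_const_mul _ hg]
  refine lintegral_mono_ae ?_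
  filter_upwards [hk.ae_mem] with y hy
  rw [lintegral_mul_const _ (by fun_prop)]
  gcongr
  simpa only [enorm_sub_rev] using hC y hy

theorem lintegral_lintegral_le (hk : IsSmoothingKernel σ Γ D α k) :
    ∃ C : NNReal, ∀ g : X → ℝ≥0∞, Measurable g →
      ∫⁻ x, ∫⁻ y, ‖k x y‖ₑ * g y ∂σ ∂σ ≤ C * ∫⁻ y, g y ∂σ := by
  obtain ⟨C, hC⟩ := hk.enorm_le
  obtain ⟨J, hJ⟩ := hk.riesz_schur hk.pos
  refine ⟨C * J, fun g hg ↦ ?_⟩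
  calc ∫⁻ x, ∫⁻ y, ‖k x y‖ₑ * g y ∂σ ∂σ
      ≤ ∫⁻ x, C * ∫⁻ y, ‖x - y‖ₑ ^ (α - D) * g y ∂σ ∂σ := by
        refine lintegral_mono_ae ?_
        filter_upwards [hk.ae_mem] with x hx
        rw [← lintegral_const_mul' _ _ (by simp)]
        refine lintegral_mono_ae ?_
        filter_upwards [hk.ae_mem, hk.ae_ne x] with y hy hne
        rw [← mul_assoc]
        gcongr
        exact hC x hx y hy hne.symm
    _ = C * ∫⁻ x, ∫⁻ y, ‖x - y‖ₑ ^ (α - D) * g y ∂σ ∂σ := lintegral_const_mul' _ _ (by simp)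
    _ ≤ C * (J * ∫⁻ y, g y ∂σ) := by gcongr; exact hJ g hg
    _ = _ := by push_cast; ring

theorem ae_meas (hk : IsSmoothingKernel σ Γ D α k) :
    ∀ᵐ x ∂σ, AEStronglyMeasurable (k x) σ :=
  hk.meas.prodMk_left

theorem integrable (hk : IsSmoothingKernel σ Γ D α k) :
    ∀ᵐ x ∂σ, Integrable (k x) σ := by
  obtain ⟨C, hC⟩ := hk.lintegral_enorm_le
  filter_upwards [hk.ae_mem, hk.ae_meas] with x hx hm
  exact ⟨hm, (hC x hx).trans_lt ENNReal.coe_lt_top⟩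

theorem meas_mul (hk : IsSmoothingKernel σ Γ D α k) {f : X → 𝕜} (hf : StronglyMeasurable f) :
    AEStronglyMeasurable (fun z : X × X ↦ (k z.1 z.2 : 𝕜) * f z.2) (σ.prod σ) :=
  (RCLike.continuous_ofReal.comp_aestronglyMeasurable hk.meas).mul
    (hf.comp_measurable measurable_snd).aestronglyMeasurable

theorem enorm_ofReal_mul (x y : X) (f : X → 𝕜) :
    ‖(k x y : 𝕜) * f y‖ₑ = ‖k x y‖ₑ * ‖f y‖ₑ := by
  rw [enorm_mul]
  congr 1
  rw [← ofReal_norm, ← ofReal_norm, RCLike.norm_ofReal, Real.norm_eq_abs]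

theorem integrable_mul (hk : IsSmoothingKernel σ Γ D α k) (f : Lp 𝕜 2 σ) :
    ∀ᵐ x ∂σ, Integrable (fun y ↦ (k x y : 𝕜) * f y) σ := by
  have hf := Lp.stronglyMeasurable f
  obtain ⟨C, hC⟩ := hk.lintegral_lintegral_le
  have hfi : Integrable f σ := (Lp.memLp f).integrable one_le_two
  have : Integrable (fun z : X × X ↦ (k z.1 z.2 : 𝕜) * f z.2) (σ.prod σ) := by
    refine ⟨hk.meas_mul hf, ?_⟩
    rw [HasFiniteIntegral, lintegral_prod _ (hk.meas_mul hf).enorm]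
    simp only [enorm_ofReal_mul]
    refine (hC _ hf.enorm).trans_lt (ENNReal.mul_lt_top ENNReal.coe_lt_top hfi.2)
  exact this.prod_right_ae

theorem lintegral_enorm_sq (f : Lp 𝕜 2 σ) : ∫⁻ x, ‖f x‖ₑ ^ 2 ∂σ = ‖f‖ₑ ^ 2 := by
  rw [Lp.enorm_def, eLpNorm_eq_lintegral_rpow_enorm_toReal (by simp) (by simp)]
  simp only [ENNReal.toReal_ofNat, ENNReal.rpow_ofNat, one_div]
  rw [← ENNReal.rpow_natCast, ← ENNReal.rpow_mul]
  simp

theorem lintegral_sq_le (hk : IsSmoothingKernel σ Γ D α k) :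
    ∃ C : NNReal, ∀ f : X → 𝕜, StronglyMeasurable f →
      ∫⁻ x, ‖∫ y, (k x y : 𝕜) * f y ∂σ‖ₑ ^ 2 ∂σ ≤ C * ∫⁻ x, ‖f x‖ₑ ^ 2 ∂σ := by
  obtain ⟨C, hC⟩ := hk.lintegral_lintegral_le
  obtain ⟨J, hJ⟩ := hk.lintegral_enorm_le
  refine ⟨J * C, fun f hf ↦ ?_⟩
  calc ∫⁻ x, ‖∫ y, (k x y : 𝕜) * f y ∂σ‖ₑ ^ 2 ∂σ
      ≤ ∫⁻ x, J * ∫⁻ y, ‖k x y‖ₑ * ‖f y‖ₑ ^ 2 ∂σ ∂σ := by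
        refine lintegral_mono_ae ?_
        filter_upwards [hk.ae_mem, hk.ae_meas] with x hx hm
        calc ‖∫ y, (k x y : 𝕜) * f y ∂σ‖ₑ ^ 2 ≤ (∫⁻ y, ‖k x y‖ₑ * ‖f y‖ₑ ∂σ) ^ 2 := by
              gcongr
              simpa only [enorm_ofReal_mul] using
                enorm_integral_le_lintegral_enorm (μ := σ) (fun y ↦ (k x y : 𝕜) * f y)
          _ ≤ _ := sq_lintegral_mul_le hm.enorm hf.enorm.aemeasurable
          _ ≤ _ := by gcongr; exact hJ x hx
    _ = J * ∫⁻ x, ∫⁻ y, ‖k x y‖ₑ * ‖f y‖ₑ ^ 2 ∂σ ∂σ := lintegral_const_mul' _ _ (by simp)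
    _ ≤ J * (C * ∫⁻ y, ‖f y‖ₑ ^ 2 ∂σ) := by gcongr; exact hC _ (hf.enorm.pow_const 2)
    _ = _ := by push_cast; ring

theorem memLp (hk : IsSmoothingKernel σ Γ D α k) (f : Lp 𝕜 2 σ) :
    MemLp (fun x ↦ ∫ y, (k x y : 𝕜) * f y ∂σ) 2 σ := by
  obtain ⟨C, hC⟩ := hk.lintegral_sq_le (𝕜 := 𝕜)
  refine ⟨(hk.meas_mul (Lp.stronglyMeasurable f)).integral_prod_right', ?_⟩
  rw [eLpNorm_lt_top_iff_lintegral_rpow_enorm_lt_top (by simp) (by simp)]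
  simp only [ENNReal.toReal_ofNat, ENNReal.rpow_ofNat]
  refine (hC f (Lp.stronglyMeasurable f)).trans_lt ?_
  rw [lintegral_enorm_sq]
  exact ENNReal.mul_lt_top ENNReal.coe_lt_top (by simp)

/-- The integral operator with kernel `k` on `L²(σ)`. -/
def op (hk : IsSmoothingKernel σ Γ D α k) (f : Lp 𝕜 2 σ) : Lp 𝕜 2 σ :=
  (hk.memLp f).toLp

theorem coeFn_op (hk : IsSmoothingKernel σ Γ D α k) (f : Lp 𝕜 2 σ) :
    hk.op f =ᵐ[σ] fun x ↦ ∫ y, (k x y : 𝕜) * f y ∂σ :=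
  (hk.memLp f).coeFn_toLp

theorem enorm_op_sq_le (hk : IsSmoothingKernel σ Γ D α k) :
    ∃ C : NNReal, ∀ f : Lp 𝕜 2 σ, ‖hk.op f‖ₑ ^ 2 ≤ C * ‖f‖ₑ ^ 2 := by
  obtain ⟨C, hC⟩ := hk.lintegral_sq_le (𝕜 := 𝕜)
  refine ⟨C, fun f ↦ ?_⟩
  rw [← lintegral_enorm_sq, ← lintegral_enorm_sq]
  refine le_of_eq_of_le (lintegral_congr_ae ?_) (hC f (Lp.stronglyMeasurable f))
  filter_upwards [hk.coeFn_op f] with x hx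
  rw [hx]

end IsSmoothingKernel

/-! ### The gain of fractional derivatives -/

/-- The square of the Gagliardo seminorm of order `s` with respect to the measure `σ`, on a set of
dimension `D`. -/
def fracSq {X : Type*} [NormedAddCommGroup X] [MeasurableSpace X] (σ : Measure X) (D s : ℝ)
    {𝕜 : Type*} [RCLike 𝕜] (f : X → 𝕜) : ℝ≥0∞ :=
  ∫⁻ x, ∫⁻ x', ‖f x - f x'‖ₑ ^ 2 * ‖x - x'‖ₑ ^ (-D - 2 * s) ∂σ ∂σ

theorem add_sq_le_four_mul (a b : ℝ≥0∞) : (a + b) ^ 2 ≤ 4 * (a ^ 2 + b ^ 2) := by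
  have h : a + b ≤ 2 * max a b := by
    rw [two_mul]; exact add_le_add (le_max_left _ _) (le_max_right _ _)
  calc (a + b) ^ 2 ≤ (2 * max a b) ^ 2 := by gcongr
    _ = 4 * max a b ^ 2 := by rw [mul_pow]; norm_num
    _ ≤ _ := by
      gcongr
      rcases max_choice a b with h | h <;> rw [h]
      · exact le_self_add
      · exact le_add_self

namespace IsSmoothingKernel

variable {X : Type*} [NormedAddCommGroup X] [MeasurableSpace X] [BorelSpace X]
  [SecondCountableTopology X] {σ : Measure X} [IsFiniteMeasure σ] {Γ : Set X} {D α : ℝ}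
  {k : X → X → ℝ} {𝕜 : Type*} [RCLike 𝕜]

theorem fracSq_congr {f g : X → 𝕜} (h : f =ᵐ[σ] g) (s : ℝ) :
    fracSq σ D s f = fracSq σ D s g := by
  refine lintegral_congr_ae ?_
  filter_upwards [h] with x hx
  refine lintegral_congr_ae ?_
  filter_upwards [h] with x' hx'
  rw [hx, hx']

theorem rpow_le_const (hk : IsSmoothingKernel σ Γ D α k) {γ : ℝ} (hγ : 0 ≤ γ) :
    ∃ C : NNReal, ∀ x ∈ Γ, ∀ y ∈ Γ, ‖x - y‖ₑ ^ γ ≤ C := by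
  obtain ⟨R, hR, h⟩ := hk.diam
  refine ⟨R.toNNReal ^ γ, fun x hx y hy ↦ ?_⟩
  rw [ENNReal.coe_rpow_of_nonneg _ hγ]
  gcongr
  rw [← ofReal_norm]
  exact ENNReal.ofReal_le_ofReal (h x hx y hy)

theorem enorm_sub_ne {x y : X} (h : y ≠ x) : ‖x - y‖ₑ ≠ 0 := by
  simpa [sub_eq_zero] using h.symm

theorem fracSq_mono (hk : IsSmoothingKernel σ Γ D α k) {s t : ℝ} (hst : s ≤ t) :
    ∃ C : NNReal, ∀ f : X → 𝕜, fracSq σ D s f ≤ C * fracSq σ D t f := by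
  obtain ⟨C, hC⟩ := hk.rpow_le_const (γ := 2 * (t - s)) (by linarith)
  refine ⟨C, fun f ↦ ?_⟩
  unfold fracSq
  rw [← lintegral_const_mul' _ _ (by simp)]
  refine lintegral_mono_ae ?_
  filter_upwards [hk.ae_mem] with x hx
  rw [← lintegral_const_mul' _ _ (by simp)]
  refine lintegral_mono_ae ?_
  filter_upwards [hk.ae_mem, hk.ae_ne x] with y hy hne
  have : ‖x - y‖ₑ ^ (-D - 2 * s) = ‖x - y‖ₑ ^ (2 * (t - s)) * ‖x - y‖ₑ ^ (-D - 2 * t) := by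
    rw [← ENNReal.rpow_add _ _ (enorm_sub_ne hne) (by simp)]
    congr 1; ring
  rw [this, mul_left_comm]
  gcongr
  exact hC x hx y hy

/-- For negative orders the Gagliardo seminorm is controlled by the `L²` norm. -/
theorem fracSq_le_of_neg (hk : IsSmoothingKernel σ Γ D α k) {s : ℝ} (hs : s < 0) :
    ∃ C : NNReal, ∀ f : X → 𝕜, StronglyMeasurable f →
      fracSq σ D s f ≤ C * ∫⁻ x, ‖f x‖ₑ ^ 2 ∂σ := by
  obtain ⟨C, hC⟩ := hk.riesz (-(2 * s)) (by linarith)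
  obtain ⟨C', hC'⟩ := hk.riesz_schur (β := -(2 * s)) (by linarith)
  refine ⟨4 * (C + C'), fun f hf ↦ ?_⟩
  have hm : Measurable fun x ↦ ‖f x‖ₑ ^ 2 := hf.enorm.pow_const 2
  have e : -D - 2 * s = -(2 * s) - D := by ring
  have hr : ∀ x : X, Measurable fun x' ↦ ‖x - x'‖ₑ ^ (-(2 * s) - D) := fun x ↦ by fun_prop
  unfold fracSq
  rw [e]
  calc ∫⁻ x, ∫⁻ x', ‖f x - f x'‖ₑ ^ 2 * ‖x - x'‖ₑ ^ (-(2 * s) - D) ∂σ ∂σ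
      ≤ ∫⁻ x, 4 * (C * ‖f x‖ₑ ^ 2 + ∫⁻ x', ‖x - x'‖ₑ ^ (-(2 * s) - D) * ‖f x'‖ₑ ^ 2 ∂σ) ∂σ := by
        refine lintegral_mono_ae ?_
        filter_upwards [hk.ae_mem] with x hx
        have hrm : Measurable fun x' ↦ ‖x - x'‖ₑ ^ (-(2 * s) - D) * ‖f x'‖ₑ ^ 2 := (hr x).mul hm
        calc _ ≤ ∫⁻ x', 4 * (‖x - x'‖ₑ ^ (-(2 * s) - D) * ‖f x‖ₑ ^ 2 +
              ‖x - x'‖ₑ ^ (-(2 * s) - D) * ‖f x'‖ₑ ^ 2) ∂σ := by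
              refine lintegral_mono fun x' ↦ ?_
              rw [← mul_add, mul_left_comm, mul_comm]
              gcongr
              refine (pow_le_pow_left' (enorm_sub_le) 2).trans (add_sq_le_four_mul _ _)
          _ = 4 * (((∫⁻ x', ‖x - x'‖ₑ ^ (-(2 * s) - D) ∂σ) * ‖f x‖ₑ ^ 2) +
              ∫⁻ x', ‖x - x'‖ₑ ^ (-(2 * s) - D) * ‖f x'‖ₑ ^ 2 ∂σ) := by
              rw [lintegral_const_mul' _ _ (by simp), lintegral_add_right _ hrm,
                lintegral_mul_const _ (hr x)]
          _ ≤ _ := by gcongr; exact hC x hx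
    _ = 4 * (C * ∫⁻ x, ‖f x‖ₑ ^ 2 ∂σ +
          ∫⁻ x, ∫⁻ x', ‖x - x'‖ₑ ^ (-(2 * s) - D) * ‖f x'‖ₑ ^ 2 ∂σ ∂σ) := by
        rw [lintegral_const_mul' _ _ (by simp), lintegral_add_left (hm.const_mul _),
          lintegral_const_mul' _ _ (by simp)]
    _ ≤ 4 * (C * ∫⁻ x, ‖f x‖ₑ ^ 2 ∂σ + C' * ∫⁻ x, ‖f x‖ₑ ^ 2 ∂σ) := by
        gcongr; exact hC' _ hm
    _ = _ := by push_cast; ring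

/-- The kernel difference estimates of `kernel_diff_bounds` in `ℝ≥0∞`. -/
theorem enorm_diff_le (hk : IsSmoothingKernel σ Γ D α k) {s : ℝ} (hs : -(α / 2) ≤ s)
    (hs' : 2 * s ≤ 1 - α / 2) :
    ∃ C : NNReal, ∀ x ∈ Γ, ∀ x' ∈ Γ, ∀ y ∈ Γ, x' ≠ x → y ≠ x → y ≠ x' →
      ‖k x y - k x' y‖ₑ ≤
        C * (‖x - x'‖ₑ ^ (α / 2) * (‖x - y‖ₑ ^ (α / 2 - D) + ‖x' - y‖ₑ ^ (α / 2 - D))) ∧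
      ‖x - x'‖ₑ ^ (-D - 2 * s) * ‖k x y - k x' y‖ₑ ≤
        C * (‖x - y‖ₑ ^ (-D - 2 * s) *
          (‖x - x'‖ₑ ^ (α / 2 - D) + ‖x' - y‖ₑ ^ (α / 2 - D))) := by
  obtain ⟨R, hR, hdiam⟩ := hk.diam
  obtain ⟨C₁, h₁⟩ := hk.size
  obtain ⟨C₂, h₂⟩ := hk.diff
  obtain ⟨C, hC, h⟩ := kernel_diff_bounds (D := D) (C₀ := max |C₁| |C₂|) hk.pos hk.le_one hs hs'
    (by linarith [hk.one_le, hk.le_one]) hR (by positivity)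
  refine ⟨C.toNNReal, fun x hx x' hx' y hy hxx' hyx hyx' ↦ ?_⟩
  have n1 : x - x' ≠ 0 := sub_ne_zero.2 hxx'.symm
  have n2 : x - y ≠ 0 := sub_ne_zero.2 hyx.symm
  have n3 : x' - y ≠ 0 := sub_ne_zero.2 hyx'.symm
  have b1 : C₁ ≤ max |C₁| |C₂| := (le_abs_self _).trans (le_max_left _ _)
  have b2 : C₂ ≤ max |C₁| |C₂| := (le_abs_self _).trans (le_max_right _ _)
  obtain ⟨g1, g2⟩ := h ‖x - x'‖ ‖x - y‖ ‖x' - y‖ |k x y - k x' y| (norm_pos_iff.2 n1)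
    (norm_pos_iff.2 n2) (norm_pos_iff.2 n3) (hdiam _ hx _ hx') (hdiam _ hx _ hy)
    (hdiam _ hx' _ hy) (by
      have := norm_sub_le (x - y) (x - x')
      rwa [sub_sub_sub_cancel_left] at this)
    (by
      calc |k x y - k x' y| ≤ |k x y| + |k x' y| := abs_sub _ _
        _ ≤ C₁ * ‖x - y‖ ^ (α - D) + C₁ * ‖x' - y‖ ^ (α - D) :=
          add_le_add (h₁ x hx y hy hyx.symm) (h₁ x' hx' y hy hyx'.symm)
        _ = C₁ * (‖x - y‖ ^ (α - D) + ‖x' - y‖ ^ (α - D)) := by ring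
        _ ≤ _ := by gcongr)
    (fun hle ↦ (h₂ x hx x' hx' y hy hxx'.symm hyx.symm hle).trans (by gcongr))
  constructor
  · have := ENNReal.ofReal_le_ofReal g1
    rw [ENNReal.ofReal_mul hC, ENNReal.ofReal_mul (by positivity),
      ENNReal.ofReal_add (by positivity) (by positivity), ofReal_norm_rpow n1,
      ofReal_norm_rpow n2, ofReal_norm_rpow n3, ← Real.enorm_eq_ofReal_abs] at this
    exact this
  · have := ENNReal.ofReal_le_ofReal g2
    rw [ENNReal.ofReal_mul hC, ENNReal.ofReal_mul (by positivity),
      ENNReal.ofReal_mul (by positivity),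
      ENNReal.ofReal_add (by positivity) (by positivity), ofReal_norm_rpow n1,
      ofReal_norm_rpow n1, ofReal_norm_rpow n2, ofReal_norm_rpow n3,
      ← Real.enorm_eq_ofReal_abs] at this
    exact this

/-- Subtracting the constant `f x` isolates the contribution of the integral of the kernel. -/
theorem enorm_sub_integral_le {x x' : X} {f : X → 𝕜} (h1 : Integrable (k x) σ)
    (h2 : Integrable (k x') σ) (h3 : Integrable (fun y ↦ (k x y : 𝕜) * f y) σ)
    (h4 : Integrable (fun y ↦ (k x' y : 𝕜) * f y) σ) :
    ‖(∫ y, (k x y : 𝕜) * f y ∂σ) - ∫ y, (k x' y : 𝕜) * f y ∂σ‖ₑ ≤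
      (∫⁻ y, ‖k x y - k x' y‖ₑ * ‖f x - f y‖ₑ ∂σ) +
        ‖∫ y, k x y ∂σ - ∫ y, k x' y ∂σ‖ₑ * ‖f x‖ₑ := by
  have i1 : Integrable (fun y ↦ (k x y : 𝕜) * f x) σ := h1.ofReal.mul_const _
  have i2 : Integrable (fun y ↦ (k x' y : 𝕜) * f x) σ := h2.ofReal.mul_const _
  have e1 : ∫ y, (k x y : 𝕜) * f x ∂σ = ((∫ y, k x y ∂σ : ℝ) : 𝕜) * f x := by
    rw [integral_mul_const, integral_ofReal]
  have e2 : ∫ y, (k x' y : 𝕜) * f x ∂σ = ((∫ y, k x' y ∂σ : ℝ) : 𝕜) * f x := by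
    rw [integral_mul_const, integral_ofReal]
  have key : (∫ y, (k x y : 𝕜) * f y ∂σ) - ∫ y, (k x' y : 𝕜) * f y ∂σ =
      (∫ y, ((k x y - k x' y : ℝ) : 𝕜) * (f y - f x) ∂σ) +
        ((∫ y, k x y ∂σ - ∫ y, k x' y ∂σ : ℝ) : 𝕜) * f x := by
    have : ∀ y, ((k x y - k x' y : ℝ) : 𝕜) * (f y - f x) =
        ((k x y : 𝕜) * f y - (k x' y : 𝕜) * f y) - ((k x y : 𝕜) * f x - (k x' y : 𝕜) * f x) :=
      fun y ↦ by push_cast; ring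
    have j1 : Integrable (fun y ↦ (k x y : 𝕜) * f y - (k x' y : 𝕜) * f y) σ := h3.sub h4
    have j2 : Integrable (fun y ↦ (k x y : 𝕜) * f x - (k x' y : 𝕜) * f x) σ := i1.sub i2
    simp_rw [this]
    rw [integral_sub j1 j2, integral_sub h3 h4, integral_sub i1 i2, e1, e2]
    push_cast; ring
  rw [key]
  refine (enorm_add_le _ _).trans (add_le_add ?_ ?_)
  · refine (enorm_integral_le_lintegral_enorm _).trans (le_of_eq ?_)
    refine lintegral_congr fun y ↦ ?_
    rw [enorm_mul, enorm_sub_rev (f y)]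
    congr 1
    rw [← ofReal_norm, ← ofReal_norm, RCLike.norm_ofReal, Real.norm_eq_abs]
  · rw [enorm_mul]
    refine le_of_eq ?_
    congr 1
    rw [← ofReal_norm, ← ofReal_norm, RCLike.norm_ofReal, Real.norm_eq_abs]

/-- The weight in `enorm_diff_le`, integrated in `x'`, is bounded, so that the triple integral is
controlled by the seminorm of order `s`. -/
theorem lintegral_triple_le (hk : IsSmoothingKernel σ Γ D α k) (s : ℝ) :
    ∃ C : NNReal, ∀ f : X → 𝕜, StronglyMeasurable f →
      ∫⁻ x, ∫⁻ x', ∫⁻ y, (‖x - y‖ₑ ^ (-D - 2 * s) *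
        (‖x - x'‖ₑ ^ (α / 2 - D) + ‖x' - y‖ₑ ^ (α / 2 - D))) * ‖f x - f y‖ₑ ^ 2 ∂σ ∂σ ∂σ ≤
      C * fracSq σ D s f := by
  obtain ⟨J, hJ⟩ := hk.riesz (α / 2) (by linarith [hk.pos])
  refine ⟨J + J, fun f hf ↦ ?_⟩
  unfold fracSq
  rw [← lintegral_const_mul' _ _ (by simp)]
  refine lintegral_mono_ae ?_
  filter_upwards [hk.ae_mem] with x hx
  rw [lintegral_lintegral_swap]
  · rw [← lintegral_const_mul' _ _ (by simp)]
    refine lintegral_mono_ae ?_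
    filter_upwards [hk.ae_mem, hk.ae_ne x] with y hy hne
    have m1 : Measurable fun x' ↦ ‖x - x'‖ₑ ^ (α / 2 - D) := by fun_prop
    have m2 : Measurable fun x' ↦ ‖x' - y‖ₑ ^ (α / 2 - D) := by fun_prop
    have e : ∀ x', (‖x - y‖ₑ ^ (-D - 2 * s) *
        (‖x - x'‖ₑ ^ (α / 2 - D) + ‖x' - y‖ₑ ^ (α / 2 - D))) * ‖f x - f y‖ₑ ^ 2 =
        (‖f x - f y‖ₑ ^ 2 * ‖x - y‖ₑ ^ (-D - 2 * s)) *
          (‖x - x'‖ₑ ^ (α / 2 - D) + ‖x' - y‖ₑ ^ (α / 2 - D)) := fun x' ↦ by ring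
    simp_rw [e]
    rw [lintegral_const_mul _ (by fun_prop), mul_comm, lintegral_add_left m1]
    gcongr
    push_cast
    gcongr
    · exact hJ x hx
    · simpa only [enorm_sub_rev] using hJ y hy
  · have hfm : Measurable fun z : X × X ↦ ‖f x - f z.2‖ₑ ^ 2 :=
      ((stronglyMeasurable_const.sub (hf.comp_measurable measurable_snd)).enorm.pow_const 2)
    refine Measurable.aemeasurable ?_
    refine Measurable.mul ?_ hfm
    fun_prop

/-- An operator of order `-α` that maps constants to Lipschitz functions gains `α / 4` derivatives
in the scale of Gagliardo seminorms, up to order `1 / 2`. After `enorm_sub_integral_le`, the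
Cauchy-Schwarz inequality is applied with the weight `|k(x,y) - k(x',y)|`: its integral gives the
factor `|x - x'|^{α/2}`, which is the gain, and the rest is bounded by `lintegral_triple_le`. -/
theorem fracSq_op_le (hk : IsSmoothingKernel σ Γ D α k) {s : ℝ} (hs : -(α / 2) ≤ s)
    (hs' : 2 * s ≤ 1 - α / 2) :
    ∃ C : NNReal, ∀ f : Lp 𝕜 2 σ,
      fracSq σ D (s + α / 4) (hk.op f) ≤ C * (fracSq σ D s f + ‖f‖ₑ ^ 2) := by
  obtain ⟨K, hK⟩ := hk.enorm_diff_le hs hs'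
  obtain ⟨J, hJ⟩ := hk.riesz (α / 2) (by linarith [hk.pos])
  obtain ⟨J', hJ'⟩ := hk.riesz (2 - 2 * s - α / 2) (by linarith [hk.pos, hk.le_one])
  obtain ⟨B, hB⟩ := hk.lintegral_triple_le (𝕜 := 𝕜) s
  obtain ⟨L, hL⟩ := hk.one
  refine ⟨4 * (K * (J + J) * K * B + L.toNNReal ^ 2 * J'), fun f ↦ ?_⟩
  have hf := Lp.stronglyMeasurable f
  rw [fracSq_congr (hk.coeFn_op f)]
  have hfm : Measurable fun x ↦ ‖f x‖ₑ ^ 2 := hf.enorm.pow_const 2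
  have pointwise : ∀ᵐ x ∂σ, ∀ᵐ x' ∂σ,
      ‖(∫ y, (k x y : 𝕜) * f y ∂σ) - ∫ y, (k x' y : 𝕜) * f y ∂σ‖ₑ ^ 2 *
        ‖x - x'‖ₑ ^ (-D - 2 * (s + α / 4)) ≤
      4 * (K * (J + J) * K * (∫⁻ y, (‖x - y‖ₑ ^ (-D - 2 * s) *
        (‖x - x'‖ₑ ^ (α / 2 - D) + ‖x' - y‖ₑ ^ (α / 2 - D))) * ‖f x - f y‖ₑ ^ 2 ∂σ) +
        L.toNNReal ^ 2 * ‖f x‖ₑ ^ 2 * ‖x - x'‖ₑ ^ (2 - 2 * s - α / 2 - D)) := by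
    filter_upwards [hk.ae_mem, hk.integrable, hk.integrable_mul f, hk.ae_meas] with x hx i1 i2 m1
    filter_upwards [hk.ae_mem, hk.integrable, hk.integrable_mul f, hk.ae_meas, hk.ae_ne x]
      with x' hx' i3 i4 m2 hne
    have hr0 : ‖x - x'‖ₑ ≠ 0 := enorm_sub_ne hne
    have hrt : ‖x - x'‖ₑ ≠ ∞ := by simp
    set W := ‖x - x'‖ₑ ^ (-D - 2 * (s + α / 4)) with hW
    have hWt : ‖x - x'‖ₑ ^ (-D - 2 * s) ≠ ∞ := by simp [hr0, ENNReal.rpow_eq_top_iff]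
    have eW : W * ‖x - x'‖ₑ ^ (α / 2) = ‖x - x'‖ₑ ^ (-D - 2 * s) := by
      rw [hW, ← ENNReal.rpow_add _ _ hr0 hrt]; congr 1; ring
    have eW2 : W * ‖x - x'‖ₑ ^ 2 = ‖x - x'‖ₑ ^ (2 - 2 * s - α / 2 - D) := by
      rw [hW, ← ENNReal.rpow_natCast, ← ENNReal.rpow_add _ _ hr0 hrt]; congr 1; push_cast; ring
    have mM : AEMeasurable (fun y ↦ ‖k x y - k x' y‖ₑ) σ := (m1.sub m2).enorm
    have mF : Measurable fun y ↦ ‖f x - f y‖ₑ := (stronglyMeasurable_const.sub hf).enorm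
    have bL : ‖∫ y, k x y ∂σ - ∫ y, k x' y ∂σ‖ₑ ≤ L.toNNReal * ‖x - x'‖ₑ := by
      rw [Real.enorm_eq_ofReal_abs]
      refine (ENNReal.ofReal_le_ofReal (hL x hx x' hx')).trans ?_
      rw [ENNReal.ofReal_mul' (by positivity), ofReal_norm]
      rfl
    have bM : ∫⁻ y, ‖k x y - k x' y‖ₑ ∂σ ≤ K * (J + J) * ‖x - x'‖ₑ ^ (α / 2) := by
      have n1 : Measurable fun y ↦ ‖x - y‖ₑ ^ (α / 2 - D) := by fun_prop
      have n2 : Measurable fun y ↦ ‖x' - y‖ₑ ^ (α / 2 - D) := by fun_prop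
      calc ∫⁻ y, ‖k x y - k x' y‖ₑ ∂σ
          ≤ ∫⁻ y, (K * ‖x - x'‖ₑ ^ (α / 2)) *
            (‖x - y‖ₑ ^ (α / 2 - D) + ‖x' - y‖ₑ ^ (α / 2 - D)) ∂σ := by
            refine lintegral_mono_ae ?_
            filter_upwards [hk.ae_mem, hk.ae_ne x, hk.ae_ne x'] with y hy h1 h2
            rw [mul_assoc]
            exact (hK x hx x' hx' y hy hne h1 h2).1
        _ = (K * ‖x - x'‖ₑ ^ (α / 2)) * (∫⁻ y, ‖x - y‖ₑ ^ (α / 2 - D) ∂σ +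
            ∫⁻ y, ‖x' - y‖ₑ ^ (α / 2 - D) ∂σ) := by
            rw [lintegral_const_mul _ (by fun_prop), lintegral_add_left n1]
        _ ≤ (K * ‖x - x'‖ₑ ^ (α / 2)) * (J + J) := by
            gcongr
            · exact hJ x hx
            · exact hJ x' hx'
        _ = _ := by ring
    have bI : ‖x - x'‖ₑ ^ (-D - 2 * s) * ∫⁻ y, ‖k x y - k x' y‖ₑ * ‖f x - f y‖ₑ ^ 2 ∂σ ≤
        K * ∫⁻ y, (‖x - y‖ₑ ^ (-D - 2 * s) *
        (‖x - x'‖ₑ ^ (α / 2 - D) + ‖x' - y‖ₑ ^ (α / 2 - D))) * ‖f x - f y‖ₑ ^ 2 ∂σ := by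
      rw [← lintegral_const_mul' _ _ hWt, ← lintegral_const_mul' _ _ (by simp)]
      refine lintegral_mono_ae ?_
      filter_upwards [hk.ae_mem, hk.ae_ne x, hk.ae_ne x'] with y hy h1 h2
      rw [← mul_assoc, ← mul_assoc]
      exact mul_le_mul_left (hK x hx x' hx' y hy hne h1 h2).2 _
    calc _ ≤ ((∫⁻ y, ‖k x y - k x' y‖ₑ * ‖f x - f y‖ₑ ∂σ) +
          L.toNNReal * ‖x - x'‖ₑ * ‖f x‖ₑ) ^ 2 * W := by
          gcongr
          refine (enorm_sub_integral_le i1 i3 i2 i4).trans ?_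
          gcongr
      _ ≤ 4 * ((∫⁻ y, ‖k x y - k x' y‖ₑ * ‖f x - f y‖ₑ ∂σ) ^ 2 +
          (L.toNNReal * ‖x - x'‖ₑ * ‖f x‖ₑ) ^ 2) * W := by
          gcongr
          exact add_sq_le_four_mul _ _
      _ = 4 * (W * (∫⁻ y, ‖k x y - k x' y‖ₑ * ‖f x - f y‖ₑ ∂σ) ^ 2 +
          L.toNNReal ^ 2 * ‖f x‖ₑ ^ 2 * (W * ‖x - x'‖ₑ ^ 2)) := by ring
      _ ≤ 4 * (W * ((K * (J + J) * ‖x - x'‖ₑ ^ (α / 2)) *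
          ∫⁻ y, ‖k x y - k x' y‖ₑ * ‖f x - f y‖ₑ ^ 2 ∂σ) +
          L.toNNReal ^ 2 * ‖f x‖ₑ ^ 2 * (W * ‖x - x'‖ₑ ^ 2)) := by
          gcongr
          exact (sq_lintegral_mul_le mM mF.aemeasurable).trans (by gcongr)
      _ = 4 * (K * (J + J) * ((W * ‖x - x'‖ₑ ^ (α / 2)) *
          ∫⁻ y, ‖k x y - k x' y‖ₑ * ‖f x - f y‖ₑ ^ 2 ∂σ) +
          L.toNNReal ^ 2 * ‖f x‖ₑ ^ 2 * (W * ‖x - x'‖ₑ ^ 2)) := by ring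
      _ ≤ _ := by
          rw [eW, eW2]
          rw [mul_assoc (K * (J + J) : ℝ≥0∞) K]
          gcongr
  calc _ ≤ ∫⁻ x, ∫⁻ x', 4 * (K * (J + J) * K * (∫⁻ y, (‖x - y‖ₑ ^ (-D - 2 * s) *
        (‖x - x'‖ₑ ^ (α / 2 - D) + ‖x' - y‖ₑ ^ (α / 2 - D))) * ‖f x - f y‖ₑ ^ 2 ∂σ) +
        L.toNNReal ^ 2 * ‖f x‖ₑ ^ 2 * ‖x - x'‖ₑ ^ (2 - 2 * s - α / 2 - D)) ∂σ ∂σ := by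
        refine lintegral_mono_ae ?_
        filter_upwards [pointwise] with x hx
        exact lintegral_mono_ae hx
    _ ≤ ∫⁻ x, 4 * (K * (J + J) * K * (∫⁻ x', ∫⁻ y, (‖x - y‖ₑ ^ (-D - 2 * s) *
        (‖x - x'‖ₑ ^ (α / 2 - D) + ‖x' - y‖ₑ ^ (α / 2 - D))) * ‖f x - f y‖ₑ ^ 2 ∂σ ∂σ) +
        L.toNNReal ^ 2 * J' * ‖f x‖ₑ ^ 2) ∂σ := by
        refine lintegral_mono_ae ?_
        filter_upwards [hk.ae_mem] with x hx
        have n1 : Measurable fun x' ↦ ‖x - x'‖ₑ ^ (2 - 2 * s - α / 2 - D) := by fun_prop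
        rw [lintegral_const_mul' _ _ (by simp), lintegral_add_right _ (n1.const_mul _),
          lintegral_const_mul' _ _ (by finiteness), lintegral_const_mul _ n1]
        gcongr 4 * (_ + ?_)
        rw [mul_right_comm]
        gcongr
        exact hJ' x hx
    _ = 4 * (K * (J + J) * K * (∫⁻ x, ∫⁻ x', ∫⁻ y, (‖x - y‖ₑ ^ (-D - 2 * s) *
        (‖x - x'‖ₑ ^ (α / 2 - D) + ‖x' - y‖ₑ ^ (α / 2 - D))) * ‖f x - f y‖ₑ ^ 2 ∂σ ∂σ ∂σ) +
        L.toNNReal ^ 2 * J' * ‖f‖ₑ ^ 2) := by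
        rw [lintegral_const_mul' _ _ (by simp), lintegral_add_right _ (hfm.const_mul _),
          lintegral_const_mul' _ _ (by finiteness), lintegral_const_mul _ hfm,
          lintegral_enorm_sq]
    _ ≤ 4 * (K * (J + J) * K * (B * fracSq σ D s f) + L.toNNReal ^ 2 * J' * ‖f‖ₑ ^ 2) := by
        gcongr
        exact hB f hf
    _ ≤ 4 * (K * (J + J) * K * B * (fracSq σ D s f + ‖f‖ₑ ^ 2) +
        L.toNNReal ^ 2 * J' * (fracSq σ D s f + ‖f‖ₑ ^ 2)) := by
        rw [← mul_assoc (K * (J + J) * K : ℝ≥0∞)]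
        gcongr
        · exact le_self_add
        · exact le_add_self
    _ = _ := by push_cast; ring

theorem enorm_iterate_op_sq_le (hk : IsSmoothingKernel σ Γ D α k) (n : ℕ) :
    ∃ C : NNReal, ∀ f : Lp 𝕜 2 σ, ‖hk.op^[n] f‖ₑ ^ 2 ≤ C * ‖f‖ₑ ^ 2 := by
  obtain ⟨C, hC⟩ := hk.enorm_op_sq_le (𝕜 := 𝕜)
  induction n with
  | zero => exact ⟨1, fun f ↦ by simp⟩
  | succ n ih =>
    obtain ⟨C', hC'⟩ := ih
    refine ⟨C * C', fun f ↦ ?_⟩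
    rw [Function.iterate_succ_apply']
    refine (hC _).trans ?_
    push_cast
    rw [mul_assoc]
    gcongr
    exact hC' f

/-- `n` applications of the operator gain almost `n α / 4` derivatives. The inequality
`t < n α / 4` is strict because the induction starts from the seminorms of negative order, which are
bounded on `L²`. -/
theorem fracSq_iterate_op_le (hk : IsSmoothingKernel σ Γ D α k) (n : ℕ) :
    ∀ t : ℝ, t < n * (α / 4) → t ≤ 1 / 2 →
      ∃ C : NNReal, ∀ f : Lp 𝕜 2 σ, fracSq σ D t (hk.op^[n] f) ≤ C * ‖f‖ₑ ^ 2 := by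
  have base : ∀ n : ℕ, ∀ t : ℝ, t < 0 →
      ∃ C : NNReal, ∀ f : Lp 𝕜 2 σ, fracSq σ D t (hk.op^[n] f) ≤ C * ‖f‖ₑ ^ 2 := by
    intro n t ht
    obtain ⟨C, hC⟩ := hk.fracSq_le_of_neg (𝕜 := 𝕜) ht
    obtain ⟨C', hC'⟩ := hk.enorm_iterate_op_sq_le (𝕜 := 𝕜) n
    refine ⟨C * C', fun f ↦ (hC _ (Lp.stronglyMeasurable _)).trans ?_⟩
    rw [lintegral_enorm_sq]
    push_cast
    rw [mul_assoc]
    gcongr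
    exact hC' f
  induction n with
  | zero => intro t ht _; exact base 0 t (by simpa using ht)
  | succ n ih =>
    intro t ht ht'
    rcases lt_or_ge t 0 with h0 | h0
    · exact base _ t h0
    have hα := hk.pos
    obtain ⟨C, hC⟩ := hk.fracSq_op_le (𝕜 := 𝕜) (s := t - α / 4) (by linarith) (by linarith)
    obtain ⟨C₁, hC₁⟩ := ih (t - α / 4) (by push_cast at ht; linarith) (by linarith)
    obtain ⟨C₂, hC₂⟩ := hk.enorm_iterate_op_sq_le (𝕜 := 𝕜) n
    rw [sub_add_cancel] at hC
    refine ⟨C * (C₁ + C₂), fun f ↦ ?_⟩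
    rw [Function.iterate_succ_apply']
    refine (hC _).trans ?_
    push_cast
    rw [mul_assoc, add_mul]
    gcongr
    · exact hC₁ f
    · exact hC₂ f

/-- Some power of the operator maps `L²` to the Sobolev space of order `1 / 2`. -/
theorem exists_fracSq_half_iterate_op_le (hk : IsSmoothingKernel σ Γ D α k) :
    ∃ n : ℕ, ∃ C : NNReal, ∀ f : Lp 𝕜 2 σ,
      fracSq σ D (1 / 2) (hk.op^[n] f) ≤ C * ‖f‖ₑ ^ 2 := by
  have hα := hk.pos
  obtain ⟨n, hn⟩ := exists_nat_gt ((1 / 2) / (α / 4))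
  exact ⟨n, hk.fracSq_iterate_op_le n (1 / 2) ((div_lt_iff₀ (by positivity)).1 hn) le_rfl⟩

/-- The operator preserves the Sobolev space of order `1 / 2`: the gain of `α / 4` derivatives is
used from the order `1 / 2 - α / 4`. -/
theorem fracSq_half_op_le (hk : IsSmoothingKernel σ Γ D α k) :
    ∃ C : NNReal, ∀ f : Lp 𝕜 2 σ,
      fracSq σ D (1 / 2) (hk.op f) ≤ C * (fracSq σ D (1 / 2) f + ‖f‖ₑ ^ 2) := by
  have hα := hk.pos
  obtain ⟨C, hC⟩ := hk.fracSq_op_le (𝕜 := 𝕜) (s := 1 / 2 - α / 4) (by linarith [hk.le_one])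
    (by linarith)
  obtain ⟨C', hC'⟩ := hk.fracSq_mono (𝕜 := 𝕜) (s := 1 / 2 - α / 4) (t := 1 / 2) (by linarith)
  rw [sub_add_cancel] at hC
  refine ⟨C * (C' + 1), fun f ↦ (hC f).trans ?_⟩
  push_cast
  rw [mul_assoc]
  gcongr
  rw [add_mul, one_mul]
  calc _ ≤ C' * fracSq σ D (1 / 2) f + ‖f‖ₑ ^ 2 := by gcongr; exact hC' f
    _ ≤ _ := by
      gcongr
      · exact le_self_add
      · exact le_add_self

end IsSmoothingKernel

/-! ### Eigenfunctions -/

/-- For an absolutely convergent integral the principal value is the integral. -/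
theorem tendsto_truncated_integral {X : Type*} [NormedAddCommGroup X] [MeasurableSpace X]
    [BorelSpace X] {σ : Measure X} {𝕜 : Type*} [RCLike 𝕜] {g : X → 𝕜} {x : X}
    (hne : ∀ᵐ y ∂σ, y ≠ x) (hg : Integrable g σ) :
    Tendsto (fun ε : ℝ ↦ ∫ y in {y | ε < ‖x - y‖}, g y ∂σ) (𝓝[>] 0) (𝓝 (∫ y, g y ∂σ)) := by
  have hm : ∀ ε : ℝ, MeasurableSet {y : X | ε < ‖x - y‖} := fun ε ↦
    (isOpen_lt continuous_const (by fun_prop)).measurableSet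
  simp_rw [← integral_indicator (hm _)]
  refine tendsto_integral_filter_of_dominated_convergence (fun y ↦ ‖g y‖) ?_ ?_ hg.norm ?_
  · exact Eventually.of_forall fun ε ↦ hg.aestronglyMeasurable.indicator (hm ε)
  · exact Eventually.of_forall fun ε ↦ Eventually.of_forall fun y ↦ norm_indicator_le_norm_self _ _
  · filter_upwards [hne] with y hy
    refine tendsto_const_nhds.congr' ?_
    have : 0 < ‖x - y‖ := norm_pos_iff.2 (sub_ne_zero.2 hy.symm)
    filter_upwards [Ioo_mem_nhdsGT this] with ε hε
    rw [indicator_of_mem]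
    exact hε.2

namespace IsSmoothingKernel

section transpose

variable {X : Type*} [NormedAddCommGroup X] [MeasurableSpace X] [BorelSpace X]
  [SecondCountableTopology X] {σ : Measure X} [IsFiniteMeasure σ] {Γ : Set X} {D α : ℝ}
  {k : X → X → ℝ} {𝕜 : Type*} [RCLike 𝕜]

theorem meas_mul_left (hk : IsSmoothingKernel σ Γ D α k) {f : X → 𝕜} (hf : StronglyMeasurable f) :
    AEStronglyMeasurable (fun z : X × X ↦ (k z.1 z.2 : 𝕜) * f z.1) (σ.prod σ) :=
  (RCLike.continuous_ofReal.comp_aestronglyMeasurable hk.meas).mul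
    (hf.comp_measurable measurable_fst).aestronglyMeasurable

theorem lintegral_mul_left_le (hk : IsSmoothingKernel σ Γ D α k) :
    ∃ C : NNReal, ∀ g : X → ℝ≥0∞, Measurable g → (∀ x, g x ≠ ∞) →
      ∫⁻ x, ∫⁻ y, ‖k x y‖ₑ * g x ∂σ ∂σ ≤ C * ∫⁻ y, g y ∂σ := by
  obtain ⟨J, hJ⟩ := hk.lintegral_enorm_le
  refine ⟨J, fun g hg hfin ↦ ?_⟩
  rw [← lintegral_const_mul _ hg]
  refine lintegral_mono_ae ?_
  filter_upwards [hk.ae_mem] with x hx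
  rw [lintegral_mul_const' _ _ (hfin x)]
  gcongr
  exact hJ x hx

theorem integrable_mul_left (hk : IsSmoothingKernel σ Γ D α k) (f : Lp 𝕜 2 σ) :
    ∀ᵐ y ∂σ, Integrable (fun x ↦ (k x y : 𝕜) * f x) σ := by
  have hf := Lp.stronglyMeasurable f
  obtain ⟨C, hC⟩ := hk.lintegral_mul_left_le
  have hfi : Integrable f σ := (Lp.memLp f).integrable one_le_two
  have : Integrable (fun z : X × X ↦ (k z.1 z.2 : 𝕜) * f z.1) (σ.prod σ) := by
    refine ⟨hk.meas_mul_left hf, ?_⟩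
    rw [HasFiniteIntegral, lintegral_prod _ (hk.meas_mul_left hf).enorm]
    have : ∀ x y, ‖(k x y : 𝕜) * f x‖ₑ = ‖k x y‖ₑ * ‖f x‖ₑ := fun x y ↦
      enorm_ofReal_mul (k := k) x y fun _ ↦ f x
    simp only [this]
    exact (hC _ hf.enorm (by simp)).trans_lt (ENNReal.mul_lt_top ENNReal.coe_lt_top hfi.2)
  exact this.prod_left_ae

/-- The transpose of the operator with kernel `k` has kernel `(x, y) ↦ k y x`. -/
theorem integral_transpose_mul (hk : IsSmoothingKernel σ Γ D α k) (u h : Lp 𝕜 2 σ) :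
    ∫ y, (∫ x, (k x y : 𝕜) * u x ∂σ) * h y ∂σ = ∫ x, u x * ∫ y, (k x y : 𝕜) * h y ∂σ ∂σ := by
  have hu := Lp.stronglyMeasurable u
  have hh := Lp.stronglyMeasurable h
  obtain ⟨C₁, h₁⟩ := hk.lintegral_mul_left_le
  obtain ⟨C₂, h₂⟩ := hk.lintegral_lintegral_le
  have hint : Integrable (fun z : X × X ↦ (k z.1 z.2 : 𝕜) * u z.1 * h z.2) (σ.prod σ) := by
    have hmeas : AEStronglyMeasurable (fun z : X × X ↦ (k z.1 z.2 : 𝕜) * u z.1 * h z.2)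
        (σ.prod σ) :=
      (hk.meas_mul_left hu).mul (hh.comp_measurable measurable_snd).aestronglyMeasurable
    refine ⟨hmeas, ?_⟩
    rw [HasFiniteIntegral]
    have e : ∀ z : X × X, ‖(k z.1 z.2 : 𝕜) * u z.1 * h z.2‖ₑ ≤
        ‖k z.1 z.2‖ₑ * ‖u z.1‖ₑ ^ 2 + ‖k z.1 z.2‖ₑ * ‖h z.2‖ₑ ^ 2 := fun z ↦ by
      rw [mul_assoc, enorm_ofReal_mul (k := k) z.1 z.2 (fun _ ↦ u z.1 * h z.2), ← mul_add]
      gcongr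
      rw [_root_.enorm_mul]
      rcases le_total ‖u z.1‖ₑ ‖h z.2‖ₑ with hle | hle
      · calc _ ≤ ‖h z.2‖ₑ * ‖h z.2‖ₑ := by gcongr
          _ = ‖h z.2‖ₑ ^ 2 := (sq _).symm
          _ ≤ _ := le_add_self
      · calc _ ≤ ‖u z.1‖ₑ * ‖u z.1‖ₑ := by gcongr
          _ = ‖u z.1‖ₑ ^ 2 := (sq _).symm
          _ ≤ _ := le_self_add
    have m1 : AEMeasurable (fun z : X × X ↦ ‖k z.1 z.2‖ₑ * ‖u z.1‖ₑ ^ 2) (σ.prod σ) :=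
      hk.meas.enorm.mul
        (((hu.comp_measurable measurable_fst).enorm.pow_const 2).aemeasurable)
    have m2 : AEMeasurable (fun z : X × X ↦ ‖k z.1 z.2‖ₑ * ‖h z.2‖ₑ ^ 2) (σ.prod σ) :=
      hk.meas.enorm.mul
        (((hh.comp_measurable measurable_snd).enorm.pow_const 2).aemeasurable)
    refine (lintegral_mono e).trans_lt ?_
    rw [lintegral_add_left' m1, lintegral_prod _ m1, lintegral_prod _ m2]
    refine ENNReal.add_lt_top.2 ⟨?_, ?_⟩
    · refine (h₁ (fun x ↦ ‖u x‖ₑ ^ 2) (hu.enorm.pow_const 2) (by simp)).trans_lt ?_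
      rw [lintegral_enorm_sq]
      exact ENNReal.mul_lt_top ENNReal.coe_lt_top (by simp)
    · refine (h₂ (fun x ↦ ‖h x‖ₑ ^ 2) (hh.enorm.pow_const 2)).trans_lt ?_
      rw [lintegral_enorm_sq]
      exact ENNReal.mul_lt_top ENNReal.coe_lt_top (by simp)
  calc ∫ y, (∫ x, (k x y : 𝕜) * u x ∂σ) * h y ∂σ
      = ∫ y, ∫ x, (k x y : 𝕜) * u x * h y ∂σ ∂σ := by simp_rw [integral_mul_const]
    _ = ∫ x, ∫ y, (k x y : 𝕜) * u x * h y ∂σ ∂σ := (integral_integral_swap hint).symm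
    _ = ∫ x, u x * ∫ y, (k x y : 𝕜) * h y ∂σ ∂σ := by
        simp_rw [← integral_const_mul]
        congr 1; ext x; congr 1; ext y; ring

end transpose

end IsSmoothingKernel

section layerPotentials

variable {𝕜 : Type*} [RCLike 𝕜] {d : ℕ} {Ω : Set (EuclideanSpace ℝ (Fin (d + 1)))}

theorem kernelKStar_eq (x y : EuclideanSpace ℝ (Fin (d + 1))) :
    kernelKStar Ω x y = kernelK Ω y x := by
  rw [kernelKStar, kernelK, ← neg_sub x y, inner_neg_left, norm_neg]
  ring

theorem gagliardoSq_eq_fracSq [SFinite (surfaceMeasure Ω)]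
    {f : EuclideanSpace ℝ (Fin (d + 1)) → 𝕜} (hf : StronglyMeasurable f) :
    gagliardoSq Ω f = fracSq (surfaceMeasure Ω) d (1 / 2) f := by
  have e : ∀ z : EuclideanSpace ℝ (Fin (d + 1)) × EuclideanSpace ℝ (Fin (d + 1)),
      ‖f z.1 - f z.2‖ₑ ^ 2 / ‖z.1 - z.2‖ₑ ^ (d + 1) =
        ‖f z.1 - f z.2‖ₑ ^ 2 * ‖z.1 - z.2‖ₑ ^ (-(d : ℝ) - 2 * (1 / 2)) := fun z ↦ by
    rw [div_eq_mul_inv, ← ENNReal.rpow_natCast _ (d + 1), ← ENNReal.rpow_neg]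
    congr 2
    push_cast; ring
  unfold gagliardoSq fracSq
  simp_rw [e]
  rw [lintegral_prod]
  refine Measurable.aemeasurable ?_
  exact (((hf.comp_measurable measurable_fst).sub
    (hf.comp_measurable measurable_snd)).enorm.pow_const 2).mul
    (IsSmoothingKernel.measurable_riesz _)

variable [IsFiniteMeasure (surfaceMeasure Ω)] {α : ℝ}

theorem PVMapsTo.eq_op (hk : IsSmoothingKernel (surfaceMeasure Ω) (frontier Ω) d α (kernelK Ω))
    {f w : L2 𝕜 Ω} (h : PVMapsTo Ω (kernelK Ω) f w) : w = hk.op f := by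
  refine Lp.ext ?_
  filter_upwards [h, hk.integrable_mul f, hk.coeFn_op f] with x hx hi ho
  rw [ho]
  exact tendsto_nhds_unique hx (tendsto_truncated_integral (hk.ae_ne x) hi)

/-- The operator with kernel `kernelKStar` is the transpose of the one with kernel `kernelK`. -/
theorem PVMapsTo.pairing_eq
    (hk : IsSmoothingKernel (surfaceMeasure Ω) (frontier Ω) d α (kernelK Ω))
    {u w : L2 𝕜 Ω} (h : PVMapsTo Ω (kernelKStar Ω) u w) (f f' : HHalf 𝕜 Ω)
    (hf : (f' : L2 𝕜 Ω) = hk.op (f : L2 𝕜 Ω)) : pairing w f = pairing u f' := by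
  have hw : w =ᵐ[surfaceMeasure Ω] fun y ↦ ∫ x, (kernelK Ω x y : 𝕜) * u x ∂(surfaceMeasure Ω) := by
    filter_upwards [h, hk.integrable_mul_left u] with x hx hi
    simp only [kernelKStar_eq] at hx
    exact tendsto_nhds_unique hx (tendsto_truncated_integral (hk.ae_ne x) hi)
  unfold pairing
  rw [hf]
  calc _ = ∫ y, (∫ x, (kernelK Ω x y : 𝕜) * u x ∂(surfaceMeasure Ω)) * (f : L2 𝕜 Ω) y
        ∂(surfaceMeasure Ω) := by
        refine integral_congr_ae ?_
        filter_upwards [hw] with y hy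
        rw [hy]
    _ = _ := hk.integral_transpose_mul u f
    _ = _ := by
        refine integral_congr_ae ?_
        filter_upwards [hk.coeFn_op (f : L2 𝕜 Ω)] with x hx
        rw [hx]

theorem mem_HHalf_iff {f : L2 𝕜 Ω} :
    f ∈ HHalf 𝕜 Ω ↔ fracSq (surfaceMeasure Ω) d (1 / 2) f < ∞ := by
  rw [← gagliardoSq_eq_fracSq (Lp.stronglyMeasurable f)]
  rfl

theorem op_mem_HHalf (hk : IsSmoothingKernel (surfaceMeasure Ω) (frontier Ω) d α (kernelK Ω))
    {f : L2 𝕜 Ω} (hf : f ∈ HHalf 𝕜 Ω) : hk.op f ∈ HHalf 𝕜 Ω := by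
  obtain ⟨C, hC⟩ := hk.fracSq_half_op_le (𝕜 := 𝕜)
  rw [mem_HHalf_iff] at hf ⊢
  refine (hC f).trans_lt (ENNReal.mul_lt_top ENNReal.coe_lt_top ?_)
  exact ENNReal.add_lt_top.2 ⟨hf, by simp⟩

/-- An eigenfunction `f` for `c ≠ 0` is a multiple of `K ^ n f`, which lies in `H^{1/2}`. -/
theorem IsEigenfunctionK.mem_HHalf
    (hk : IsSmoothingKernel (surfaceMeasure Ω) (frontier Ω) d α (kernelK Ω))
    {c : 𝕜} {f : L2 𝕜 Ω} (hc : c ≠ 0) (hf : IsEigenfunctionK Ω c f) : f ∈ HHalf 𝕜 Ω := by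
  obtain ⟨n, C, hC⟩ := hk.exists_fracSq_half_iterate_op_le (𝕜 := 𝕜)
  have h1 : c • f = hk.op f := hf.2.eq_op hk
  have hsmul : ∀ b : 𝕜, hk.op (b • f) = b • hk.op f := by
    intro b
    refine Lp.ext ?_
    filter_upwards [hk.coeFn_op (b • f), hk.coeFn_op f, Lp.coeFn_smul b (hk.op f)]
      with x h1 h2 h3
    rw [h1, h3, Pi.smul_apply, h2, smul_eq_mul, ← integral_const_mul]
    refine integral_congr_ae ?_
    filter_upwards [Lp.coeFn_smul b f] with y hy
    rw [hy, Pi.smul_apply, smul_eq_mul]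
    ring
  have hit : ∀ m : ℕ, hk.op^[m] f = c ^ m • f := by
    intro m
    induction m with
    | zero => simp
    | succ m ih => rw [Function.iterate_succ_apply', ih, hsmul, ← h1, smul_smul, pow_succ]
  have hmem : hk.op^[n] f ∈ HHalf 𝕜 Ω := by
    rw [mem_HHalf_iff]
    exact (hC f).trans_lt (ENNReal.mul_lt_top ENNReal.coe_lt_top (by simp))
  rw [hit] at hmem
  exact ((HHalf 𝕜 Ω).smul_mem_iff (pow_ne_zero n hc)).1 hmem

theorem hHalfNorm_le_of_sq_le {h : HHalf 𝕜 Ω} {C C' : NNReal} {r : ℝ}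
    (h1 : ‖(h : L2 𝕜 Ω)‖ₑ ^ 2 ≤ C * ENNReal.ofReal r ^ 2)
    (h2 : fracSq (surfaceMeasure Ω) d (1 / 2) (h : L2 𝕜 Ω) ≤ C' * ENNReal.ofReal r ^ 2)
    (hr : 0 ≤ r) : hHalfNorm h ≤ Real.sqrt (C + C') * r := by
  rw [hHalfNorm, gagliardoSq_eq_fracSq (Lp.stronglyMeasurable _)]
  refine Real.sqrt_le_iff.2 ⟨by positivity, ?_⟩
  rw [mul_pow, Real.sq_sqrt (by positivity), add_mul]
  refine add_le_add ?_ ?_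
  · have := ENNReal.toReal_mono (by finiteness) h1
    simpa [ENNReal.toReal_ofReal hr] using this
  · have := ENNReal.toReal_mono (by finiteness) h2
    simpa [ENNReal.toReal_ofReal hr] using this

/-- A functional on `H^{1/2}` that is bounded in the norm of `L²` belongs to `L²`. -/
theorem BelongsToL2.of_bound {g : HNegHalf 𝕜 Ω} {C : ℝ}
    (hg : ∀ h : HHalf 𝕜 Ω, ‖g.1 h‖ ≤ C * ‖(h : L2 𝕜 Ω)‖) : BelongsToL2 g := by
  obtain ⟨G, hG, -⟩ := exists_extension_norm_eq (HHalf 𝕜 Ω) (g.1.mkContinuous C hg)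
  set v := (InnerProductSpace.toDual 𝕜 (L2 𝕜 Ω)).symm G with hv
  refine ⟨star v, fun h ↦ ?_⟩
  have h1 : g.1 h = ⟪v, (h : L2 𝕜 Ω)⟫_𝕜 := by
    rw [hv, InnerProductSpace.toDual_symm_apply, hG]
    rfl
  rw [h1, L2.inner_def, pairing]
  refine integral_congr_ae ?_
  filter_upwards [Lp.coeFn_star v] with x hx
  rw [hx, RCLike.inner_apply, mul_comm]
  rfl

/-- An eigenfunctional `g` for `c ≠ 0` is a multiple of `g ∘ K ^ n`, which is bounded in the norm of
`L²`, since `K ^ n` maps `L²` to `H^{1/2}`. -/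
theorem IsEigenfunctionKStar.belongsToL2
    (hk : IsSmoothingKernel (surfaceMeasure Ω) (frontier Ω) d α (kernelK Ω))
    {c : 𝕜} {g : HNegHalf 𝕜 Ω} (hc : c ≠ 0) (hg : IsEigenfunctionKStar Ω c g) :
    BelongsToL2 g := by
  obtain ⟨n, C, hC⟩ := hk.exists_fracSq_half_iterate_op_le (𝕜 := 𝕜)
  obtain ⟨C', hC'⟩ := hk.enorm_iterate_op_sq_le (𝕜 := 𝕜) n
  obtain ⟨B, hB⟩ := g.2
  obtain ⟨u, w, huw, ⟨ε, hε, hu⟩, ⟨ε', hε', hw⟩⟩ := hg.2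
  let T : HHalf 𝕜 Ω → HHalf 𝕜 Ω := fun h ↦ ⟨hk.op h, op_mem_HHalf hk h.2⟩
  -- the eigenvalue equation, tested against `h` in `H^{1/2}`
  have htest : ∀ h, g.1 (T h) = c * g.1 h := by
    intro h
    have l1 : Tendsto (fun m ↦ pairing (u m) (T h)) atTop (𝓝 (g.1 (T h))) := by
      rw [tendsto_iff_norm_sub_tendsto_zero]
      refine squeeze_zero (fun _ ↦ norm_nonneg _) (fun m ↦ hu m (T h)) ?_
      simpa using hε.mul_const (hHalfNorm (T h))
    have l2 : Tendsto (fun m ↦ pairing (w m) h) atTop (𝓝 ((c • g).1 h)) := by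
      rw [tendsto_iff_norm_sub_tendsto_zero]
      refine squeeze_zero (fun _ ↦ norm_nonneg _) (fun m ↦ hw m h) ?_
      simpa using hε'.mul_const (hHalfNorm h)
    have : (fun m ↦ pairing (w m) h) = fun m ↦ pairing (u m) (T h) :=
      funext fun m ↦ (huw m).pairing_eq hk h (T h) rfl
    rw [this] at l2
    exact tendsto_nhds_unique l1 l2
  have hcoe : ∀ (m : ℕ) (h : HHalf 𝕜 Ω), ((T^[m] h : HHalf 𝕜 Ω) : L2 𝕜 Ω) = hk.op^[m] h := by
    intro m h
    induction m with
    | zero => rfl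
    | succ m ih => rw [Function.iterate_succ_apply', Function.iterate_succ_apply', ← ih]
  have hit : ∀ (m : ℕ) (h : HHalf 𝕜 Ω), g.1 (T^[m] h) = c ^ m * g.1 h := by
    intro m h
    induction m with
    | zero => simp
    | succ m ih => rw [Function.iterate_succ_apply', htest, ih, pow_succ]; ring
  refine BelongsToL2.of_bound (C := (‖c‖ ^ n)⁻¹ * (|B| * Real.sqrt (C' + C))) fun h ↦ ?_
  have hcn : 0 < ‖c‖ ^ n := pow_pos (norm_pos_iff.2 hc) n
  have hnorm : hHalfNorm (T^[n] h) ≤ Real.sqrt (C' + C) * ‖(h : L2 𝕜 Ω)‖ := by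
    refine hHalfNorm_le_of_sq_le ?_ ?_ (norm_nonneg _)
    · rw [hcoe, ofReal_norm]; exact hC' _
    · rw [hcoe, ofReal_norm]; exact hC _
  have hmain : ‖c‖ ^ n * ‖g.1 h‖ ≤ |B| * (Real.sqrt (C' + C) * ‖(h : L2 𝕜 Ω)‖) := by
    rw [← norm_pow, ← norm_mul, ← hit]
    refine (hB _).trans ?_
    exact (mul_le_mul_of_nonneg_right (le_abs_self B) (Real.sqrt_nonneg _)).trans
      (mul_le_mul_of_nonneg_left hnorm (abs_nonneg B))
  calc ‖g.1 h‖ = (‖c‖ ^ n)⁻¹ * (‖c‖ ^ n * ‖g.1 h‖) := by field_simp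
    _ ≤ (‖c‖ ^ n)⁻¹ * (|B| * (Real.sqrt (C' + C) * ‖(h : L2 𝕜 Ω)‖)) := by gcongr
    _ = _ := by ring

end layerPotentials

/-! ### The area formula for graphs -/

/-- A local comparison of two measures is a global one. -/
theorem measure_le_smul_of_local {X : Type*} [TopologicalSpace X] [SecondCountableTopology X]
    [MeasurableSpace X] [BorelSpace X] {μ ν : Measure X} {c : ℝ≥0∞}
    (h : ∀ x, ∃ U ∈ 𝓝 x, ∀ A, MeasurableSet A → A ⊆ U → μ A ≤ c * ν A) {A : Set X}
    (hA : MeasurableSet A) : μ A ≤ c * ν A := by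
  choose U hU hUA using h
  obtain ⟨s, hs, hcov⟩ := TopologicalSpace.countable_cover_nhds
    (f := fun x ↦ interior (U x)) fun x ↦ interior_mem_nhds.2 (hU x)
  rcases s.eq_empty_or_nonempty with rfl | hne
  · have : A = ∅ := by
      rw [eq_empty_iff_forall_notMem]
      intro x
      have : x ∈ (univ : Set X) := mem_univ x
      rw [← hcov] at this
      simp at this
    simp [this]
  obtain ⟨e, rfl⟩ := hs.exists_eq_range hne
  set V : ℕ → Set X := fun n ↦ interior (U (e n)) with hV
  have hVm : ∀ n, MeasurableSet (V n) := fun n ↦ isOpen_interior.measurableSet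
  have hVu : ⋃ n, V n = univ := by simpa using hcov
  have hDm : ∀ n, MeasurableSet (disjointed V n) := fun n ↦ MeasurableSet.disjointed hVm n
  have hdec : ∀ ρ : Measure X, ρ A = ∑' n, ρ (A ∩ disjointed V n) := fun ρ ↦ by
    rw [← measure_iUnion (fun i j hij ↦ (disjoint_disjointed V hij).mono inter_subset_right
      inter_subset_right) (fun n ↦ hA.inter (hDm n)), ← inter_iUnion, iUnion_disjointed, hVu,
      inter_univ]
  rw [hdec μ, hdec ν, ← ENNReal.tsum_mul_left]
  refine ENNReal.tsum_le_tsum fun n ↦ hUA (e n) _ (hA.inter (hDm n)) ?_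
  exact inter_subset_right.trans ((disjointed_subset V n).trans interior_subset)

/-- If `f` expands distances on `A` by at most the factor `K` more than `g` does, the Hausdorff
measures of the images compare accordingly. -/
theorem euclideanHausdorffMeasure_image_le {Z X Y : Type*} [Nonempty Z]
    [MetricSpace X] [MeasurableSpace X] [BorelSpace X] [MetricSpace Y] [MeasurableSpace Y]
    [BorelSpace Y] {f : Z → X} {g : Z → Y} {A : Set Z} {K : NNReal} (d : ℕ)
    (h : ∀ v ∈ A, ∀ w ∈ A, dist (f v) (f w) ≤ K * dist (g v) (g w)) :
    Measure.euclideanHausdorffMeasure d (f '' A) ≤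
      K ^ d * Measure.euclideanHausdorffMeasure d (g '' A) := by
  set i := Function.invFunOn g A with hi
  have hiA : ∀ y ∈ g '' A, i y ∈ A := fun y hy ↦ Function.invFunOn_mem hy
  have hig : ∀ y ∈ g '' A, g (i y) = y := fun y hy ↦ Function.invFunOn_eq hy
  have hlip : LipschitzOnWith K (f ∘ i) (g '' A) := by
    refine LipschitzOnWith.of_dist_le_mul fun y hy y' hy' ↦ ?_
    have := h _ (hiA y hy) _ (hiA y' hy')
    rwa [hig y hy, hig y' hy'] at this
  have himg : f '' A = (f ∘ i) '' (g '' A) := by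
    rw [← image_comp]
    refine image_congr fun v hv ↦ ?_
    have hv' : g v ∈ g '' A := mem_image_of_mem g hv
    have := h v hv _ (hiA _ hv')
    rw [hig _ hv', dist_self, mul_zero] at this
    exact dist_le_zero.1 this
  have hH := hlip.hausdorffMeasure_image_le (d := (d : ℝ)) (by positivity)
  rw [← himg, ENNReal.rpow_natCast] at hH
  rw [Measure.euclideanHausdorffMeasure_def, Measure.euclideanHausdorffMeasure_def,
    Measure.smul_apply, Measure.smul_apply, mul_smul_comm]
  gcongr

/-- A linear map `T` of `E` such that `w ↦ T w` and the graph map `w ↦ (w, ℓ w)` have the same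
norms; the Jacobian determinant of the graph of `ℓ` is read off from it. -/
theorem exists_linearMap_norm_eq_graph {E : Type*} [NormedAddCommGroup E] [InnerProductSpace ℝ E]
    [FiniteDimensional ℝ E] (ℓ : E →L[ℝ] ℝ) :
    ∃ T : E →ₗ[ℝ] E, |LinearMap.det T| = Real.sqrt (1 + ‖ℓ‖ ^ 2) ∧
      ∀ w, ‖T w‖ ^ 2 = ‖w‖ ^ 2 + ℓ w ^ 2 := by
  have : CompleteSpace E := FiniteDimensional.complete ℝ E
  set a := (InnerProductSpace.toDual ℝ E).symm ℓ with ha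
  have hℓ : ∀ w, ℓ w = ⟪a, w⟫_ℝ := fun w ↦ by rw [ha, InnerProductSpace.toDual_symm_apply]
  have hna : ‖a‖ = ‖ℓ‖ := by rw [ha, LinearIsometryEquiv.norm_map]
  set s := Real.sqrt (1 + ‖ℓ‖ ^ 2) with hs
  have hs0 : 0 ≤ s := Real.sqrt_nonneg _
  have hs2 : s ^ 2 = 1 + ‖ℓ‖ ^ 2 := Real.sq_sqrt (by positivity)
  -- `w + c (ℓ w) a` has the required norm if `2 c + c² |ℓ|² = 1`
  set c := 1 / (s + 1) with hc
  have hc1 : c * (s + 1) = 1 := by rw [hc]; field_simp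
  have hcs : c * ‖ℓ‖ ^ 2 = s - 1 := by linear_combination c * (-hs2) + (s - 1) * hc1
  refine ⟨LinearMap.transvection (ℓ : E →ₗ[ℝ] ℝ) (c • a), ?_, fun w ↦ ?_⟩
  · rw [LinearMap.transvection.det]
    have : (ℓ : E →ₗ[ℝ] ℝ) (c • a) = c * ‖ℓ‖ ^ 2 := by
      rw [ContinuousLinearMap.coe_coe, map_smul, hℓ, real_inner_self_eq_norm_sq, hna, smul_eq_mul]
    rw [this, hcs, add_sub_cancel, abs_of_nonneg hs0]
  · have : LinearMap.transvection (ℓ : E →ₗ[ℝ] ℝ) (c • a) w = w + (ℓ w * c) • a := by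
      rw [LinearMap.transvection.apply, ContinuousLinearMap.coe_coe, smul_smul]
    rw [this, norm_add_sq_real, inner_smul_right, real_inner_comm, ← hℓ, norm_smul, mul_pow, hna,
      Real.norm_eq_abs, sq_abs]
    linear_combination (ℓ w) ^ 2 * c * hcs + (ℓ w) ^ 2 * hc1

section graph

variable {d : ℕ}

/-- The graph of `φ` in the Cartesian coordinates `Φ`, parametrized by the base. -/
def graphMap (Φ : EuclideanSpace ℝ (Fin (d + 1)) ≃ᵃⁱ[ℝ] WithLp 2 (EuclideanSpace ℝ (Fin d) × ℝ))
    (φ : EuclideanSpace ℝ (Fin d) → ℝ) (v : EuclideanSpace ℝ (Fin d)) :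
    EuclideanSpace ℝ (Fin (d + 1)) :=
  Φ.symm (WithLp.toLp 2 (v, φ v))

/-- The density of the surface measure of the graph of `φ` in the base coordinates. -/
def graphDensity (φ : EuclideanSpace ℝ (Fin d) → ℝ) (v : EuclideanSpace ℝ (Fin d)) : ℝ :=
  Real.sqrt (1 + ‖fderiv ℝ φ v‖ ^ 2)

variable (Φ : EuclideanSpace ℝ (Fin (d + 1)) ≃ᵃⁱ[ℝ] WithLp 2 (EuclideanSpace ℝ (Fin d) × ℝ))
  {φ : EuclideanSpace ℝ (Fin d) → ℝ}

theorem one_le_graphDensity (v : EuclideanSpace ℝ (Fin d)) : 1 ≤ graphDensity φ v := by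
  rw [graphDensity, Real.one_le_sqrt]
  nlinarith [norm_nonneg (fderiv ℝ φ v)]

theorem continuous_graphDensity (hφ : ContDiff ℝ 1 φ) : Continuous (graphDensity φ) := by
  have := hφ.continuous_fderiv one_ne_zero
  unfold graphDensity
  fun_prop

theorem norm_sub_sq_eq (x y : EuclideanSpace ℝ (Fin (d + 1))) :
    ‖x - y‖ ^ 2 = ‖(Φ x).fst - (Φ y).fst‖ ^ 2 + ((Φ x).snd - (Φ y).snd) ^ 2 := by
  have h : ‖x - y‖ = ‖Φ x - Φ y‖ := by
    rw [← dist_eq_norm, ← dist_eq_norm, Φ.dist_map]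
  rw [h, WithLp.prod_norm_sq_eq_of_L2]
  simp

theorem norm_fst_sub_le (x y : EuclideanSpace ℝ (Fin (d + 1))) :
    ‖(Φ x).fst - (Φ y).fst‖ ≤ ‖x - y‖ := by
  have := norm_sub_sq_eq Φ x y
  exact (sq_le_sq₀ (norm_nonneg _) (norm_nonneg _)).1
    (by nlinarith [sq_nonneg ((Φ x).snd - (Φ y).snd)])

theorem apply_graphMap (v : EuclideanSpace ℝ (Fin d)) :
    Φ (graphMap Φ φ v) = WithLp.toLp 2 (v, φ v) := by
  simp [graphMap]

theorem fst_graphMap (v : EuclideanSpace ℝ (Fin d)) : (Φ (graphMap Φ φ v)).fst = v := by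
  rw [apply_graphMap]
  rfl

theorem snd_graphMap (v : EuclideanSpace ℝ (Fin d)) : (Φ (graphMap Φ φ v)).snd = φ v := by
  rw [apply_graphMap]
  rfl

theorem norm_graphMap_sub_sq (u v : EuclideanSpace ℝ (Fin d)) :
    ‖graphMap Φ φ u - graphMap Φ φ v‖ ^ 2 = ‖u - v‖ ^ 2 + (φ u - φ v) ^ 2 := by
  rw [norm_sub_sq_eq Φ, apply_graphMap, apply_graphMap]
  rfl

theorem norm_sub_le_graphMap (u v : EuclideanSpace ℝ (Fin d)) :
    ‖u - v‖ ≤ ‖graphMap Φ φ u - graphMap Φ φ v‖ := by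
  have := norm_fst_sub_le Φ (graphMap Φ φ u) (graphMap Φ φ v)
  simpa [apply_graphMap] using this

theorem eq_graphMap {x : EuclideanSpace ℝ (Fin (d + 1))} (hx : (Φ x).snd = φ (Φ x).fst) :
    x = graphMap Φ φ (Φ x).fst := by
  apply Φ.injective
  rw [apply_graphMap, ← hx]
  rfl

theorem continuous_graphMap (hφ : Continuous φ) : Continuous (graphMap Φ φ) := by
  unfold graphMap
  have := Φ.symm.continuous
  fun_prop

theorem measurableEmbedding_graphMap (hφ : Continuous φ) : MeasurableEmbedding (graphMap Φ φ) := by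
  refine (continuous_graphMap Φ hφ).measurableEmbedding fun u v huv ↦ ?_
  have := norm_sub_le_graphMap Φ (φ := φ) u v
  rw [huv, sub_self, norm_zero] at this
  exact sub_eq_zero.1 (norm_le_zero_iff.1 this)

/-- Near each point the graph map is almost an isometry, after a linear change of variables. -/
theorem exists_linearMap_dist_graphMap (hφ : ContDiff ℝ 1 φ) {K : ℝ} (hK : 1 < K)
    (u : EuclideanSpace ℝ (Fin d)) :
    ∃ T : EuclideanSpace ℝ (Fin d) →ₗ[ℝ] EuclideanSpace ℝ (Fin d),
      |LinearMap.det T| = graphDensity φ u ∧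
      ∃ U ∈ 𝓝 u, ∀ v ∈ U, ∀ w ∈ U,
        dist (graphMap Φ φ v) (graphMap Φ φ w) ≤ K * dist (T v) (T w) ∧
        dist (T v) (T w) ≤ K * dist (graphMap Φ φ v) (graphMap Φ φ w) := by
  obtain ⟨T, hdet, hT⟩ := exists_linearMap_norm_eq_graph (fderiv ℝ φ u)
  refine ⟨T, hdet, ?_⟩
  have hK0 : 0 < K := by linarith
  set ε := 1 - K⁻¹ with hε
  have hε0 : 0 < ε := by rw [hε, sub_pos]; exact inv_lt_one_of_one_lt₀ hK
  have hstrict : HasStrictFDerivAt φ (fderiv ℝ φ u) u :=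
    hφ.contDiffAt.hasStrictFDerivAt one_ne_zero
  obtain ⟨U, hU, hUb⟩ := (hstrict.isLittleO.def hε0).exists_mem
  rw [nhds_prod_eq] at hU
  obtain ⟨V, hV, hVU⟩ := mem_prod_same_iff.1 hU
  refine ⟨V, hV, fun v hv w hw ↦ ?_⟩
  have hb := hUb (v, w) (hVU ⟨hv, hw⟩)
  simp only at hb
  have hTn : ‖v - w‖ ≤ ‖T v - T w‖ := by
    rw [← map_sub]
    exact (sq_le_sq₀ (norm_nonneg _) (norm_nonneg _)).1
      (by nlinarith [hT (v - w), sq_nonneg (fderiv ℝ φ u (v - w))])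
  have hcmp : |‖graphMap Φ φ v - graphMap Φ φ w‖ - ‖T v - T w‖| ≤ ε * ‖T v - T w‖ := by
    set p : WithLp 2 (EuclideanSpace ℝ (Fin d) × ℝ) := WithLp.toLp 2 (v - w, φ v - φ w)
    set q : WithLp 2 (EuclideanSpace ℝ (Fin d) × ℝ) :=
      WithLp.toLp 2 (v - w, fderiv ℝ φ u (v - w))
    have hp : ‖graphMap Φ φ v - graphMap Φ φ w‖ = ‖p‖ := by
      rw [← sq_eq_sq₀ (norm_nonneg _) (norm_nonneg _), norm_graphMap_sub_sq,
        WithLp.prod_norm_sq_eq_of_L2]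
      simp [p]
    have hq : ‖T v - T w‖ = ‖q‖ := by
      rw [← sq_eq_sq₀ (norm_nonneg _) (norm_nonneg _), ← map_sub, hT,
        WithLp.prod_norm_sq_eq_of_L2]
      simp [q]
    have hpq : ‖p - q‖ ≤ ε * ‖v - w‖ := by
      refine le_trans (le_of_eq ?_) hb
      rw [← sq_eq_sq₀ (norm_nonneg _) (norm_nonneg _), WithLp.prod_norm_sq_eq_of_L2]
      simp [p, q]
    rw [hp]
    nth_rewrite 1 [hq]
    exact (abs_norm_sub_norm_le p q).trans (hpq.trans (by gcongr))
  rw [dist_eq_norm, dist_eq_norm]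
  obtain ⟨h1, h2⟩ := abs_le.1 hcmp
  have hn := norm_nonneg (T v - T w)
  have hKi : K * K⁻¹ = 1 := mul_inv_cancel₀ hK0.ne'
  constructor
  · have : 1 + ε ≤ K := by
      have : K⁻¹ * (K - 1) ^ 2 ≥ 0 := by positivity
      nlinarith
    nlinarith
  · have h3 : K⁻¹ * ‖T v - T w‖ ≤ ‖graphMap Φ φ v - graphMap Φ φ w‖ := by
      rw [hε] at h1; linarith
    calc ‖T v - T w‖ = K * (K⁻¹ * ‖T v - T w‖) := by rw [← mul_assoc, hKi, one_mul]
      _ ≤ _ := by gcongr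

/-- The area formula for graphs: the Hausdorff measure on the graph of `φ` has density
`√(1 + |∇φ|²)` in the base coordinates. -/
theorem comap_graphMap (hφ : ContDiff ℝ 1 φ) :
    (Measure.euclideanHausdorffMeasure d).comap (graphMap Φ φ) =
      volume.withDensity fun v ↦ ENNReal.ofReal (graphDensity φ v) := by
  have hemb := measurableEmbedding_graphMap Φ hφ.continuous
  have hJ := continuous_graphDensity hφ
  set μ := (Measure.euclideanHausdorffMeasure d).comap (graphMap Φ φ) with hμ
  set ν := (volume : Measure (EuclideanSpace ℝ (Fin d))).withDensity
    fun v ↦ ENNReal.ofReal (graphDensity φ v) with hν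
  -- comparison up to a factor `K ^ (d + 1)`, for every `K > 1`
  have key : ∀ K : NNReal, 1 < K → ∀ A, MeasurableSet A →
      μ A ≤ K ^ (d + 1) * ν A ∧ ν A ≤ K ^ (d + 1) * μ A := by
    intro K hK
    have loc : ∀ u, ∃ U ∈ 𝓝 u, ∀ A, MeasurableSet A → A ⊆ U →
        μ A ≤ K ^ (d + 1) * ν A ∧ ν A ≤ K ^ (d + 1) * μ A := by
      intro u
      obtain ⟨T, hdet, U, hU, hUT⟩ := exists_linearMap_dist_graphMap Φ hφ
        (K := K) (by exact_mod_cast hK) u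
      have hJ0 : 0 < graphDensity φ u := one_pos.trans_le (one_le_graphDensity u)
      have hKr : (1 : ℝ) < K := by exact_mod_cast hK
      have hV : {v | graphDensity φ v < K * graphDensity φ u ∧
          graphDensity φ u < K * graphDensity φ v} ∈ 𝓝 u := by
        refine Filter.inter_mem ?_ ?_
        · exact hJ.continuousAt.eventually_lt continuousAt_const (by nlinarith)
        · exact continuousAt_const.eventually_lt (hJ.continuousAt.const_mul _) (by nlinarith)
      refine ⟨_, Filter.inter_mem hU hV, fun A hA hAU ↦ ?_⟩
      have e1 : μ A = Measure.euclideanHausdorffMeasure d (graphMap Φ φ '' A) := by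
        rw [hμ, hemb.comap_apply]
      have e2 : Measure.euclideanHausdorffMeasure d (T '' A) =
          ENNReal.ofReal (graphDensity φ u) * volume A := by
        rw [EuclideanSpace.euclideanHausdorffMeasure_eq_volume,
          Measure.addHaar_image_linearMap, hdet]
      have i1 := euclideanHausdorffMeasure_image_le (f := graphMap Φ φ) (g := T) (A := A) (K := K)
        d fun v hv w hw ↦ (hUT v (hAU hv).1 w (hAU hw).1).1
      have i2 := euclideanHausdorffMeasure_image_le (f := T) (g := graphMap Φ φ) (A := A) (K := K)
        d fun v hv w hw ↦ (hUT v (hAU hv).1 w (hAU hw).1).2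
      rw [e2, ← e1] at i1
      rw [e2, ← e1] at i2
      have e3 : ν A = ∫⁻ v in A, ENNReal.ofReal (graphDensity φ v) := withDensity_apply _ hA
      have j1 : ν A ≤ K * (ENNReal.ofReal (graphDensity φ u) * volume A) := by
        rw [e3, ← mul_assoc, ← setLIntegral_const]
        refine setLIntegral_mono' hA fun v hv ↦ ?_
        rw [← ENNReal.ofReal_coe_nnreal, ← ENNReal.ofReal_mul (by positivity)]
        exact ENNReal.ofReal_le_ofReal (hAU hv).2.1.le
      have j2 : ENNReal.ofReal (graphDensity φ u) * volume A ≤ K * ν A := by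
        rw [e3, ← setLIntegral_const, ← lintegral_const_mul' _ _ (by simp)]
        refine setLIntegral_mono' hA fun v hv ↦ ?_
        rw [← ENNReal.ofReal_coe_nnreal, ← ENNReal.ofReal_mul (by positivity)]
        exact ENNReal.ofReal_le_ofReal (hAU hv).2.2.le
      constructor
      · calc μ A ≤ K ^ d * (ENNReal.ofReal (graphDensity φ u) * volume A) := i1
          _ ≤ K ^ d * (K * ν A) := by gcongr
          _ = _ := by rw [pow_succ]; ring
      · calc ν A ≤ K * (ENNReal.ofReal (graphDensity φ u) * volume A) := j1
          _ ≤ K * (K ^ d * μ A) := by gcongr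
          _ = _ := by rw [pow_succ]; ring
    intro A hA
    constructor
    · refine measure_le_smul_of_local (fun x ↦ ?_) hA
      obtain ⟨U, hU, h⟩ := loc x
      exact ⟨U, hU, fun A hA hAU ↦ (h A hA hAU).1⟩
    · refine measure_le_smul_of_local (fun x ↦ ?_) hA
      obtain ⟨U, hU, h⟩ := loc x
      exact ⟨U, hU, fun A hA hAU ↦ (h A hA hAU).2⟩
  have lim : ∀ a b : ℝ≥0∞, (∀ K : NNReal, 1 < K → a ≤ K ^ (d + 1) * b) → a ≤ b := by
    intro a b hab
    have ht : Tendsto (fun K : NNReal ↦ (K : ℝ≥0∞) ^ (d + 1) * b) (𝓝[>] 1) (𝓝 (1 * b)) := by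
      refine ENNReal.Tendsto.mul_const ?_ (Or.inl one_ne_zero)
      have : Continuous fun K : NNReal ↦ (K : ℝ≥0∞) ^ (d + 1) := by fun_prop
      have h1 := this.tendsto 1
      simp only [ENNReal.coe_one, one_pow] at h1
      exact h1.mono_left nhdsWithin_le_nhds
    rw [one_mul] at ht
    refine ge_of_tendsto ht ?_
    filter_upwards [self_mem_nhdsWithin] with K hK using hab K hK
  ext A hA
  exact le_antisymm (lim _ _ fun K hK ↦ (key K hK A hA).1) (lim _ _ fun K hK ↦ (key K hK A hA).2)

end graph

/-! ### Charts of a `C^{1,α}` boundary -/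

section

variable {d : ℕ}

/-- On the ball `B(p, r)` the open set `Ω` is the region below the graph of the `C^{1,α}` function
`φ`, in the Cartesian coordinates `Φ`. -/
structure IsGraphChart (α : ℝ) (Ω : Set (EuclideanSpace ℝ (Fin (d + 1))))
    (Φ : EuclideanSpace ℝ (Fin (d + 1)) ≃ᵃⁱ[ℝ] WithLp 2 (EuclideanSpace ℝ (Fin d) × ℝ))
    (φ : EuclideanSpace ℝ (Fin d) → ℝ) (p : EuclideanSpace ℝ (Fin (d + 1))) (r : ℝ) : Prop where
  isOpen : IsOpen Ω
  contDiff : ContDiff ℝ 1 φ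
  holder : ∃ C, 0 ≤ C ∧ ∀ u v, ‖fderiv ℝ φ u - fderiv ℝ φ v‖ ≤ C * ‖u - v‖ ^ α
  pos : 0 < r
  mem_iff : ∀ x ∈ Metric.ball p r, (x ∈ Ω ↔ (Φ x).snd < φ (Φ x).fst)

theorem HasC1HolderBoundary.exists_chart {α : ℝ} {Ω : Set (EuclideanSpace ℝ (Fin (d + 1)))}
    (h : HasC1HolderBoundary α Ω) (hΩ : IsOpen Ω) {p : EuclideanSpace ℝ (Fin (d + 1))}
    (hp : p ∈ frontier Ω) : ∃ Φ φ r, IsGraphChart α Ω Φ φ p r := by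
  obtain ⟨Φ, φ, h1, ⟨C, hC⟩, r, hr, h2⟩ := h p hp
  refine ⟨Φ, φ, r, hΩ, h1, ⟨|C|, abs_nonneg _, fun u v ↦ (hC u v).trans ?_⟩, hr, h2⟩
  gcongr
  exact le_abs_self C

/-- The unit normal, pointing upwards, of the graph of `φ` over `u`. -/
def graphNormal (Φ : EuclideanSpace ℝ (Fin (d + 1)) ≃ᵃⁱ[ℝ] WithLp 2 (EuclideanSpace ℝ (Fin d) × ℝ))
    (φ : EuclideanSpace ℝ (Fin d) → ℝ) (u : EuclideanSpace ℝ (Fin d)) :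
    EuclideanSpace ℝ (Fin (d + 1)) :=
  Φ.linearIsometryEquiv.symm (WithLp.toLp 2
    (-(graphDensity φ u)⁻¹ • (InnerProductSpace.toDual ℝ _).symm (fderiv ℝ φ u),
      (graphDensity φ u)⁻¹))

section

variable (Φ : EuclideanSpace ℝ (Fin (d + 1)) ≃ᵃⁱ[ℝ] WithLp 2 (EuclideanSpace ℝ (Fin d) × ℝ))
  {φ : EuclideanSpace ℝ (Fin d) → ℝ}

theorem graphDensity_pos (u : EuclideanSpace ℝ (Fin d)) : 0 < graphDensity φ u :=
  one_pos.trans_le (one_le_graphDensity u)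

theorem inner_graphNormal (u : EuclideanSpace ℝ (Fin d)) (y z : EuclideanSpace ℝ (Fin (d + 1))) :
    ⟪y - z, graphNormal Φ φ u⟫_ℝ =
      ((Φ y).snd - (Φ z).snd - fderiv ℝ φ u ((Φ y).fst - (Φ z).fst)) / graphDensity φ u := by
  have h1 : Φ.linearIsometryEquiv (y - z) = Φ y - Φ z := by
    have := Φ.map_vsub y z
    simpa using this
  rw [graphNormal, ← LinearIsometryEquiv.inner_map_map Φ.linearIsometryEquiv,
    LinearIsometryEquiv.apply_symm_apply, h1, WithLp.prod_inner_apply]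
  simp only [WithLp.ofLp_sub, Prod.fst_sub, Prod.snd_sub, inner_smul_right]
  rw [real_inner_comm, InnerProductSpace.toDual_symm_apply]
  simp only [RCLike.inner_apply, conj_trivial]
  change -(graphDensity φ u)⁻¹ * fderiv ℝ φ u ((Φ y).fst - (Φ z).fst) +
    (graphDensity φ u)⁻¹ * ((Φ y).snd - (Φ z).snd) = _
  ring

theorem norm_graphNormal (u : EuclideanSpace ℝ (Fin d)) : ‖graphNormal Φ φ u‖ = 1 := by
  have hJ := graphDensity_pos (φ := φ) u
  have hJ2 : graphDensity φ u ^ 2 = 1 + ‖fderiv ℝ φ u‖ ^ 2 := Real.sq_sqrt (by positivity)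
  rw [← sq_eq_sq₀ (norm_nonneg _) zero_le_one, graphNormal, LinearIsometryEquiv.norm_map,
    WithLp.prod_norm_sq_eq_of_L2]
  change ‖-(graphDensity φ u)⁻¹ • (InnerProductSpace.toDual ℝ _).symm (fderiv ℝ φ u)‖ ^ 2 +
    ‖(graphDensity φ u)⁻¹‖ ^ 2 = 1 ^ 2
  simp only [norm_smul, LinearIsometryEquiv.norm_map, Real.norm_eq_abs, abs_neg, abs_inv,
    abs_of_pos hJ]
  field_simp
  rw [hJ2]; ring

theorem continuous_graphNormal (hφ : ContDiff ℝ 1 φ) : Continuous (graphNormal Φ φ) := by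
  have h1 := hφ.continuous_fderiv one_ne_zero
  have h2 : Continuous fun u ↦ (graphDensity φ u)⁻¹ :=
    (continuous_graphDensity hφ).inv₀ fun u ↦ (graphDensity_pos u).ne'
  unfold graphNormal
  have h3 := (InnerProductSpace.toDual ℝ (EuclideanSpace ℝ (Fin d))).symm.continuous
  have h4 := Φ.linearIsometryEquiv.symm.continuous
  fun_prop

end

namespace IsGraphChart

variable {α : ℝ} {Ω : Set (EuclideanSpace ℝ (Fin (d + 1)))}
  {Φ : EuclideanSpace ℝ (Fin (d + 1)) ≃ᵃⁱ[ℝ] WithLp 2 (EuclideanSpace ℝ (Fin d) × ℝ)}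
  {φ : EuclideanSpace ℝ (Fin d) → ℝ} {p : EuclideanSpace ℝ (Fin (d + 1))} {r : ℝ}

theorem continuous_snd_sub (h : IsGraphChart α Ω Φ φ p r) :
    Continuous fun x ↦ (Φ x).snd - φ (Φ x).fst := by
  have h1 := Φ.continuous
  have h2 := h.contDiff.continuous
  have h3 : Continuous fun x ↦ (Φ x).fst := by fun_prop
  have h4 : Continuous fun x ↦ (Φ x).snd := by fun_prop
  fun_prop

theorem mem_frontier_iff (h : IsGraphChart α Ω Φ φ p r) {x : EuclideanSpace ℝ (Fin (d + 1))}
    (hx : x ∈ Metric.ball p r) : x ∈ frontier Ω ↔ (Φ x).snd = φ (Φ x).fst := by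
  rw [h.isOpen.frontier_eq, Set.mem_sdiff, h.mem_iff x hx, not_lt]
  have hball := Metric.isOpen_ball.mem_nhds hx
  constructor
  · rintro ⟨hcl, hle⟩
    refine le_antisymm ?_ hle
    by_contra! hlt
    have hev : ∀ᶠ y in 𝓝 x, y ∈ Metric.ball p r ∧ 0 < (Φ y).snd - φ (Φ y).fst :=
      Filter.Eventually.and hball
        (continuousAt_const.eventually_lt h.continuous_snd_sub.continuousAt (by linarith))
    obtain ⟨y, hyΩ, hy1, hy2⟩ := (mem_closure_iff_frequently.1 hcl).and_eventually hev |>.exists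
    have := (h.mem_iff y hy1).1 hyΩ
    linarith
  · intro heq
    refine ⟨?_, heq.ge⟩
    set γ : ℝ → EuclideanSpace ℝ (Fin (d + 1)) :=
      fun t ↦ Φ.symm (WithLp.toLp 2 ((Φ x).fst, φ (Φ x).fst - t)) with hγ
    have hγc : Continuous γ := by
      have := Φ.symm.continuous
      fun_prop
    have hγ0 : γ 0 = x := by
      rw [hγ]
      simp only [sub_zero]
      exact (eq_graphMap Φ heq).symm
    have ht : Tendsto γ (𝓝[>] 0) (𝓝 x) := by
      have := hγc.tendsto 0
      rw [hγ0] at this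
      exact this.mono_left nhdsWithin_le_nhds
    refine mem_closure_of_tendsto ht ?_
    filter_upwards [ht.eventually hball, self_mem_nhdsWithin] with t h1 h2
    rw [h.mem_iff _ h1]
    have : Φ (γ t) = WithLp.toLp 2 ((Φ x).fst, φ (Φ x).fst - t) := by simp [hγ]
    rw [this]
    have h2' : 0 < t := h2
    change φ (Φ x).fst - t < φ (Φ x).fst
    linarith

theorem isOutwardUnitNormal (h : IsGraphChart α Ω Φ φ p r)
    {x : EuclideanSpace ℝ (Fin (d + 1))} (hx : x ∈ Metric.ball p r) (hxf : x ∈ frontier Ω) :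
    IsOutwardUnitNormal Ω x (graphNormal Φ φ (Φ x).fst) := by
  refine ⟨norm_graphNormal Φ _, fun ε hε ↦ ?_⟩
  set u := (Φ x).fst with hu
  have hxg := (h.mem_frontier_iff hx).1 hxf
  have hd : HasFDerivAt φ (fderiv ℝ φ u) u :=
    (h.contDiff.differentiable one_ne_zero u).hasFDerivAt
  have hev := hd.isLittleO.def (half_pos hε)
  obtain ⟨δ₁, hδ₁, hb⟩ := Metric.eventually_nhds_iff_ball.1 hev
  obtain ⟨δ₂, hδ₂, hb2⟩ := Metric.isOpen_iff.1 Metric.isOpen_ball x hx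
  refine ⟨min δ₁ δ₂, lt_min hδ₁ hδ₂, fun y hy ↦ ?_⟩
  have hy1 : (Φ y).fst ∈ Metric.ball u δ₁ := by
    rw [mem_ball_iff_norm] at hy ⊢
    exact (norm_fst_sub_le Φ y x).trans_lt (hy.trans_le (min_le_left _ _))
  have hy2 : y ∈ Metric.ball p r := hb2 (Metric.ball_subset_ball (min_le_right _ _) hy)
  have hb' := hb _ hy1
  have hn : ‖(Φ y).fst - u‖ ≤ ‖y - x‖ := norm_fst_sub_le Φ y x
  rw [Real.norm_eq_abs] at hb'
  obtain ⟨b1, b2⟩ := abs_le.1 hb'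
  have hJ := one_le_graphDensity (φ := φ) u
  have hJ0 := graphDensity_pos (φ := φ) u
  have hn0 := norm_nonneg (y - x)
  rw [inner_graphNormal, h.mem_iff y hy2, ← hu]
  have hε2 : ε * ‖y - x‖ ≤ ε * ‖y - x‖ * graphDensity φ u :=
    le_mul_of_one_le_right (by positivity) hJ
  have hε3 : ε / 2 * ‖(Φ y).fst - u‖ ≤ ε / 2 * ‖y - x‖ := by gcongr
  have hε4 : 0 ≤ ε / 2 * ‖y - x‖ := by positivity
  constructor
  · intro hlt
    rw [div_lt_iff₀ hJ0] at hlt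
    linarith
  · intro hlt
    rw [lt_div_iff₀ hJ0] at hlt
    rw [not_lt]
    linarith

theorem outwardNormal_eq (h : IsGraphChart α Ω Φ φ p r)
    {x : EuclideanSpace ℝ (Fin (d + 1))} (hx : x ∈ Metric.ball p r) (hxf : x ∈ frontier Ω) :
    outwardNormal Ω x = graphNormal Φ φ (Φ x).fst := by
  have hN := h.isOutwardUnitNormal hx hxf
  have hex : ∃ n, IsOutwardUnitNormal Ω x n := ⟨_, hN⟩
  rw [outwardNormal, dif_pos hex]
  exact hex.choose_spec.unique hN

/-- The basic estimate for the normal component of chords of a `C^{1,α}` surface. -/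
theorem exists_abs_inner_le (hα : 0 < α) (h : IsGraphChart α Ω Φ φ p r) :
    ∃ C, ∀ x ∈ frontier Ω ∩ Metric.ball p r, ∀ x' ∈ frontier Ω ∩ Metric.ball p r,
      ∀ y ∈ frontier Ω ∩ Metric.ball p r,
      |⟪x - x', outwardNormal Ω y⟫_ℝ| ≤ C * (‖x - x'‖ * (‖x - y‖ + ‖x' - y‖) ^ α) := by
  obtain ⟨C, hC0, hC⟩ := h.holder
  refine ⟨C, fun x hx x' hx' y hy ↦ ?_⟩
  rw [h.outwardNormal_eq hy.2 hy.1, inner_graphNormal, (h.mem_frontier_iff hx.2).1 hx.1,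
    (h.mem_frontier_iff hx'.2).1 hx'.1]
  set u := (Φ x).fst
  set u' := (Φ x').fst
  set v := (Φ y).fst
  have hJ := one_le_graphDensity (φ := φ) v
  have n1 : ‖u - u'‖ ≤ ‖x - x'‖ := norm_fst_sub_le Φ x x'
  have n2 : ‖u - v‖ ≤ ‖x - y‖ := norm_fst_sub_le Φ x y
  have n3 : ‖u' - v‖ ≤ ‖x' - y‖ := norm_fst_sub_le Φ x' y
  set s := Metric.closedBall v (‖x - y‖ + ‖x' - y‖)
  have hu : u ∈ s := mem_closedBall_iff_norm.2 (by linarith [norm_nonneg (x' - y)])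
  have hu' : u' ∈ s := mem_closedBall_iff_norm.2 (by linarith [norm_nonneg (x - y)])
  have hb : ∀ ξ ∈ s, ‖fderiv ℝ φ ξ - fderiv ℝ φ v‖ ≤ C * (‖x - y‖ + ‖x' - y‖) ^ α := by
    intro ξ hξ
    refine (hC ξ v).trans ?_
    have := mem_closedBall_iff_norm.1 hξ
    gcongr
  have hmv := (convex_closedBall v _).norm_image_sub_le_of_norm_fderiv_le'
    (fun ξ _ ↦ h.contDiff.differentiable one_ne_zero ξ) hb hu' hu
  rw [Real.norm_eq_abs] at hmv
  rw [abs_div, abs_of_pos (graphDensity_pos v)]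
  calc _ ≤ |φ u - φ u' - fderiv ℝ φ v (u - u')| := div_le_self (abs_nonneg _) hJ
    _ ≤ C * (‖x - y‖ + ‖x' - y‖) ^ α * ‖u - u'‖ := hmv
    _ ≤ C * (‖x - y‖ + ‖x' - y‖) ^ α * ‖x - x'‖ := by gcongr
    _ = _ := by ring

theorem restrict_image_graphMap (hφ : Continuous φ) (A : Set (EuclideanSpace ℝ (Fin d))) :
    (Measure.euclideanHausdorffMeasure d).restrict (graphMap Φ φ '' A) =
      (((Measure.euclideanHausdorffMeasure d).comap (graphMap Φ φ)).restrict A).map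
        (graphMap Φ φ) := by
  have hemb := measurableEmbedding_graphMap Φ hφ
  nth_rewrite 2 [← preimage_image_eq A hemb.injective]
  rw [← hemb.restrict_map, hemb.map_comap, Measure.restrict_restrict_of_subset
    (image_subset_range _ _)]

/-- Over a subset of the base, integration with respect to the Hausdorff measure of the graph is
integration with the density `graphDensity`. -/
theorem lintegral_graph (hφ : ContDiff ℝ 1 φ) {A : Set (EuclideanSpace ℝ (Fin d))}
    (hA : MeasurableSet A) {g : EuclideanSpace ℝ (Fin (d + 1)) → ℝ≥0∞} :
    ∫⁻ y in graphMap Φ φ '' A, g y ∂(Measure.euclideanHausdorffMeasure d) =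
      ∫⁻ v in A, ENNReal.ofReal (graphDensity φ v) * g (graphMap Φ φ v) := by
  have hemb := measurableEmbedding_graphMap Φ hφ.continuous
  have hJ := (continuous_graphDensity hφ).measurable.ennreal_ofReal
  rw [restrict_image_graphMap hφ.continuous, hemb.lintegral_map,
    comap_graphMap Φ hφ, restrict_withDensity hA,
    lintegral_withDensity_eq_lintegral_mul_non_measurable _ hJ
      (Eventually.of_forall fun v ↦ ENNReal.ofReal_lt_top)]
  rfl

theorem integral_graph (hφ : ContDiff ℝ 1 φ) {A : Set (EuclideanSpace ℝ (Fin d))}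
    (hA : MeasurableSet A) {g : EuclideanSpace ℝ (Fin (d + 1)) → ℝ} :
    ∫ y in graphMap Φ φ '' A, g y ∂(Measure.euclideanHausdorffMeasure d) =
      ∫ v in A, graphDensity φ v * g (graphMap Φ φ v) := by
  have hemb := measurableEmbedding_graphMap Φ hφ.continuous
  have hJ := (continuous_graphDensity hφ).measurable
  rw [restrict_image_graphMap hφ.continuous, hemb.integral_map,
    comap_graphMap Φ hφ, restrict_withDensity hA,
    integral_withDensity_eq_integral_toReal_smul hJ.ennreal_ofReal
      (Eventually.of_forall fun v ↦ ENNReal.ofReal_lt_top)]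
  refine integral_congr_ae (Eventually.of_forall fun v ↦ ?_)
  simp only [smul_eq_mul, ENNReal.toReal_ofReal (graphDensity_pos v).le]

theorem frontier_inter_ball_subset (h : IsGraphChart α Ω Φ φ p r) {ε : ℝ} (hε : ε ≤ r) :
    frontier Ω ∩ Metric.ball p ε ⊆ graphMap Φ φ '' Metric.ball (Φ p).fst ε := by
  rintro y ⟨hy, hyb⟩
  refine ⟨(Φ y).fst, ?_, ?_⟩
  · rw [mem_ball_iff_norm] at hyb ⊢
    exact (norm_fst_sub_le Φ y p).trans_lt hyb
  · exact (eq_graphMap Φ ((h.mem_frontier_iff (Metric.ball_subset_ball hε hyb)).1 hy)).symm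

end IsGraphChart

theorem exists_lintegral_ball_rpow_le (hd : 1 ≤ d) {β : ℝ} (hβ : 0 < β) (hβd : β ≤ d)
    (u : EuclideanSpace ℝ (Fin d)) (R : ℝ) :
    ∃ C : NNReal, ∀ w : EuclideanSpace ℝ (Fin d),
      ∫⁻ v in Metric.ball u R, ‖w - v‖ₑ ^ (β - d) ≤ C := by
  have hfin : Module.finrank ℝ (EuclideanSpace ℝ (Fin d)) = d := by simp
  have h1 : IntegrableOn (fun z : EuclideanSpace ℝ (Fin d) ↦ ‖z‖ ^ (β - d)) (Metric.ball 0 1) := by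
    refine integrableOn_ball_of_norm_le_rpow (C := 1) (α := d - β) (by rw [hfin]; exact hd)
      (by rw [hfin]; linarith) (Eventually.of_forall fun z ↦ ?_)
      (measurable_norm.pow_const _).aestronglyMeasurable
    rw [Real.norm_of_nonneg (by positivity), one_mul, neg_sub]
  have : Nontrivial (EuclideanSpace ℝ (Fin d)) :=
    Module.nontrivial_of_finrank_pos (R := ℝ) (by rw [hfin]; omega)
  have h2 : ∫⁻ z in Metric.ball (0 : EuclideanSpace ℝ (Fin d)) 1, ‖z‖ₑ ^ (β - d) < ∞ := by
    refine lt_of_eq_of_lt (lintegral_congr_ae ?_) h1.2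
    refine ae_restrict_of_ae ?_
    filter_upwards [Measure.ae_ne volume (0 : EuclideanSpace ℝ (Fin d))] with z hz
    rw [← ofReal_norm_rpow hz, ← ofReal_norm, Real.norm_of_nonneg (by positivity)]
  refine ⟨((∫⁻ z in Metric.ball (0 : EuclideanSpace ℝ (Fin d)) 1, ‖z‖ₑ ^ (β - d)) +
    volume (Metric.ball u R)).toNNReal, fun w ↦ ?_⟩
  rw [ENNReal.coe_toNNReal (ENNReal.add_lt_top.2
    ⟨h2, measure_ball_lt_top (μ := volume) (x := u) (r := R)⟩).ne]
  have e : ∫⁻ v in Metric.ball w 1, ‖w - v‖ₑ ^ (β - d) =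
      ∫⁻ z in Metric.ball (0 : EuclideanSpace ℝ (Fin d)) 1, ‖z‖ₑ ^ (β - d) := by
    rw [← lintegral_indicator Metric.isOpen_ball.measurableSet,
      ← lintegral_indicator Metric.isOpen_ball.measurableSet,
      ← lintegral_sub_left_eq_self _ w]
    congr 1; ext v
    simp only [indicator, Metric.mem_ball, dist_eq_norm, sub_zero, sub_sub_cancel,
      sub_sub_cancel_left, norm_neg]
  calc ∫⁻ v in Metric.ball u R, ‖w - v‖ₑ ^ (β - d)
      ≤ ∫⁻ v in Metric.ball w 1 ∪ Metric.ball u R \ Metric.ball w 1, ‖w - v‖ₑ ^ (β - d) := by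
        refine lintegral_mono_set ?_
        rw [union_sdiff_self]; exact subset_union_right
    _ ≤ (∫⁻ v in Metric.ball w 1, ‖w - v‖ₑ ^ (β - d)) +
        ∫⁻ v in Metric.ball u R \ Metric.ball w 1, ‖w - v‖ₑ ^ (β - d) := lintegral_union_le _ _ _
    _ ≤ _ := by
        rw [e]
        gcongr
        calc _ ≤ ∫⁻ v in Metric.ball u R \ Metric.ball w 1, 1 := by
              refine setLIntegral_mono' (Metric.isOpen_ball.measurableSet.diff
                Metric.isOpen_ball.measurableSet) fun v hv ↦ ?_
              have : 1 ≤ ‖w - v‖ := by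
                have := hv.2
                rwa [Metric.mem_ball, not_lt, dist_eq_norm, norm_sub_rev] at this
              have h1 : 1 ≤ ‖w - v‖ₑ := by
                rw [← ofReal_norm]
                exact ENNReal.one_le_ofReal.2 this
              simpa using ENNReal.rpow_le_rpow_of_exponent_le h1
                (show β - d ≤ 0 by linarith)
          _ ≤ _ := by
              rw [setLIntegral_one]
              exact measure_mono Set.sdiff_subset

end

/-! ### Size and regularity of the double layer kernel -/

section

variable {d : ℕ} {α : ℝ} {Ω : Set (EuclideanSpace ℝ (Fin (d + 1)))}

/-- Estimates that hold near each point of a compact set hold at a uniform scale. -/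
theorem exists_uniform_of_local {X : Type*} [PseudoMetricSpace X] {Γ : Set X} (hΓ : IsCompact Γ)
    {P : ℝ → Set X → Prop} (hC : ∀ C C' U, C ≤ C' → P C U → P C' U)
    (hU : ∀ C U V, U ⊆ V → P C V → P C U) (h : ∀ p ∈ Γ, ∃ ε > 0, ∃ C, P C (Metric.ball p ε)) :
    ∃ δ > 0, ∃ C, ∀ x ∈ Γ, P C (Metric.ball x δ) := by
  refine hΓ.induction_on (p := fun S ↦ ∃ δ > 0, ∃ C, ∀ x ∈ S, P C (Metric.ball x δ)) ?_ ?_ ?_ ?_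
  · exact ⟨1, one_pos, 0, by simp⟩
  · rintro s t hst ⟨δ, hδ, C, H⟩
    exact ⟨δ, hδ, C, fun x hx ↦ H x (hst hx)⟩
  · rintro s t ⟨δ, hδ, C, H⟩ ⟨δ', hδ', C', H'⟩
    refine ⟨min δ δ', lt_min hδ hδ', max C C', ?_⟩
    rintro x (hx | hx)
    · exact hC _ _ _ (le_max_left _ _)
        (hU _ _ _ (Metric.ball_subset_ball (min_le_left _ _)) (H x hx))
    · exact hC _ _ _ (le_max_right _ _)
        (hU _ _ _ (Metric.ball_subset_ball (min_le_right _ _)) (H' x hx))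
  · intro p hp
    obtain ⟨ε, hε, C, H⟩ := h p hp
    refine ⟨Metric.ball p (ε / 2),
      mem_nhdsWithin_of_mem_nhds (Metric.ball_mem_nhds p (by positivity)),
      ε / 2, by positivity, C, fun x hx ↦ hU _ _ _ ?_ H⟩
    refine Metric.ball_subset_ball' ?_
    have := Metric.mem_ball.1 hx
    linarith

section

variable (hΩ : IsOpen Ω) (hreg : HasC1HolderBoundary α Ω) (hΓ : IsCompact (frontier Ω))
include hΩ hreg

theorem norm_outwardNormal {y : EuclideanSpace ℝ (Fin (d + 1))} (hy : y ∈ frontier Ω) :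
    ‖outwardNormal Ω y‖ = 1 := by
  obtain ⟨Φ, φ, r, h⟩ := hreg.exists_chart hΩ hy
  rw [h.outwardNormal_eq (Metric.mem_ball_self h.pos) hy, norm_graphNormal]

theorem continuousOn_outwardNormal : ContinuousOn (outwardNormal Ω) (frontier Ω) := by
  intro y hy
  obtain ⟨Φ, φ, r, h⟩ := hreg.exists_chart hΩ hy
  have hc : Continuous fun x ↦ graphNormal Φ φ (Φ x).fst := by
    have h1 := continuous_graphNormal Φ h.contDiff
    have h2 := Φ.continuous
    have h3 : Continuous fun x ↦ (Φ x).fst := by fun_prop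
    exact h1.comp h3
  refine hc.continuousWithinAt.congr_of_eventuallyEq ?_
    (h.outwardNormal_eq (Metric.mem_ball_self h.pos) hy)
  filter_upwards [self_mem_nhdsWithin, mem_nhdsWithin_of_mem_nhds (Metric.ball_mem_nhds y h.pos)]
    with x hx hxb
  exact h.outwardNormal_eq hxb hx

include hΓ

/-- The normal component of a chord of a `C^{1,α}` surface is small of higher order. -/
theorem exists_abs_inner_outwardNormal_le (hα : 0 < α) :
    ∃ C, 0 ≤ C ∧ ∀ x ∈ frontier Ω, ∀ x' ∈ frontier Ω, ∀ y ∈ frontier Ω,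
      |⟪x - x', outwardNormal Ω y⟫_ℝ| ≤ C * (‖x - x'‖ * (‖x - y‖ + ‖x' - y‖) ^ α) := by
  obtain ⟨δ, hδ, C, hC⟩ := exists_uniform_of_local hΓ
    (P := fun C U ↦ ∀ x ∈ frontier Ω ∩ U, ∀ x' ∈ frontier Ω ∩ U, ∀ y ∈ frontier Ω ∩ U,
      |⟪x - x', outwardNormal Ω y⟫_ℝ| ≤ C * (‖x - x'‖ * (‖x - y‖ + ‖x' - y‖) ^ α))
    (fun C C' U hCC h x hx x' hx' y hy ↦ (h x hx x' hx' y hy).trans (by gcongr))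
    (fun C U V hUV h x hx x' hx' y hy ↦ h x ⟨hx.1, hUV hx.2⟩ x' ⟨hx'.1, hUV hx'.2⟩ y
      ⟨hy.1, hUV hy.2⟩)
    (fun p hp ↦ by
      obtain ⟨Φ, φ, r, h⟩ := hreg.exists_chart hΩ hp
      exact ⟨r, h.pos, h.exists_abs_inner_le hα⟩)
  refine ⟨max |C| (δ ^ α)⁻¹, by positivity, fun x hx x' hx' y hy ↦ ?_⟩
  have hn1 := norm_nonneg (x - y)
  have hn2 := norm_nonneg (x' - y)
  by_cases hclose : ‖x - y‖ < δ ∧ ‖x' - y‖ < δ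
  · refine (hC y hy x ⟨hx, mem_ball_iff_norm.2 hclose.1⟩ x' ⟨hx', mem_ball_iff_norm.2 hclose.2⟩ y
      ⟨hy, Metric.mem_ball_self hδ⟩).trans ?_
    gcongr
    exact (le_abs_self C).trans (le_max_left _ _)
  · have hfar : δ ≤ ‖x - y‖ + ‖x' - y‖ := by
      by_contra! hlt
      exact hclose ⟨by linarith, by linarith⟩
    have h1 : 1 ≤ (δ ^ α)⁻¹ * (‖x - y‖ + ‖x' - y‖) ^ α := by
      rw [inv_mul_eq_div, one_le_div (by positivity)]
      gcongr
    calc |⟪x - x', outwardNormal Ω y⟫_ℝ| ≤ ‖x - x'‖ * ‖outwardNormal Ω y‖ :=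
          abs_real_inner_le_norm _ _
      _ = ‖x - x'‖ * 1 := by rw [norm_outwardNormal hΩ hreg hy]
      _ ≤ ‖x - x'‖ * ((δ ^ α)⁻¹ * (‖x - y‖ + ‖x' - y‖) ^ α) := by gcongr
      _ = (δ ^ α)⁻¹ * (‖x - x'‖ * (‖x - y‖ + ‖x' - y‖) ^ α) := by ring
      _ ≤ _ := by gcongr; exact le_max_right _ _

theorem exists_abs_kernelK_le (hα : 0 < α) :
    ∃ C, ∀ x ∈ frontier Ω, ∀ y ∈ frontier Ω, x ≠ y →
      |kernelK Ω x y| ≤ C * ‖x - y‖ ^ (α - d) := by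
  obtain ⟨C, hC0, hC⟩ := exists_abs_inner_outwardNormal_le hΩ hreg hΓ hα
  refine ⟨|1 / sphereArea d| * C, fun x hx y hy hxy ↦ ?_⟩
  have hn : 0 < ‖x - y‖ := norm_pos_iff.2 (sub_ne_zero.2 hxy)
  have h := hC x hx y hy y hy
  rw [sub_self, norm_zero, add_zero] at h
  have e : ‖x - y‖ ^ (α - d) = ‖x - y‖ * ‖x - y‖ ^ α / ‖x - y‖ ^ (d + 1) := by
    rw [Real.rpow_sub hn, Real.rpow_natCast, pow_succ]
    field_simp
  rw [kernelK, abs_mul, abs_neg, abs_div ⟪x - y, outwardNormal Ω y⟫_ℝ,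
    abs_of_pos (pow_pos hn (d + 1)), mul_assoc, e]
  gcongr
  rw [← mul_div_assoc]
  gcongr

/-- The kernel is Lipschitz in the first variable. The chord from `x` to `x'` has a normal component
at `y` that is small of order `|x - y|^α`; without this, one would only have the exponent
`-1 - d`. -/
theorem exists_abs_kernelK_sub_le (hα : 0 < α) (hα1 : α ≤ 1) :
    ∃ C, ∀ x ∈ frontier Ω, ∀ x' ∈ frontier Ω, ∀ y ∈ frontier Ω, x ≠ x' → x ≠ y →
      2 * ‖x - x'‖ ≤ ‖x - y‖ →
      |kernelK Ω x y - kernelK Ω x' y| ≤ C * (‖x - x'‖ * ‖x - y‖ ^ (α - 1 - d)) := by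
  obtain ⟨C, hC0, hC⟩ := exists_abs_inner_outwardNormal_le hΩ hreg hΓ hα
  obtain ⟨m, hm⟩ : ∃ m, m = d + 1 := ⟨_, rfl⟩
  have hker : ∀ x y, kernelK Ω x y =
      -(1 / sphereArea d) * (⟪x - y, outwardNormal Ω y⟫_ℝ / ‖x - y‖ ^ m) := by
    rw [hm]; exact fun _ _ ↦ rfl
  refine ⟨|1 / sphereArea d| * (3 * C + C * m * 2 ^ (m - 1) * 4 * 2 ^ m),
    fun x hx x' hx' y hy _ hxy hle ↦ ?_⟩
  set a := ‖x - y‖ with ha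
  set b := ‖x' - y‖ with hb
  set r := ‖x - x'‖ with hr
  have ha0 : 0 < a := norm_pos_iff.2 (sub_ne_zero.2 hxy)
  have hr0 : 0 ≤ r := norm_nonneg _
  have hab : |a - b| ≤ r := by
    have := abs_norm_sub_norm_le (x - y) (x' - y)
    rwa [sub_sub_sub_cancel_right] at this
  obtain ⟨hab1, hab2⟩ := abs_le.1 hab
  have hb1 : a / 2 ≤ b := by linarith
  have hb2 : b ≤ 2 * a := by linarith
  have hb0 : 0 < b := by linarith
  set N := ⟪x - y, outwardNormal Ω y⟫_ℝ with hN
  set N' := ⟪x' - y, outwardNormal Ω y⟫_ℝ with hN'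
  have hNN : |N - N'| ≤ C * (r * (a + b) ^ α) := by
    have := hC x hx x' hx' y hy
    rwa [← sub_sub_sub_cancel_right x x' y, inner_sub_left, sub_sub_sub_cancel_right] at this
  have hN'b : |N'| ≤ C * (b * b ^ α) := by
    have := hC x' hx' y hy y hy
    rwa [sub_self, norm_zero, add_zero] at this
  have hpow3 : (a + b) ^ α ≤ 3 * a ^ α := by
    calc (a + b) ^ α ≤ (3 * a) ^ α := by gcongr; linarith
      _ = 3 ^ α * a ^ α := Real.mul_rpow (by norm_num) ha0.le
      _ ≤ 3 ^ (1 : ℝ) * a ^ α := by gcongr; norm_num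
      _ = _ := by simp
  have hpow2 : b ^ α ≤ 2 * a ^ α := by
    calc b ^ α ≤ (2 * a) ^ α := by gcongr
      _ = 2 ^ α * a ^ α := Real.mul_rpow (by norm_num) ha0.le
      _ ≤ 2 ^ (1 : ℝ) * a ^ α := by gcongr; norm_num
      _ = _ := by simp
  have hinv : |(a ^ m)⁻¹ - (b ^ m)⁻¹| ≤ r * m * (2 * a) ^ (m - 1) / (a ^ m * b ^ m) := by
    rw [inv_sub_inv (by positivity) (by positivity), abs_div, abs_of_pos (by positivity :
      0 < a ^ m * b ^ m)]
    gcongr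
    refine (abs_pow_sub_pow_le b a m).trans ?_
    rw [abs_sub_comm b a]
    gcongr
    rw [abs_of_pos ha0, abs_of_pos hb0]
    exact max_le hb2 (by linarith)
  have hbm : (b ^ m)⁻¹ ≤ 2 ^ m * (a ^ m)⁻¹ := by
    calc (b ^ m)⁻¹ ≤ ((a / 2) ^ m)⁻¹ := by gcongr
      _ = _ := by rw [div_pow, inv_div, div_eq_mul_inv]
  have ea : (2 * a) ^ (m - 1) = 2 ^ (m - 1) * a ^ (m - 1) := mul_pow _ _ _
  have ea2 : a ^ m = a ^ (m - 1) * a := by rw [← pow_succ, hm, Nat.add_sub_cancel]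
  have e : a ^ (α - 1 - d) = a ^ α * (a ^ m)⁻¹ := by
    rw [sub_sub, Real.rpow_sub ha0, div_eq_mul_inv]
    congr 2
    rw [hm, ← Real.rpow_natCast]; push_cast; ring_nf
  have hmain : |N / a ^ m - N' / b ^ m| ≤
      (3 * C + C * m * 2 ^ (m - 1) * 4 * 2 ^ m) * (r * a ^ (α - 1 - d)) := by
    have split : N / a ^ m - N' / b ^ m =
        (N - N') * (a ^ m)⁻¹ + N' * ((a ^ m)⁻¹ - (b ^ m)⁻¹) := by
      rw [div_eq_mul_inv, div_eq_mul_inv]; ring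
    have t1 : |N - N'| * (a ^ m)⁻¹ ≤ 3 * C * (r * a ^ (α - 1 - d)) := by
      rw [e]
      calc |N - N'| * (a ^ m)⁻¹ ≤ C * (r * (3 * a ^ α)) * (a ^ m)⁻¹ := by
            gcongr
            exact hNN.trans (by gcongr)
        _ = _ := by ring
    have t2 : |N'| * |(a ^ m)⁻¹ - (b ^ m)⁻¹| ≤
        C * m * 2 ^ (m - 1) * 4 * 2 ^ m * (r * a ^ (α - 1 - d)) := by
      rw [e]
      calc |N'| * |(a ^ m)⁻¹ - (b ^ m)⁻¹|
          ≤ (C * ((2 * a) * (2 * a ^ α))) * (r * m * (2 * a) ^ (m - 1) / (a ^ m * b ^ m)) := by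
            gcongr
            exact hN'b.trans (by gcongr)
        _ = C * ((2 * a) * (2 * a ^ α)) * (r * m * (2 ^ (m - 1) * a ^ (m - 1)) * (a ^ m)⁻¹) *
            (b ^ m)⁻¹ := by
            rw [ea, div_eq_mul_inv, mul_inv]; ring
        _ ≤ C * ((2 * a) * (2 * a ^ α)) * (r * m * (2 ^ (m - 1) * a ^ (m - 1)) * (a ^ m)⁻¹) *
            (2 ^ m * (a ^ m)⁻¹) := by gcongr
        _ = C * m * 2 ^ (m - 1) * 4 * 2 ^ m * (r * (a ^ α * (a ^ m)⁻¹)) *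
            ((a ^ (m - 1) * a) * (a ^ m)⁻¹) := by ring
        _ = _ := by rw [← ea2, mul_inv_cancel₀ (by positivity), mul_one]
    rw [split]
    refine (abs_add_le _ _).trans ?_
    rw [abs_mul, abs_mul, abs_of_pos (by positivity : 0 < (a ^ m)⁻¹), add_mul]
    exact add_le_add t1 t2
  rw [hker, hker, ← mul_sub, abs_mul, abs_neg, mul_assoc]
  gcongr

omit hΓ in
theorem exists_lintegral_chart_le (hd : 1 ≤ d) {β : ℝ} (hβ : 0 < β) (hβd : β ≤ d)
    {p : EuclideanSpace ℝ (Fin (d + 1))} (hp : p ∈ frontier Ω) :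
    ∃ r > 0, ∃ C : NNReal, ∀ x, ∫⁻ y in frontier Ω ∩ Metric.ball p r, ‖x - y‖ₑ ^ (β - d)
      ∂(Measure.euclideanHausdorffMeasure d) ≤ C := by
  obtain ⟨Φ, φ, r, h⟩ := hreg.exists_chart hΩ hp
  obtain ⟨C, hC⟩ := exists_lintegral_ball_rpow_le hd hβ hβd (Φ p).fst r
  obtain ⟨J, hJ⟩ := (isCompact_closedBall (Φ p).fst r).exists_bound_of_continuousOn
    (continuous_graphDensity h.contDiff).continuousOn
  refine ⟨r, h.pos, J.toNNReal * C, fun x ↦ ?_⟩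
  calc _ ≤ ∫⁻ y in graphMap Φ φ '' Metric.ball (Φ p).fst r, ‖x - y‖ₑ ^ (β - d)
        ∂(Measure.euclideanHausdorffMeasure d) :=
        lintegral_mono_set (h.frontier_inter_ball_subset le_rfl)
    _ = ∫⁻ v in Metric.ball (Φ p).fst r,
        ENNReal.ofReal (graphDensity φ v) * ‖x - graphMap Φ φ v‖ₑ ^ (β - d) :=
        IsGraphChart.lintegral_graph h.contDiff Metric.isOpen_ball.measurableSet
    _ ≤ ∫⁻ v in Metric.ball (Φ p).fst r, J.toNNReal * ‖(Φ x).fst - v‖ₑ ^ (β - d) := by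
        refine setLIntegral_mono' Metric.isOpen_ball.measurableSet fun v hv ↦ ?_
        refine mul_le_mul' ?_ ?_
        · exact ENNReal.ofReal_le_ofReal ((le_abs_self _).trans
            (hJ v (Metric.ball_subset_closedBall hv)))
        · rw [← neg_sub (d : ℝ) β, ENNReal.rpow_neg, ENNReal.rpow_neg, ENNReal.inv_le_inv]
          refine ENNReal.rpow_le_rpow ?_ (by linarith)
          rw [← ofReal_norm, ← ofReal_norm]
          refine ENNReal.ofReal_le_ofReal ?_
          have := norm_fst_sub_le Φ x (graphMap Φ φ v)
          rwa [apply_graphMap] at this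
    _ = J.toNNReal * ∫⁻ v in Metric.ball (Φ p).fst r, ‖(Φ x).fst - v‖ₑ ^ (β - d) :=
        lintegral_const_mul' _ _ (by simp)
    _ ≤ J.toNNReal * C := by gcongr; exact hC _
    _ = _ := by push_cast; rfl

theorem exists_lintegral_riesz_le_of_le (hd : 1 ≤ d) {β : ℝ} (hβ : 0 < β) (hβd : β ≤ d) :
    ∃ C : NNReal, ∀ x, ∫⁻ y, ‖x - y‖ₑ ^ (β - d) ∂(surfaceMeasure Ω) ≤ C := by
  have := hΓ.induction_on (p := fun S ↦ ∃ C : NNReal, ∀ x, ∫⁻ y in frontier Ω ∩ S,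
    ‖x - y‖ₑ ^ (β - d) ∂(Measure.euclideanHausdorffMeasure d) ≤ C) ⟨0, by simp⟩
    (fun s t hst ⟨C, hC⟩ ↦ ⟨C, fun x ↦
      (lintegral_mono_set (inter_subset_inter_right _ hst)).trans (hC x)⟩)
    (fun s t ⟨C, hC⟩ ⟨C', hC'⟩ ↦ ⟨C + C', fun x ↦ by
      rw [inter_union_distrib_left]
      exact (lintegral_union_le _ _ _).trans (by push_cast; exact add_le_add (hC x) (hC' x))⟩)
    (fun p hp ↦ by
      obtain ⟨r, hr, h⟩ := exists_lintegral_chart_le hΩ hreg hd hβ hβd hp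
      exact ⟨Metric.ball p r, mem_nhdsWithin_of_mem_nhds (Metric.ball_mem_nhds p hr), h⟩)
  simp only [inter_self] at this
  exact this

theorem isFiniteMeasure_surfaceMeasure (hd : 1 ≤ d) : IsFiniteMeasure (surfaceMeasure Ω) := by
  obtain ⟨C, hC⟩ := exists_lintegral_riesz_le_of_le hΩ hreg hΓ hd (β := d) (by positivity) le_rfl
  refine ⟨lt_of_le_of_lt ?_ (ENNReal.coe_lt_top (r := C))⟩
  simpa using hC 0

omit hΩ hreg in
theorem exists_norm_sub_le : ∃ R > 0, ∀ x ∈ frontier Ω, ∀ y ∈ frontier Ω, ‖x - y‖ ≤ R := by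
  obtain ⟨R, hR⟩ := Metric.isBounded_iff.1 hΓ.isBounded
  refine ⟨max R 1, by positivity, fun x hx y hy ↦ ?_⟩
  rw [← dist_eq_norm]
  exact (hR hx hy).trans (le_max_left _ _)

omit hΩ hreg in
theorem ae_mem_frontier : ∀ᵐ x ∂(surfaceMeasure Ω), x ∈ frontier Ω :=
  ae_restrict_mem hΓ.measurableSet

theorem exists_lintegral_riesz_le (hd : 1 ≤ d) {β : ℝ} (hβ : 0 < β) :
    ∃ C : NNReal, ∀ x ∈ frontier Ω, ∫⁻ y, ‖x - y‖ₑ ^ (β - d) ∂(surfaceMeasure Ω) ≤ C := by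
  rcases le_total β d with h | h
  · obtain ⟨C, hC⟩ := exists_lintegral_riesz_le_of_le hΩ hreg hΓ hd hβ h
    exact ⟨C, fun x _ ↦ hC x⟩
  · have := isFiniteMeasure_surfaceMeasure hΩ hreg hΓ hd
    obtain ⟨R, -, hR⟩ := exists_norm_sub_le hΓ
    refine ⟨(ENNReal.ofReal R ^ (β - d) * surfaceMeasure Ω univ).toNNReal, fun x hx ↦ ?_⟩
    rw [ENNReal.coe_toNNReal (by
      have : ENNReal.ofReal R ^ (β - d) ≠ ∞ :=
        ENNReal.rpow_ne_top_of_nonneg (by linarith) ENNReal.ofReal_ne_top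
      finiteness), ← lintegral_const]
    refine lintegral_mono_ae ?_
    filter_upwards [ae_mem_frontier hΓ] with y hy
    refine ENNReal.rpow_le_rpow ?_ (by linarith)
    rw [← ofReal_norm]
    exact ENNReal.ofReal_le_ofReal (hR x hx y hy)

theorem aestronglyMeasurable_kernelK [SFinite (surfaceMeasure Ω)] :
    AEStronglyMeasurable (Function.uncurry (kernelK Ω))
      ((surfaceMeasure Ω).prod (surfaceMeasure Ω)) := by
  have h1 : AEStronglyMeasurable (outwardNormal Ω) (surfaceMeasure Ω) :=
    (continuousOn_outwardNormal hΩ hreg).aestronglyMeasurable hΓ.measurableSet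
  have h2 : AEStronglyMeasurable (fun z : EuclideanSpace ℝ (Fin (d + 1)) ×
      EuclideanSpace ℝ (Fin (d + 1)) ↦ outwardNormal Ω z.2)
      ((surfaceMeasure Ω).prod (surfaceMeasure Ω)) := h1.comp_snd
  have h3 : AEStronglyMeasurable (fun z : EuclideanSpace ℝ (Fin (d + 1)) ×
      EuclideanSpace ℝ (Fin (d + 1)) ↦ z.1 - z.2)
      ((surfaceMeasure Ω).prod (surfaceMeasure Ω)) := by fun_prop
  have h4 := (h3.inner (𝕜 := ℝ) h2).aemeasurable.div
    ((h3.norm.aemeasurable).pow_const (d + 1))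
  exact (h4.const_mul (-(1 / sphereArea d))).aestronglyMeasurable

end

end

/-! ### Integration along dilations -/

section dilation

variable {d : ℕ}

theorem integrable_of_norm_le_rpow (hd : 1 ≤ d) {α C R : ℝ} (hα : 0 < α)
    {f : EuclideanSpace ℝ (Fin d) → ℝ} (hf : AEStronglyMeasurable f volume)
    (hC : ∀ z, z ≠ 0 → |f z| ≤ C * ‖z‖ ^ (α - d)) (hR : ∀ z, R ≤ ‖z‖ → f z = 0) :
    Integrable f := by
  have hfin : Module.finrank ℝ (EuclideanSpace ℝ (Fin d)) = d := by simp
  have : Nontrivial (EuclideanSpace ℝ (Fin d)) :=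
    Module.nontrivial_of_finrank_pos (R := ℝ) (by rw [hfin]; omega)
  have h1 : IntegrableOn f (Metric.ball 0 R) := by
    refine integrableOn_ball_of_norm_le_rpow (C := C) (α := d - α) (by rw [hfin]; exact hd)
      (by rw [hfin]; linarith) ?_ hf
    refine ae_restrict_of_ae ?_
    filter_upwards [Measure.ae_ne volume (0 : EuclideanSpace ℝ (Fin d))] with z hz
    rw [Real.norm_eq_abs, neg_sub]
    exact hC z hz
  refine (integrableOn_iff_integrable_of_support_subset fun z hz ↦ ?_).1 h1
  rw [mem_ball_zero_iff]
  by_contra! hle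
  exact hz (hR z hle)

/-- If `Q` is a function on `ℝ^d` with bounded support whose even part vanishes at the origin, and
`W` is its radial derivative `z ↦ DQ(z) z`, then `∫ W(z) |z|^{-d} dz = 0`. Indeed
`∫ (Q(λ z) + Q(-λ z)) |z|^{-d} dz` does not depend on `λ > 0`, the measure `|z|^{-d} dz` being
invariant under dilations. -/
theorem integral_radial_deriv_eq_zero (hd : 1 ≤ d) {α C R : ℝ} (hα : 0 < α) (hα1 : α ≤ 1)
    {Q W : EuclideanSpace ℝ (Fin d) → ℝ} (hQm : Measurable Q) (hWm : Measurable W)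
    (hderiv : ∀ z, z ≠ 0 → HasDerivAt (fun t : ℝ ↦ Q (t • z)) (W z) 1)
    (hQ : ∀ z, z ≠ 0 → |Q z + Q (-z)| ≤ C * ‖z‖ ^ α) (hW : ∀ z, z ≠ 0 → |W z| ≤ C * ‖z‖ ^ α)
    (hQR : ∀ z, R ≤ ‖z‖ → Q z = 0) (hWR : ∀ z, R ≤ ‖z‖ → W z = 0) :
    ∫ z, (‖z‖ ^ d)⁻¹ * W z = 0 := by
  have hfin : Module.finrank ℝ (EuclideanSpace ℝ (Fin d)) = d := by simp
  have : Nontrivial (EuclideanSpace ℝ (Fin d)) :=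
    Module.nontrivial_of_finrank_pos (R := ℝ) (by rw [hfin]; omega)
  have hrpow : ∀ z : EuclideanSpace ℝ (Fin d), z ≠ 0 →
      ‖z‖ ^ (α - d) = (‖z‖ ^ d)⁻¹ * ‖z‖ ^ α := fun z hz ↦ by
    rw [Real.rpow_sub (norm_pos_iff.2 hz), Real.rpow_natCast]; ring
  have hwm : Measurable fun z : EuclideanSpace ℝ (Fin d) ↦ (‖z‖ ^ d)⁻¹ := by fun_prop
  set S : EuclideanSpace ℝ (Fin d) → ℝ := fun z ↦ Q z + Q (-z) with hS
  set V : EuclideanSpace ℝ (Fin d) → ℝ := fun z ↦ W z + W (-z) with hV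
  have hSm : Measurable S := hQm.add (hQm.comp measurable_neg)
  have hVm : Measurable V := hWm.add (hWm.comp measurable_neg)
  have hVb : ∀ z, z ≠ 0 → |V z| ≤ 2 * C * ‖z‖ ^ α := fun z hz ↦ by
    have h1 := hW z hz
    have h2 := hW (-z) (neg_ne_zero.2 hz)
    rw [norm_neg] at h2
    calc |V z| ≤ |W z| + |W (-z)| := abs_add_le _ _
      _ ≤ _ := by linarith
  have hVR : ∀ z, R ≤ ‖z‖ → V z = 0 := fun z hz ↦ by
    simp [hV, hWR z hz, hWR (-z) (by rwa [norm_neg])]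
  have hSR : ∀ z, R ≤ ‖z‖ → S z = 0 := fun z hz ↦ by
    simp [hS, hQR z hz, hQR (-z) (by rwa [norm_neg])]
  have hint : ∀ {g : EuclideanSpace ℝ (Fin d) → ℝ} {B : ℝ}, Measurable g →
      (∀ z, z ≠ 0 → |g z| ≤ B * ‖z‖ ^ α) → (∀ z, R ≤ ‖z‖ → g z = 0) →
      Integrable fun z ↦ (‖z‖ ^ d)⁻¹ * g z := by
    intro g B hg hB hgR
    refine integrable_of_norm_le_rpow hd hα (C := B) (R := R) (hwm.mul hg).aestronglyMeasurable
      (fun z hz ↦ ?_) (fun z hz ↦ by rw [hgR z hz, mul_zero])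
    rw [abs_mul, abs_of_nonneg (by positivity), hrpow z hz]
    calc _ ≤ (‖z‖ ^ d)⁻¹ * (B * ‖z‖ ^ α) := by gcongr; exact hB z hz
      _ = _ := by ring
  have hSi : Integrable fun z ↦ (‖z‖ ^ d)⁻¹ * S z := hint hSm hQ hSR
  have hWi : Integrable fun z ↦ (‖z‖ ^ d)⁻¹ * W z := hint hWm hW hWR
  -- the integral of the dilated function is constant
  have hconst : ∀ t : ℝ, 0 < t →
      ∫ z, (‖z‖ ^ d)⁻¹ * S (t • z) = ∫ z, (‖z‖ ^ d)⁻¹ * S z := by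
    intro t ht
    have e : ∀ z : EuclideanSpace ℝ (Fin d), (‖z‖ ^ d)⁻¹ * S (t • z) =
        t ^ d * ((fun z ↦ (‖z‖ ^ d)⁻¹ * S z) (t • z)) := fun z ↦ by
      simp only [norm_smul, Real.norm_of_nonneg ht.le, mul_pow, mul_inv]
      have : t ^ d * (t ^ d)⁻¹ = 1 := mul_inv_cancel₀ (by positivity)
      linear_combination -((‖z‖ ^ d)⁻¹ * S (t • z)) * this
    have h := Measure.integral_comp_smul volume
      (fun z : EuclideanSpace ℝ (Fin d) ↦ (‖z‖ ^ d)⁻¹ * S z) t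
    simp_rw [e]
    rw [integral_const_mul, h, hfin, abs_of_nonneg (by positivity),
      smul_eq_mul, ← mul_assoc, mul_inv_cancel₀ (by positivity), one_mul]
  -- its derivative can be computed under the integral sign
  have hVd : ∀ z, z ≠ 0 → ∀ t : ℝ, 0 < t →
      HasDerivAt (fun t : ℝ ↦ S (t • z)) (t⁻¹ * V (t • z)) t := by
    intro z hz t ht
    have aux : ∀ z, z ≠ 0 → HasDerivAt (fun s : ℝ ↦ Q (s • z)) (t⁻¹ * W (t • z)) t := by
      intro z hz
      have h1 := hderiv (t • z) (smul_ne_zero ht.ne' hz)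
      have h2 : HasDerivAt (fun s : ℝ ↦ t⁻¹ * s) t⁻¹ t := by
        simpa using (hasDerivAt_id t).const_mul t⁻¹
      have h3 : HasDerivAt (fun s : ℝ ↦ Q (s • t • z)) (W (t • z)) (t⁻¹ * t) := by
        rwa [inv_mul_cancel₀ ht.ne']
      have h4 := h3.comp t h2
      have e : ((fun s : ℝ ↦ Q (s • t • z)) ∘ fun s : ℝ ↦ t⁻¹ * s) = fun s : ℝ ↦ Q (s • z) := by
        ext s
        simp only [Function.comp, smul_smul]
        congr 2
        field_simp
      rw [e, mul_comm] at h4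
      exact h4
    have h1 := aux z hz
    have h2 := aux (-z) (neg_ne_zero.2 hz)
    simp only [smul_neg] at h2
    have h3 := h1.add h2
    rw [← mul_add] at h3
    exact h3
  have hderivI : HasDerivAt (fun t : ℝ ↦ ∫ z, (‖z‖ ^ d)⁻¹ * S (t • z))
      (∫ z, (‖z‖ ^ d)⁻¹ * ((1 : ℝ)⁻¹ * V ((1 : ℝ) • z))) 1 := by
    have hC0 : 0 ≤ C := by
      obtain ⟨z, hz⟩ := exists_ne (0 : EuclideanSpace ℝ (Fin d))
      have := (abs_nonneg _).trans (hW z hz)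
      exact nonneg_of_mul_nonneg_left this (Real.rpow_pos_of_pos (norm_pos_iff.2 hz) _)
    set bound : EuclideanSpace ℝ (Fin d) → ℝ :=
      (Metric.ball 0 (2 * R)).indicator fun z ↦ 8 * C * ‖z‖ ^ (α - d) with hbound
    have hbi : Integrable bound := by
      refine integrable_of_norm_le_rpow hd hα (C := 8 * C) (R := 2 * R) ?_ (fun z hz ↦ ?_)
        (fun z hz ↦ ?_)
      · exact ((measurable_norm.pow_const _).const_mul _).indicator
          Metric.isOpen_ball.measurableSet |>.aestronglyMeasurable
      · rw [hbound, ← Real.norm_eq_abs]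
        refine (norm_indicator_le_norm_self _ _).trans (le_of_eq ?_)
        exact Real.norm_of_nonneg (by positivity)
      · rw [hbound, indicator_of_notMem]
        rw [mem_ball_zero_iff, not_lt]; exact hz
    have hs : Metric.ball (1 : ℝ) (1 / 2) ∈ 𝓝 (1 : ℝ) := Metric.ball_mem_nhds _ (by norm_num)
    have htpos : ∀ t ∈ Metric.ball (1 : ℝ) (1 / 2), 1 / 2 < t ∧ t < 3 / 2 := by
      intro t ht
      rw [Metric.mem_ball, Real.dist_eq, abs_lt] at ht
      constructor <;> linarith
    refine (hasDerivAt_integral_of_dominated_loc_of_deriv_le (μ := volume)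
      (F := fun (t : ℝ) z ↦ (‖z‖ ^ d)⁻¹ * S (t • z))
      (F' := fun (t : ℝ) z ↦ (‖z‖ ^ d)⁻¹ * (t⁻¹ * V (t • z))) (bound := bound) hs
      ?_ ?_ ?_ ?_ hbi ?_).2
    · exact Eventually.of_forall fun t ↦
        (hwm.mul (hSm.comp (measurable_const_smul t))).aestronglyMeasurable
    · simpa using hSi
    · exact (hwm.mul ((hVm.comp (measurable_const_smul (1 : ℝ))).const_mul _)).aestronglyMeasurable
    · filter_upwards [Measure.ae_ne volume (0 : EuclideanSpace ℝ (Fin d))] with z hz t ht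
      obtain ⟨t1, t2⟩ := htpos t ht
      have t0 : 0 < t := by linarith
      have hz0 : 0 < ‖z‖ := norm_pos_iff.2 hz
      by_cases hzR : ‖z‖ < 2 * R
      · rw [hbound, indicator_of_mem (mem_ball_zero_iff.2 hzR), hrpow z hz, Real.norm_eq_abs,
          abs_mul, abs_of_nonneg (by positivity : 0 ≤ (‖z‖ ^ d)⁻¹), abs_mul,
          abs_of_pos (inv_pos.2 t0)]
        have b1 : t⁻¹ ≤ 2 := by
          rw [inv_le_comm₀ t0 (by norm_num)]; linarith
        have b2 : |V (t • z)| ≤ 2 * C * (2 * ‖z‖ ^ α) := by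
          refine (hVb _ (smul_ne_zero t0.ne' hz)).trans ?_
          rw [norm_smul, Real.norm_of_nonneg t0.le, Real.mul_rpow t0.le hz0.le]
          gcongr
          calc t ^ α ≤ 2 ^ α := by gcongr; linarith
            _ ≤ 2 ^ (1 : ℝ) := by gcongr; norm_num
            _ = 2 := by simp
        calc (‖z‖ ^ d)⁻¹ * (t⁻¹ * |V (t • z)|)
            ≤ (‖z‖ ^ d)⁻¹ * (2 * (2 * C * (2 * ‖z‖ ^ α))) := by gcongr
          _ = _ := by ring
      · have : V (t • z) = 0 := by
          refine hVR _ ?_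
          rw [norm_smul, Real.norm_of_nonneg t0.le]
          nlinarith [norm_nonneg z]
        rw [this, hbound, indicator_of_notMem (by rwa [mem_ball_zero_iff])]
        simp
    · filter_upwards [Measure.ae_ne volume (0 : EuclideanSpace ℝ (Fin d))] with z hz t ht
      exact (hVd z hz t (by linarith [(htpos t ht).1])).const_mul _
  have hzero : ∫ z, (‖z‖ ^ d)⁻¹ * V z = 0 := by
    have h0 : HasDerivAt (fun t : ℝ ↦ ∫ z, (‖z‖ ^ d)⁻¹ * S (t • z)) 0 1 := by
      refine (hasDerivAt_const (1 : ℝ) (∫ z, (‖z‖ ^ d)⁻¹ * S z)).congr_of_eventuallyEq ?_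
      filter_upwards [Ioi_mem_nhds (zero_lt_one' ℝ)] with t ht using hconst t ht
    have := hderivI.unique h0
    simpa using this
  have hsymm : ∫ z, (‖z‖ ^ d)⁻¹ * W (-z) = ∫ z, (‖z‖ ^ d)⁻¹ * W z := by
    rw [← integral_neg_eq_self]
    simp
  have hWi' : Integrable fun z ↦ (‖z‖ ^ d)⁻¹ * W (-z) := by
    simpa using hWi.comp_neg
  have : ∫ z, (‖z‖ ^ d)⁻¹ * V z = 2 * ∫ z, (‖z‖ ^ d)⁻¹ * W z := by
    simp_rw [hV, mul_add]
    rw [integral_add hWi hWi', hsymm, two_mul]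
  linarith

end dilation

section slope

/-- The primitive of `(1 + τ²)^{-(d+1)/2}`: up to the sign, the solid angle of a cone of slope `h`
per unit of angular variable on the equator. -/
def slopeFun (d : ℕ) (h : ℝ) : ℝ := ∫ τ in (0 : ℝ)..h, (Real.sqrt (1 + τ ^ 2) ^ (d + 1))⁻¹

variable (d : ℕ)

theorem continuous_slope_integrand :
    Continuous fun τ : ℝ ↦ (Real.sqrt (1 + τ ^ 2) ^ (d + 1))⁻¹ := by
  refine Continuous.inv₀ (by fun_prop) fun τ ↦ ?_
  have : 0 < Real.sqrt (1 + τ ^ 2) := Real.sqrt_pos.2 (by positivity)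
  positivity

theorem hasDerivAt_slopeFun (h : ℝ) :
    HasDerivAt (slopeFun d) (Real.sqrt (1 + h ^ 2) ^ (d + 1))⁻¹ h :=
  (continuous_slope_integrand d).integral_hasStrictDerivAt 0 h |>.hasDerivAt

theorem slopeFun_neg (h : ℝ) : slopeFun d (-h) = -slopeFun d h := by
  unfold slopeFun
  have := intervalIntegral.integral_comp_neg (a := 0) (b := h)
    (fun τ : ℝ ↦ (Real.sqrt (1 + τ ^ 2) ^ (d + 1))⁻¹)
  simp only [neg_sq, neg_zero] at this
  rw [this, intervalIntegral.integral_symm]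

theorem abs_slopeFun_sub_le (a b : ℝ) : |slopeFun d a - slopeFun d b| ≤ |a - b| := by
  have h := (convex_univ : Convex ℝ (univ : Set ℝ)).norm_image_sub_le_of_norm_hasDerivWithin_le
    (f := slopeFun d) (f' := fun h ↦ (Real.sqrt (1 + h ^ 2) ^ (d + 1))⁻¹) (C := 1) (x := b) (y := a)
    (fun x _ ↦ (hasDerivAt_slopeFun d x).hasDerivWithinAt) (fun x _ ↦ ?_) (mem_univ _) (mem_univ _)
  · simpa using h
  · have h1 : 1 ≤ Real.sqrt (1 + x ^ 2) := by
      rw [Real.one_le_sqrt]; nlinarith [sq_nonneg x]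
    rw [Real.norm_of_nonneg (by positivity)]
    exact inv_le_one_of_one_le₀ (one_le_pow₀ h1)

theorem abs_slopeFun_le (a : ℝ) : |slopeFun d a| ≤ |a| := by
  have := abs_slopeFun_sub_le d a 0
  simpa [slopeFun] using this

theorem continuous_slopeFun : Continuous (slopeFun d) :=
  continuous_iff_continuousAt.2 fun h ↦ (hasDerivAt_slopeFun d h).continuousAt

end slope

/-! ### The double layer kernel of a graph -/

section

variable {d : ℕ} {φ η : EuclideanSpace ℝ (Fin d) → ℝ}

theorem abs_sub_fderiv_le {α C : ℝ} (hα : 0 < α) (hC : 0 ≤ C) (hφ : ContDiff ℝ 1 φ)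
    (hH : ∀ u v, ‖fderiv ℝ φ u - fderiv ℝ φ v‖ ≤ C * ‖u - v‖ ^ α) (u v : EuclideanSpace ℝ (Fin d)) :
    |φ u - φ v - fderiv ℝ φ v (u - v)| ≤ C * ‖u - v‖ ^ α * ‖u - v‖ := by
  refine (convex_closedBall v ‖u - v‖).norm_image_sub_le_of_norm_fderiv_le'
    (fun ξ _ ↦ hφ.differentiable one_ne_zero ξ) (fun ξ hξ ↦ (hH ξ v).trans ?_)
    (Metric.mem_closedBall_self (norm_nonneg _)) (mem_closedBall_iff_norm.2 le_rfl)
  have := mem_closedBall_iff_norm.1 hξ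
  gcongr

/-- The density in the base coordinates of the double layer kernel of the graph of `φ`, without the
dimensional constant. -/
def graphKernel (φ : EuclideanSpace ℝ (Fin d) → ℝ) (u v : EuclideanSpace ℝ (Fin d)) : ℝ :=
  (φ u - φ v - fderiv ℝ φ v (u - v)) / Real.sqrt (‖u - v‖ ^ 2 + (φ u - φ v) ^ 2) ^ (d + 1)

/-- The boundary term produced when the kernel `graphKernel φ u`, which is a divergence, is
integrated against a cut-off function `η`. -/
def cutoffTerm (φ η : EuclideanSpace ℝ (Fin d) → ℝ) (u v : EuclideanSpace ℝ (Fin d)) : ℝ :=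
  (‖v - u‖ ^ d)⁻¹ * (fderiv ℝ η v (v - u) * slopeFun d ((φ v - φ u) / ‖v - u‖))

theorem norm_eq_rpow_mul_rpow {E : Type*} [NormedAddCommGroup E] {z : E} (hz : z ≠ 0) (α : ℝ) :
    ‖z‖ = ‖z‖ ^ (1 - α) * ‖z‖ ^ α := by
  rw [← Real.rpow_add (norm_pos_iff.2 hz)]; simp

/-- The radial derivative, in `z = v - u`, of the cut-off function times `slopeFun` of the slope of
the chord. The second summand is `‖z‖ ^ d` times the cut-off kernel, the first one `‖z‖ ^ d` times
the boundary term. -/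
theorem hasDerivAt_cutoff_slope (hφ : ContDiff ℝ 1 φ) (hη : ContDiff ℝ 1 η)
    (u : EuclideanSpace ℝ (Fin d)) {z : EuclideanSpace ℝ (Fin d)} (hz : z ≠ 0) :
    HasDerivAt (fun t : ℝ ↦ η (u + t • z) * slopeFun d ((φ (u + t • z) - φ u) / ‖t • z‖))
      (fderiv ℝ η (u + z) z * slopeFun d ((φ (u + z) - φ u) / ‖z‖) +
        η (u + z) * ((Real.sqrt (1 + ((φ (u + z) - φ u) / ‖z‖) ^ 2) ^ (d + 1))⁻¹ *
          ((fderiv ℝ φ (u + z) z - (φ (u + z) - φ u)) / ‖z‖))) 1 := by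
  have hz0 : ‖z‖ ≠ 0 := norm_ne_zero_iff.2 hz
  have hline : HasDerivAt (fun t : ℝ ↦ u + t • z) z 1 := by
    simpa using ((hasDerivAt_id (1 : ℝ)).smul_const z).const_add u
  have hcomp : ∀ {f : EuclideanSpace ℝ (Fin d) → ℝ}, ContDiff ℝ 1 f →
      HasDerivAt (fun t : ℝ ↦ f (u + t • z)) (fderiv ℝ f (u + z) z) 1 := by
    intro f hf
    have h := (hf.differentiable one_ne_zero (u + (1 : ℝ) • z)).hasFDerivAt
    have := h.comp_hasDerivAt (1 : ℝ) hline
    simp only [one_smul] at this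
    exact this
  have hnorm : HasDerivAt (fun t : ℝ ↦ ‖t • z‖) ‖z‖ 1 := by
    have h1 : HasDerivAt (fun t : ℝ ↦ t * ‖z‖) ‖z‖ 1 := by
      simpa using (hasDerivAt_id (1 : ℝ)).mul_const ‖z‖
    refine h1.congr_of_eventuallyEq ?_
    filter_upwards [Ioi_mem_nhds (zero_lt_one' ℝ)] with t ht
    rw [norm_smul, Real.norm_of_nonneg (le_of_lt ht)]
  have hquot : HasDerivAt (fun t : ℝ ↦ (φ (u + t • z) - φ u) / ‖t • z‖)
      ((fderiv ℝ φ (u + z) z - (φ (u + z) - φ u)) / ‖z‖) 1 := by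
    have := ((hcomp hφ).sub_const (φ u)).div hnorm (by simpa using hz0)
    simp only [one_smul] at this
    rw [← sub_mul, sq, mul_div_mul_right _ _ hz0] at this
    exact this
  have hG := (hasDerivAt_slopeFun d
    ((φ (u + (1 : ℝ) • z) - φ u) / ‖(1 : ℝ) • z‖)).comp (1 : ℝ) hquot
  have := (hcomp hη).mul hG
  simp only [one_smul, Function.comp] at this
  exact this

/-- On a `C^{1,α}` graph the double layer kernel is integrated against a cut-off function by parts;
no contribution of the singularity remains, because the slopes of the chords in opposite directions
at `u` cancel in the limit. -/
theorem integral_mul_graphKernel {α C : ℝ} (hd : 1 ≤ d) (hα : 0 < α) (hα1 : α ≤ 1) (hC : 0 ≤ C)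
    (hφ : ContDiff ℝ 1 φ) (hH : ∀ u v, ‖fderiv ℝ φ u - fderiv ℝ φ v‖ ≤ C * ‖u - v‖ ^ α)
    (hη : ContDiff ℝ 1 η) (hηc : HasCompactSupport η) (u : EuclideanSpace ℝ (Fin d)) :
    Integrable (fun v ↦ cutoffTerm φ η u v) ∧
    ∫ v, η v * graphKernel φ u v = -∫ v, cutoffTerm φ η u v := by
  have hηd : Continuous (fderiv ℝ η) := hη.continuous_fderiv one_ne_zero
  have hφd : Continuous (fderiv ℝ φ) := hφ.continuous_fderiv one_ne_zero
  obtain ⟨M, hM⟩ := hη.continuous.bounded_above_of_compact_support hηc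
  obtain ⟨M', hM'⟩ := hηd.bounded_above_of_compact_support (hηc.fderiv (𝕜 := ℝ))
  have hM0 : 0 ≤ M := (norm_nonneg _).trans (hM 0)
  have hM'0 : 0 ≤ M' := (norm_nonneg _).trans (hM' 0)
  obtain ⟨R₀, hR₀⟩ := hηc.isCompact.isBounded.subset_ball (0 : EuclideanSpace ℝ (Fin d))
  set R := |R₀| + ‖u‖ + 1 with hR
  have hRpos : 0 < R := by positivity
  have hout : ∀ z, R ≤ ‖z‖ → u + z ∉ tsupport η := by
    intro z hz hmem
    have h1 := mem_ball_zero_iff.1 (hR₀ hmem)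
    have h2 : ‖z‖ ≤ ‖u + z‖ + ‖u‖ := by
      have := norm_sub_le (u + z) u
      rwa [add_sub_cancel_left] at this
    linarith [le_abs_self R₀]
  have hη0 : ∀ z, R ≤ ‖z‖ → η (u + z) = 0 := fun z hz ↦ image_eq_zero_of_notMem_tsupport (hout z hz)
  have hηd0 : ∀ z, R ≤ ‖z‖ → fderiv ℝ η (u + z) = 0 := fun z hz ↦
    image_eq_zero_of_notMem_tsupport fun h ↦ hout z hz (tsupport_fderiv_subset ℝ h)
  -- the three ingredients, as functions of `z = v - u`
  set h : EuclideanSpace ℝ (Fin d) → ℝ := fun z ↦ (φ (u + z) - φ u) / ‖z‖ with hh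
  set Q : EuclideanSpace ℝ (Fin d) → ℝ := fun z ↦ η (u + z) * slopeFun d (h z) with hQ
  set A : EuclideanSpace ℝ (Fin d) → ℝ := fun z ↦ fderiv ℝ η (u + z) z * slopeFun d (h z) with hA
  set B : EuclideanSpace ℝ (Fin d) → ℝ := fun z ↦ η (u + z) *
    ((Real.sqrt (1 + h z ^ 2) ^ (d + 1))⁻¹ *
      ((fderiv ℝ φ (u + z) z - (φ (u + z) - φ u)) / ‖z‖)) with hB
  have mh : Measurable h := by
    have := hφ.continuous
    exact Measurable.div (by fun_prop) (by fun_prop)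
  have mG : Measurable fun z ↦ slopeFun d (h z) := (continuous_slopeFun d).measurable.comp mh
  have mη : Measurable fun z ↦ η (u + z) := by
    have := hη.continuous
    fun_prop
  have mQ : Measurable Q := mη.mul mG
  have mA : Measurable A := by
    have : Continuous fun z ↦ fderiv ℝ η (u + z) z := by fun_prop
    exact this.measurable.mul mG
  have mB : Measurable B := by
    have h1 : Continuous fun z ↦ fderiv ℝ φ (u + z) z - (φ (u + z) - φ u) := by
      have := hφ.continuous
      fun_prop
    have h2 : Measurable fun z ↦ (Real.sqrt (1 + h z ^ 2) ^ (d + 1))⁻¹ := by fun_prop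
    exact mη.mul (h2.mul (h1.measurable.div measurable_norm))
  -- bounds
  set H := ‖fderiv ℝ φ u‖ + C * R ^ α with hHdef
  have hH0 : 0 ≤ H := by positivity
  have tay : ∀ z, |φ (u + z) - φ u - fderiv ℝ φ u z| ≤ C * ‖z‖ ^ α * ‖z‖ := fun z ↦ by
    simpa using abs_sub_fderiv_le hα hC hφ hH (u + z) u
  have hhb : ∀ z, z ≠ 0 → ‖z‖ < R → |h z| ≤ H := by
    intro z hz hzR
    have hz0 : 0 < ‖z‖ := norm_pos_iff.2 hz
    rw [hh, abs_div, abs_norm, div_le_iff₀ hz0]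
    have h1 := tay z
    have h2 : |fderiv ℝ φ u z| ≤ ‖fderiv ℝ φ u‖ * ‖z‖ := (fderiv ℝ φ u).le_opNorm z
    have h3 : |φ (u + z) - φ u| ≤ |φ (u + z) - φ u - fderiv ℝ φ u z| + |fderiv ℝ φ u z| := by
      simpa using abs_add_le (φ (u + z) - φ u - fderiv ℝ φ u z) (fderiv ℝ φ u z)
    have h4 : ‖z‖ ^ α ≤ R ^ α := by gcongr
    calc _ ≤ C * ‖z‖ ^ α * ‖z‖ + ‖fderiv ℝ φ u‖ * ‖z‖ := by linarith
      _ ≤ C * R ^ α * ‖z‖ + ‖fderiv ℝ φ u‖ * ‖z‖ := by gcongr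
      _ = _ := by rw [hHdef]; ring
  have hrp : ∀ z : EuclideanSpace ℝ (Fin d), z ≠ 0 → ‖z‖ < R →
      ‖z‖ ≤ R ^ (1 - α) * ‖z‖ ^ α := by
    intro z hz hzR
    nth_rewrite 1 [norm_eq_rpow_mul_rpow hz α]
    have : 0 ≤ 1 - α := by linarith
    gcongr
  have hAb : ∀ z, z ≠ 0 → |A z| ≤ M' * R ^ (1 - α) * H * ‖z‖ ^ α := by
    intro z hz
    by_cases hzR : ‖z‖ < R
    · rw [hA, abs_mul]
      calc |fderiv ℝ η (u + z) z| * |slopeFun d (h z)| ≤ (M' * ‖z‖) * H := by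
            gcongr
            · exact ((fderiv ℝ η (u + z)).le_opNorm z).trans (by gcongr; exact hM' _)
            · exact (abs_slopeFun_le d _).trans (hhb z hz hzR)
        _ ≤ (M' * (R ^ (1 - α) * ‖z‖ ^ α)) * H := by gcongr; exact hrp z hz hzR
        _ = _ := by ring
    · simp only [hA, hηd0 z (not_lt.1 hzR)]
      simp
      positivity
  have hBb : ∀ z, z ≠ 0 → |B z| ≤ M * C * ‖z‖ ^ α := by
    intro z hz
    have hz0 : 0 < ‖z‖ := norm_pos_iff.2 hz
    have h1 : |fderiv ℝ φ (u + z) z - (φ (u + z) - φ u)| ≤ C * ‖z‖ ^ α * ‖z‖ := by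
      have := abs_sub_fderiv_le hα hC hφ hH u (u + z)
      rw [sub_add_cancel_left, norm_neg, map_neg] at this
      refine le_of_eq_of_le ?_ this
      congr 1; ring
    have h2 : 1 ≤ Real.sqrt (1 + h z ^ 2) := by
      rw [Real.one_le_sqrt]; nlinarith [sq_nonneg (h z)]
    have h3 : (Real.sqrt (1 + h z ^ 2) ^ (d + 1))⁻¹ ≤ 1 := inv_le_one_of_one_le₀ (one_le_pow₀ h2)
    rw [hB, abs_mul, abs_mul, abs_of_nonneg (by positivity : (0 : ℝ) ≤
      (Real.sqrt (1 + h z ^ 2) ^ (d + 1))⁻¹), abs_div, abs_norm]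
    calc _ ≤ M * (1 * (C * ‖z‖ ^ α * ‖z‖ / ‖z‖)) := by
          gcongr
          exact hM _
      _ = _ := by field_simp
  have hQb : ∀ z, z ≠ 0 →
      |Q z + Q (-z)| ≤ (M' * 2 * R ^ (1 - α) * H + M * (2 * C)) * ‖z‖ ^ α := by
    intro z hz
    have hz0 : 0 < ‖z‖ := norm_pos_iff.2 hz
    by_cases hzR : ‖z‖ < R
    · have e : Q z + Q (-z) = (η (u + z) - η (u + -z)) * slopeFun d (h z) +
          η (u + -z) * (slopeFun d (h z) - slopeFun d (-h (-z))) := by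
        rw [slopeFun_neg, hQ]; ring
      have h1 : |η (u + z) - η (u + -z)| ≤ M' * (2 * ‖z‖) := by
        have := (convex_univ (𝕜 := ℝ)
          (E := EuclideanSpace ℝ (Fin d))).norm_image_sub_le_of_norm_fderiv_le
          (𝕜 := ℝ) (f := η) (C := M') (x := u + -z) (y := u + z)
          (fun x _ ↦ hη.differentiable one_ne_zero x) (fun x _ ↦ hM' x) (mem_univ _) (mem_univ _)
        refine this.trans ?_
        have e : u + z - (u + -z) = (2 : ℝ) • z := by rw [two_smul]; abel
        rw [e, norm_smul]
        simp
      have h2 : |slopeFun d (h z) - slopeFun d (-h (-z))| ≤ 2 * C * ‖z‖ ^ α := by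
        refine (abs_slopeFun_sub_le d _ _).trans ?_
        have e : h z - -h (-z) = ((φ (u + z) - φ u - fderiv ℝ φ u z) +
            (φ (u + -z) - φ u - fderiv ℝ φ u (-z))) / ‖z‖ := by
          simp only [hh, norm_neg, map_neg]; ring
        rw [e, abs_div, abs_norm, div_le_iff₀ hz0]
        refine (abs_add_le _ _).trans ?_
        have t1 := tay z
        have t2 := tay (-z)
        rw [norm_neg] at t2
        linarith
      rw [e]
      refine (abs_add_le _ _).trans ?_
      rw [abs_mul, abs_mul, add_mul]
      refine add_le_add ?_ ?_
      · calc _ ≤ (M' * (2 * ‖z‖)) * H := by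
              gcongr
              exact (abs_slopeFun_le d _).trans (hhb z hz hzR)
          _ ≤ (M' * (2 * (R ^ (1 - α) * ‖z‖ ^ α))) * H := by gcongr; exact hrp z hz hzR
          _ = _ := by ring
      · calc _ ≤ M * (2 * C * ‖z‖ ^ α) := by
              gcongr
              exact hM _
          _ = _ := by ring
    · have h1 : Q z = 0 := by simp [hQ, hη0 z (not_lt.1 hzR)]
      have h2 : Q (-z) = 0 := by
        simp [hQ, hη0 (-z) (by rw [norm_neg]; exact not_lt.1 hzR)]
      rw [h1, h2]
      simp only [add_zero, abs_zero]
      positivity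
  have hA0 : ∀ z, R ≤ ‖z‖ → A z = 0 := fun z hz ↦ by simp [hA, hηd0 z hz]
  have hB0 : ∀ z, R ≤ ‖z‖ → B z = 0 := fun z hz ↦ by simp [hB, hη0 z hz]
  have hint : ∀ {g : EuclideanSpace ℝ (Fin d) → ℝ} {b : ℝ}, Measurable g →
      (∀ z, z ≠ 0 → |g z| ≤ b * ‖z‖ ^ α) → (∀ z, R ≤ ‖z‖ → g z = 0) →
      Integrable fun z ↦ (‖z‖ ^ d)⁻¹ * g z := by
    intro g b hg hb hgR
    refine integrable_of_norm_le_rpow hd hα (C := b) (R := R) (by fun_prop)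
      (fun z hz ↦ ?_) (fun z hz ↦ by rw [hgR z hz, mul_zero])
    rw [abs_mul, abs_of_nonneg (by positivity), Real.rpow_sub (norm_pos_iff.2 hz),
      Real.rpow_natCast]
    calc _ ≤ (‖z‖ ^ d)⁻¹ * (b * ‖z‖ ^ α) := by gcongr; exact hb z hz
      _ = _ := by ring
  have iA := hint mA hAb hA0
  have iB := hint mB hBb hB0
  set K := (M' * 2 * R ^ (1 - α) * H + M * (2 * C)) with hK
  have hRa : 0 < R ^ (1 - α) := by positivity
  have hzero : ∫ z, (‖z‖ ^ d)⁻¹ * (A z + B z) = 0 := by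
    refine integral_radial_deriv_eq_zero hd hα hα1 (Q := Q) (R := R) (C := K) mQ (mA.add mB)
      (fun z hz ↦ hasDerivAt_cutoff_slope hφ hη u hz) hQb (fun z hz ↦ ?_)
      (fun z hz ↦ by simp [hQ, hη0 z hz]) (fun z hz ↦ by simp [hA0 z hz, hB0 z hz])
    refine (abs_add_le _ _).trans ((add_le_add (hAb z hz) (hBb z hz)).trans ?_)
    rw [← add_mul, hK]
    have : 0 ≤ M' * R ^ (1 - α) * H := by positivity
    have : 0 ≤ M * C := by positivity
    gcongr ?_ * _
    linarith
  have eA : ∀ z, cutoffTerm φ η u (u + z) = (‖z‖ ^ d)⁻¹ * A z := fun z ↦ by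
    simp [cutoffTerm, hA, hh]
  have eB : ∀ z, η (u + z) * graphKernel φ u (u + z) = (‖z‖ ^ d)⁻¹ * B z := by
    intro z
    rcases eq_or_ne z 0 with rfl | hz
    · have : (0 : ℝ) ^ d = 0 := zero_pow (by omega)
      simp [graphKernel, this]
    have hz0 : 0 < ‖z‖ := norm_pos_iff.2 hz
    have hs : Real.sqrt (‖u - (u + z)‖ ^ 2 + (φ u - φ (u + z)) ^ 2) =
        ‖z‖ * Real.sqrt (1 + h z ^ 2) := by
      rw [sub_add_cancel_left, norm_neg, ← Real.sqrt_sq hz0.le, ← Real.sqrt_mul (by positivity),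
        Real.sqrt_sq hz0.le]
      congr 1
      simp only [hh]
      field_simp
      ring
    have hs0 : 0 < Real.sqrt (1 + h z ^ 2) := Real.sqrt_pos.2 (by positivity)
    rw [graphKernel, hs, hB, sub_add_cancel_left, map_neg]
    field_simp
    ring
  have key : (∫ z, (‖z‖ ^ d)⁻¹ * B z) = -∫ z, (‖z‖ ^ d)⁻¹ * A z := by
    simp_rw [mul_add] at hzero
    rw [integral_add iA iB] at hzero
    linarith
  constructor
  · have : Integrable fun z ↦ cutoffTerm φ η u (u + z) := by simpa only [eA] using iA
    have h2 := this.comp_add_left (-u)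
    simpa using h2
  · rw [← integral_add_left_eq_self (fun v ↦ η v * graphKernel φ u v) u,
      ← integral_add_left_eq_self (fun v ↦ cutoffTerm φ η u v) u]
    simp_rw [eA, eB]
    exact key

end

section

variable {d : ℕ} {φ η : EuclideanSpace ℝ (Fin d) → ℝ}

theorem contDiff_slopeFun (d : ℕ) : ContDiff ℝ 1 (slopeFun d) := by
  have : deriv (slopeFun d) = fun τ ↦ (Real.sqrt (1 + τ ^ 2) ^ (d + 1))⁻¹ :=
    funext fun h ↦ (hasDerivAt_slopeFun d h).deriv
  rw [contDiff_one_iff_deriv, this]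
  exact ⟨fun h ↦ (hasDerivAt_slopeFun d h).differentiableAt, continuous_slope_integrand d⟩

theorem contDiffAt_cutoffTerm (hφ : ContDiff ℝ 1 φ) (hη : ContDiff ℝ 2 η)
    {w : EuclideanSpace ℝ (Fin d) × EuclideanSpace ℝ (Fin d)} (hw : w.2 - w.1 ≠ 0) :
    ContDiffAt ℝ 1 (fun w : EuclideanSpace ℝ (Fin d) × EuclideanSpace ℝ (Fin d) ↦
      cutoffTerm φ η w.1 w.2) w := by
  have hn : ContDiffAt ℝ 1 (fun w : EuclideanSpace ℝ (Fin d) × EuclideanSpace ℝ (Fin d) ↦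
      ‖w.2 - w.1‖) w := (contDiffAt_snd.sub contDiffAt_fst).norm ℝ hw
  have hn0 : ‖w.2 - w.1‖ ≠ 0 := norm_ne_zero_iff.2 hw
  have hη' : ContDiffAt ℝ 1 (fun w : EuclideanSpace ℝ (Fin d) × EuclideanSpace ℝ (Fin d) ↦
      fderiv ℝ η w.2 (w.2 - w.1)) w := by
    have : ContDiff ℝ 1 (fderiv ℝ η) := hη.fderiv_right (by norm_num)
    exact ((this.comp contDiff_snd).clm_apply (contDiff_snd.sub contDiff_fst)).contDiffAt
  have hq : ContDiffAt ℝ 1 (fun w : EuclideanSpace ℝ (Fin d) × EuclideanSpace ℝ (Fin d) ↦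
      (φ w.2 - φ w.1) / ‖w.2 - w.1‖) w :=
    ((hφ.comp contDiff_snd).sub (hφ.comp contDiff_fst)).contDiffAt.div hn hn0
  exact ((hn.pow d).inv (pow_ne_zero _ hn0)).mul
    (hη'.mul ((contDiff_slopeFun d).contDiffAt.comp w hq))

/-- Away from the region where the cut-off function varies, its boundary term is Lipschitz. -/
theorem exists_abs_integral_cutoffTerm_sub_le (hφ : ContDiff ℝ 1 φ) (hη : ContDiff ℝ 2 η)
    {u₀ : EuclideanSpace ℝ (Fin d)} {R : ℝ}
    (hR : 0 < R) (hη0 : ∀ v, v ∉ Metric.closedBall u₀ (2 * R) \ Metric.ball u₀ R → fderiv ℝ η v = 0)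
    (hint : ∀ u, Integrable (cutoffTerm φ η u)) :
    ∃ C, ∀ u ∈ Metric.ball u₀ (R / 2), ∀ u' ∈ Metric.ball u₀ (R / 2),
      |(∫ v, cutoffTerm φ η u v) - ∫ v, cutoffTerm φ η u' v| ≤ C * ‖u - u'‖ := by
  obtain ⟨L, hL⟩ : ∃ L, LipschitzOnWith L
      (fun w : EuclideanSpace ℝ (Fin d) × EuclideanSpace ℝ (Fin d) ↦ cutoffTerm φ η w.1 w.2)
      (Metric.closedBall u₀ (R / 2) ×ˢ (Metric.closedBall u₀ (2 * R) \ Metric.ball u₀ R)) := by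
    refine LocallyLipschitzOn.exists_lipschitzOnWith_of_compact
      ((isCompact_closedBall _ _).prod ((isCompact_closedBall _ _).diff Metric.isOpen_ball)) ?_
    rintro w ⟨h1, -, h2⟩
    have hw : w.2 - w.1 ≠ 0 := by
      intro h0
      rw [sub_eq_zero.1 h0] at h2
      exact h2 (Metric.closedBall_subset_ball (by linarith) h1)
    obtain ⟨K, t, ht, h⟩ := (contDiffAt_cutoffTerm hφ hη hw).exists_lipschitzOnWith
    exact ⟨K, t, mem_nhdsWithin_of_mem_nhds ht, h⟩
  refine ⟨L * volume.real (Metric.closedBall u₀ (2 * R)), fun u hu u' hu' ↦ ?_⟩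
  rw [← integral_sub (hint u) (hint u'), ← setIntegral_eq_integral_of_forall_compl_eq_zero
    (s := Metric.closedBall u₀ (2 * R)), mul_right_comm, ← Real.norm_eq_abs]
  · have hB : volume (Metric.closedBall u₀ (2 * R)) < ∞ := measure_closedBall_lt_top
    refine norm_setIntegral_le_of_norm_le_const hB fun v hv ↦ ?_
    by_cases hvR : v ∈ Metric.ball u₀ R
    · have h0 : fderiv ℝ η v = 0 := hη0 v fun h ↦ h.2 hvR
      simp only [cutoffTerm, h0]
      simp
      positivity
    · have := hL.dist_le_mul (u, v) ⟨Metric.ball_subset_closedBall hu, hv, hvR⟩ (u', v)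
        ⟨Metric.ball_subset_closedBall hu', hv, hvR⟩
      simpa [Prod.dist_eq, dist_eq_norm] using this
  · intro v hv
    have h0 : fderiv ℝ η v = 0 := hη0 v fun h ↦ hv h.1
    simp [cutoffTerm, h0]

end

/-! ### The double layer potential of the constant function -/

section

variable {d : ℕ} {α : ℝ} {Ω : Set (EuclideanSpace ℝ (Fin (d + 1)))}

/-- In the coordinates of a chart, the double layer potential of a cut-off function is the integral
of its boundary term. -/
theorem IsGraphChart.setIntegral_cutoff_mul_kernelK (hd : 1 ≤ d) (hα : 0 < α) (hα1 : α ≤ 1)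
    {Φ : EuclideanSpace ℝ (Fin (d + 1)) ≃ᵃⁱ[ℝ] WithLp 2 (EuclideanSpace ℝ (Fin d) × ℝ)}
    {φ η : EuclideanSpace ℝ (Fin d) → ℝ} {p x : EuclideanSpace ℝ (Fin (d + 1))} {r : ℝ}
    (h : IsGraphChart α Ω Φ φ p r) {A : Set (EuclideanSpace ℝ (Fin d))} (hA : MeasurableSet A)
    (hAr : ∀ v ∈ A, graphMap Φ φ v ∈ Metric.ball p r) (hη : ContDiff ℝ 1 η)
    (hηc : HasCompactSupport η) (hηA : ∀ v ∉ A, η v = 0)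
    (hx : x ∈ Metric.ball p r) (hxf : x ∈ frontier Ω) :
    ∫ y in graphMap Φ φ '' A, η (Φ y).fst * kernelK Ω x y ∂(Measure.euclideanHausdorffMeasure d) =
      1 / sphereArea d * ∫ v, cutoffTerm φ η (Φ x).fst v := by
  obtain ⟨C, hC0, hC⟩ := h.holder
  set u := (Φ x).fst with hu
  have hxs : (Φ x).snd = φ u := (h.mem_frontier_iff hx).1 hxf
  have hxF : x = graphMap Φ φ u := eq_graphMap Φ hxs
  have key : ∀ v ∈ A, graphDensity φ v *
      (η (Φ (graphMap Φ φ v)).fst * kernelK Ω x (graphMap Φ φ v)) =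
      -(1 / sphereArea d) * (η v * graphKernel φ u v) := by
    intro v hv
    have hvf : graphMap Φ φ v ∈ frontier Ω := by
      rw [h.mem_frontier_iff (hAr v hv), fst_graphMap, snd_graphMap]
    have hJ := (graphDensity_pos (φ := φ) v).ne'
    have hn : ‖x - graphMap Φ φ v‖ = Real.sqrt (‖u - v‖ ^ 2 + (φ u - φ v) ^ 2) := by
      rw [← norm_graphMap_sub_sq Φ, Real.sqrt_sq (norm_nonneg _), ← hxF]
    rw [kernelK, h.outwardNormal_eq (hAr v hv) hvf, inner_graphNormal, hn, fst_graphMap,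
      snd_graphMap, hxs, ← hu, graphKernel]
    field_simp
  rw [IsGraphChart.integral_graph h.contDiff hA, setIntegral_congr_fun hA key, integral_const_mul,
    setIntegral_eq_integral_of_forall_compl_eq_zero fun v hv ↦ by rw [hηA v hv, zero_mul],
    (integral_mul_graphKernel hd hα hα1 hC0 h.contDiff hC hη hηc u).2]
  ring

variable (hΩ : IsOpen Ω) (hreg : HasC1HolderBoundary α Ω) (hΓ : IsCompact (frontier Ω))
include hΩ hreg hΓ

theorem isWeaklySingularKernel_kernelK (hd : 1 ≤ d) (hα : 0 < α) (hα1 : α ≤ 1) :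
    IsWeaklySingularKernel (surfaceMeasure Ω) (frontier Ω) d α (kernelK Ω) :=
  have := isFiniteMeasure_surfaceMeasure hΩ hreg hΓ hd
  { one_le := by exact_mod_cast hd
    pos := hα
    le_one := hα1
    ae_mem := ae_mem_frontier hΓ
    diam := exists_norm_sub_le hΓ
    riesz := fun _ hβ ↦ exists_lintegral_riesz_le hΩ hreg hΓ hd hβ
    meas := aestronglyMeasurable_kernelK hΩ hreg hΓ
    size := exists_abs_kernelK_le hΩ hreg hΓ hα
    diff := exists_abs_kernelK_sub_le hΩ hreg hΓ hα hα1 }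

theorem integrable_kernelK (hd : 1 ≤ d) (hα : 0 < α) (hα1 : α ≤ 1)
    {x : EuclideanSpace ℝ (Fin (d + 1))} (hx : x ∈ frontier Ω) :
    Integrable (kernelK Ω x) (surfaceMeasure Ω) := by
  have := isFiniteMeasure_surfaceMeasure hΩ hreg hΓ hd
  obtain ⟨C, hC⟩ := (isWeaklySingularKernel_kernelK hΩ hreg hΓ hd hα hα1).lintegral_enorm_le
  refine ⟨?_, (hC x hx).trans_lt ENNReal.coe_lt_top⟩
  have h1 : AEStronglyMeasurable (outwardNormal Ω) (surfaceMeasure Ω) :=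
    (continuousOn_outwardNormal hΩ hreg).aestronglyMeasurable hΓ.measurableSet
  have h2 : AEStronglyMeasurable (fun y ↦ x - y) (surfaceMeasure Ω) := by fun_prop
  have h3 := (h2.inner (𝕜 := ℝ) h1).aemeasurable.div ((h2.norm.aemeasurable).pow_const (d + 1))
  exact (h3.const_mul (-(1 / sphereArea d))).aestronglyMeasurable

/-- Near `p` the potential of the constant function is split by a cut-off function `θ` that is
supported in a chart and equal to `1` near `p`. The part with `θ` is an integral of `cutoffTerm`; in
the part with `1 - θ` the kernel is not singular. -/
theorem exists_abs_integral_kernelK_sub_le_local (hd : 1 ≤ d) (hα : 0 < α) (hα1 : α ≤ 1)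
    {p : EuclideanSpace ℝ (Fin (d + 1))} (hp : p ∈ frontier Ω) :
    ∃ ε > 0, ∃ C, ∀ x ∈ frontier Ω ∩ Metric.ball p ε, ∀ x' ∈ frontier Ω ∩ Metric.ball p ε,
      |∫ y, kernelK Ω x y ∂(surfaceMeasure Ω) - ∫ y, kernelK Ω x' y ∂(surfaceMeasure Ω)| ≤
        C * ‖x - x'‖ := by
  have hfin := isFiniteMeasure_surfaceMeasure hΩ hreg hΓ hd
  have hk := isWeaklySingularKernel_kernelK hΩ hreg hΓ hd hα hα1
  obtain ⟨Φ, φ, r, h⟩ := hreg.exists_chart hΩ hp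
  obtain ⟨C₀, hC0, hC⟩ := h.holder
  obtain ⟨C₂, hC₂⟩ := hk.diff
  set u₀ := (Φ p).fst with hu₀
  have hFc := continuous_graphMap Φ h.contDiff.continuous
  have hFp : graphMap Φ φ u₀ = p :=
    (eq_graphMap Φ ((h.mem_frontier_iff (Metric.mem_ball_self h.pos)).1 hp)).symm
  obtain ⟨R, hR, hRr⟩ : ∃ R > 0, ∀ v ∈ Metric.ball u₀ (2 * R),
      graphMap Φ φ v ∈ Metric.ball p r := by
    have := hFc.continuousAt.preimage_mem_nhds (x := u₀)
      (by rw [hFp]; exact Metric.ball_mem_nhds p h.pos)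
    obtain ⟨ρ, hρ, hρr⟩ := Metric.mem_nhds_iff.1 this
    exact ⟨ρ / 2, by positivity, fun v hv ↦ hρr (by rwa [mul_div_cancel₀ _ two_ne_zero] at hv)⟩
  set S := graphMap Φ φ '' Metric.ball u₀ (2 * R) with hS
  have hSm : MeasurableSet S :=
    (measurableEmbedding_graphMap Φ h.contDiff.continuous).measurableSet_image.2
      Metric.isOpen_ball.measurableSet
  have hSf : S ⊆ frontier Ω := by
    rintro _ ⟨v, hv, rfl⟩
    rw [h.mem_frontier_iff (hRr v hv), fst_graphMap, snd_graphMap]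
  let η : ContDiffBump u₀ := ⟨R, 2 * R, hR, by linarith⟩
  have hη0 : ∀ v ∉ Metric.ball u₀ (2 * R), η v = 0 := fun v hv ↦
    η.zero_of_le_dist (not_lt.1 hv)
  have hηd : ∀ v, v ∉ Metric.closedBall u₀ (2 * R) \ Metric.ball u₀ R → fderiv ℝ η v = 0 := by
    intro v hv
    by_cases hvR : v ∈ Metric.ball u₀ R
    · rw [(η.eventuallyEq_one_of_mem_ball hvR).fderiv_eq]
      exact fderiv_const_apply 1
    · refine image_eq_zero_of_notMem_tsupport fun h ↦ hv ⟨?_, hvR⟩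
      have := tsupport_fderiv_subset ℝ h
      rwa [η.tsupport_eq] at this
  obtain ⟨C₁, hC₁⟩ := exists_abs_integral_cutoffTerm_sub_le h.contDiff (η.contDiff (n := 2)) hR hηd
    fun u ↦ (integral_mul_graphKernel hd hα hα1 hC0 h.contDiff hC (η.contDiff (n := 1))
      η.hasCompactSupport u).1
  -- the cut-off function on the surface
  set θ : EuclideanSpace ℝ (Fin (d + 1)) → ℝ := S.indicator fun y ↦ η (Φ y).fst with hθ
  have hθm : Measurable θ := by
    have h1 := Φ.continuous
    have h2 : Continuous fun x ↦ (Φ x).fst := by fun_prop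
    exact (η.continuous.comp h2).measurable.indicator hSm
  have hθ0 : ∀ y, 0 ≤ θ y := fun y ↦ indicator_nonneg (fun y _ ↦ η.nonneg) y
  have hθ1 : ∀ y, θ y ≤ 1 := fun y ↦ by
    rw [hθ]
    exact (indicator_le_self' (fun y _ ↦ η.nonneg) y).trans η.le_one
  set ε := min r R with hε
  have hε0 : 0 < ε := lt_min h.pos hR
  have hθe : ∀ y ∈ frontier Ω ∩ Metric.ball p ε, θ y = 1 := by
    intro y hy
    obtain ⟨v, hv, rfl⟩ := h.frontier_inter_ball_subset (min_le_left _ _) hy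
    have hvR : v ∈ Metric.ball u₀ R := Metric.ball_subset_ball (min_le_right _ _) hv
    rw [hθ, indicator_of_mem (mem_image_of_mem _ (Metric.ball_subset_ball (by linarith) hvR)),
      fst_graphMap]
    exact η.one_of_mem_closedBall (Metric.ball_subset_closedBall hvR)
  have hint := fun x hx ↦ integrable_kernelK hΩ hreg hΓ hd hα hα1 (x := x) hx
  have hint1 : ∀ x ∈ frontier Ω, Integrable (fun y ↦ θ y * kernelK Ω x y) (surfaceMeasure Ω) :=
    fun x hx ↦ (hint x hx).bdd_mul (c := 1) hθm.aestronglyMeasurable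
      (Eventually.of_forall fun y ↦ by rw [Real.norm_of_nonneg (hθ0 y)]; exact hθ1 y)
  have hint2 : ∀ x ∈ frontier Ω,
      Integrable (fun y ↦ (1 - θ y) * kernelK Ω x y) (surfaceMeasure Ω) :=
    fun x hx ↦ ((hint x hx).sub (hint1 x hx)).congr
      (Eventually.of_forall fun y ↦ by simp only [Pi.sub_apply]; ring)
  have hsplit : ∀ x ∈ frontier Ω, ∫ y, kernelK Ω x y ∂(surfaceMeasure Ω) =
      (∫ y, θ y * kernelK Ω x y ∂(surfaceMeasure Ω)) +
        ∫ y, (1 - θ y) * kernelK Ω x y ∂(surfaceMeasure Ω) := by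
    intro x hx
    rw [← integral_add (hint1 x hx) (hint2 x hx)]
    congr 1; ext y; ring
  have hnear : ∀ x ∈ frontier Ω ∩ Metric.ball p r, ∫ y, θ y * kernelK Ω x y ∂(surfaceMeasure Ω) =
      1 / sphereArea d * ∫ v, cutoffTerm φ η (Φ x).fst v := by
    intro x hx
    rw [← h.setIntegral_cutoff_mul_kernelK hd hα hα1 Metric.isOpen_ball.measurableSet hRr
      (η.contDiff (n := 1)) η.hasCompactSupport hη0 hx.2 hx.1, ← hS]
    have e : ∀ y, θ y * kernelK Ω x y = S.indicator (fun y ↦ η (Φ y).fst * kernelK Ω x y) y :=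
      fun y ↦ (indicator_mul_left S _ _).symm
    simp_rw [e]
    rw [integral_indicator hSm, surfaceMeasure, Measure.restrict_restrict hSm,
      inter_eq_left.2 hSf]
  refine ⟨min (ε / 8) (R / 2), by positivity, |1 / sphereArea d| * |C₁| +
    |C₂| * (ε / 2) ^ (α - 1 - d) * (surfaceMeasure Ω).real univ, fun x hx x' hx' ↦ ?_⟩
  have hr : ∀ x ∈ frontier Ω ∩ Metric.ball p (min (ε / 8) (R / 2)),
      x ∈ Metric.ball p r ∧ x ∈ Metric.ball p (ε / 8) ∧ (Φ x).fst ∈ Metric.ball u₀ (R / 2) := by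
    intro x hx
    have h1 := Metric.ball_subset_ball (min_le_left _ _) hx.2
    refine ⟨Metric.ball_subset_ball ?_ h1, h1, ?_⟩
    · have : ε ≤ r := min_le_left _ _
      linarith
    · have h2 := Metric.ball_subset_ball (min_le_right _ _) hx.2
      rw [mem_ball_iff_norm] at h2 ⊢
      exact (norm_fst_sub_le Φ x p).trans_lt h2
  obtain ⟨a1, a2, a3⟩ := hr x hx
  obtain ⟨b1, b2, b3⟩ := hr x' hx'
  rw [hsplit x hx.1, hsplit x' hx'.1, hnear x ⟨hx.1, a1⟩, hnear x' ⟨hx'.1, b1⟩, add_sub_add_comm,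
    add_mul]
  refine (abs_add_le _ _).trans (add_le_add ?_ ?_)
  · rw [← mul_sub, abs_mul, mul_assoc]
    gcongr
    calc _ ≤ C₁ * ‖(Φ x).fst - (Φ x').fst‖ := hC₁ _ a3 _ b3
      _ ≤ |C₁| * ‖x - x'‖ := by
          gcongr
          · exact le_abs_self _
          · exact norm_fst_sub_le Φ x x'
  · rw [← integral_sub (hint2 x hx.1) (hint2 x' hx'.1), mul_right_comm, ← Real.norm_eq_abs]
    refine norm_integral_le_of_norm_le_const ?_
    filter_upwards [hk.ae_mem] with y hy
    rw [← mul_sub, Real.norm_eq_abs, abs_mul]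
    by_cases hyb : y ∈ Metric.ball p ε
    · rw [hθe y ⟨hy, hyb⟩]
      simp
      positivity
    rcases eq_or_ne x x' with rfl | hne
    · simp
    have hxy : ε / 2 ≤ ‖x - y‖ := by
      rw [mem_ball_iff_norm, not_lt] at hyb
      rw [mem_ball_iff_norm] at a2
      have := norm_sub_le_norm_sub_add_norm_sub y x p
      rw [norm_sub_rev y x] at this
      linarith
    have hxx : 2 * ‖x - x'‖ ≤ ‖x - y‖ := by
      rw [mem_ball_iff_norm] at a2 b2
      have := norm_sub_le_norm_sub_add_norm_sub x p x'
      rw [norm_sub_rev p x'] at this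
      linarith
    have hxy0 : x ≠ y := fun e ↦ by
      rw [e, sub_self, norm_zero] at hxy
      linarith
    have hexp : α - 1 - d ≤ 0 := by
      have : (0 : ℝ) ≤ d := by positivity
      linarith
    calc |1 - θ y| * |kernelK Ω x y - kernelK Ω x' y|
        ≤ 1 * (C₂ * (‖x - x'‖ * ‖x - y‖ ^ (α - 1 - d))) := by
          gcongr
          · rw [abs_of_nonneg (by linarith [hθ1 y])]
            linarith [hθ0 y]
          · exact hC₂ x hx.1 x' hx'.1 y hy hne hxy0 hxx
      _ ≤ 1 * (|C₂| * (‖x - x'‖ * (ε / 2) ^ (α - 1 - d))) := by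
          gcongr 1 * (?_ * (_ * ?_))
          · exact le_abs_self _
          · exact Real.rpow_le_rpow_of_nonpos (by positivity) hxy hexp
      _ = _ := by ring

/-- The double layer potential of the constant function is Lipschitz on a `C^{1,α}` boundary. -/
theorem exists_abs_integral_kernelK_sub_le (hd : 1 ≤ d) (hα : 0 < α) (hα1 : α ≤ 1) :
    ∃ C, ∀ x ∈ frontier Ω, ∀ x' ∈ frontier Ω,
      |∫ y, kernelK Ω x y ∂(surfaceMeasure Ω) - ∫ y, kernelK Ω x' y ∂(surfaceMeasure Ω)| ≤
        C * ‖x - x'‖ := by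
  have := isFiniteMeasure_surfaceMeasure hΩ hreg hΓ hd
  obtain ⟨B, hB⟩ := (isWeaklySingularKernel_kernelK hΩ hreg hΓ hd hα hα1).lintegral_enorm_le
  have hB' : ∀ x ∈ frontier Ω, |∫ y, kernelK Ω x y ∂(surfaceMeasure Ω)| ≤ B := by
    intro x hx
    have := (enorm_integral_le_lintegral_enorm (μ := surfaceMeasure Ω)
      (kernelK Ω x)).trans (hB x hx)
    rw [← Real.norm_eq_abs]
    exact_mod_cast enorm_le_coe.1 this
  obtain ⟨δ, hδ, C, hC⟩ := exists_uniform_of_local hΓ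
    (P := fun C U ↦ ∀ x ∈ frontier Ω ∩ U, ∀ x' ∈ frontier Ω ∩ U,
      |∫ y, kernelK Ω x y ∂(surfaceMeasure Ω) - ∫ y, kernelK Ω x' y ∂(surfaceMeasure Ω)| ≤
        C * ‖x - x'‖)
    (fun C C' U hCC h x hx x' hx' ↦ (h x hx x' hx').trans (by gcongr))
    (fun C U V hUV h x hx x' hx' ↦ h x ⟨hx.1, hUV hx.2⟩ x' ⟨hx'.1, hUV hx'.2⟩)
    (fun p hp ↦ exists_abs_integral_kernelK_sub_le_local hΩ hreg hΓ hd hα hα1 hp)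
  refine ⟨max C (2 * B / δ), fun x hx x' hx' ↦ ?_⟩
  rcases lt_or_ge ‖x' - x‖ δ with hlt | hge
  · refine (hC x hx x ⟨hx, Metric.mem_ball_self hδ⟩ x' ⟨hx', mem_ball_iff_norm.2 hlt⟩).trans ?_
    gcongr
    exact le_max_left _ _
  · rw [norm_sub_rev] at hge
    calc _ ≤ |∫ y, kernelK Ω x y ∂(surfaceMeasure Ω)| + |∫ y, kernelK Ω x' y ∂(surfaceMeasure Ω)| :=
          abs_sub _ _
      _ ≤ 2 * B / δ * δ := by
          rw [div_mul_cancel₀ _ hδ.ne']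
          linarith [hB' x hx, hB' x' hx']
      _ ≤ max C (2 * B / δ) * ‖x - x'‖ := by
          gcongr
          exact le_max_right _ _

/-- The double layer kernel has the properties on which the gain of derivatives rests. -/
theorem isSmoothingKernel_kernelK (hd : 1 ≤ d) (hα : 0 < α) (hα1 : α ≤ 1) :
    IsSmoothingKernel (surfaceMeasure Ω) (frontier Ω) d α (kernelK Ω) :=
  { isWeaklySingularKernel_kernelK hΩ hreg hΓ hd hα hα1 with
    one := exists_abs_integral_kernelK_sub_le hΩ hreg hΓ hd hα hα1 }

end

end NeumannPoincare

end

theorem corollaryA3 {𝕜 : Type*} [RCLike 𝕜] (d : ℕ) (hd : 1 ≤ d)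
    (Ω : Set (EuclideanSpace ℝ (Fin (d + 1)))) (hopen : IsOpen Ω) (hconn : IsConnected Ω)
    (hbdd : Bornology.IsBounded Ω) (α : ℝ) (hα : 0 < α) (hα1 : α ≤ 1)
    (hreg : NeumannPoincare.HasC1HolderBoundary α Ω) :
    (∀ (c : 𝕜) (f : NeumannPoincare.L2 𝕜 Ω), c ≠ 0 →
      NeumannPoincare.IsEigenfunctionK Ω c f → f ∈ NeumannPoincare.HHalf 𝕜 Ω) ∧
    (∀ (c : 𝕜) (g : NeumannPoincare.HNegHalf 𝕜 Ω), c ≠ 0 →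
      NeumannPoincare.IsEigenfunctionKStar Ω c g → NeumannPoincare.BelongsToL2 g) := by
  have hΓ : IsCompact (frontier Ω) :=
    Metric.isCompact_of_isClosed_isBounded isClosed_frontier
      (hbdd.closure.subset frontier_subset_closure)
  have := NeumannPoincare.isFiniteMeasure_surfaceMeasure hopen hreg hΓ hd
  have hk := NeumannPoincare.isSmoothingKernel_kernelK hopen hreg hΓ hd hα hα1
  exact ⟨fun c f hc hf ↦ hf.mem_HHalf hk hc, fun c g hc hg ↦ hg.belongsToL2 hk hc⟩
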